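/- **Theorem.** Let $k$ be a field of characteristic $p>0$ and let $f:X\to S$ be a smooth morphism of $k$-schemes. *Notation.* $\mathcal Diff(X/S)=\bigcup_m\mathcal Diff^m\subset\mathcal End_{\mathcal O_S}(\mathcal O_X)$ is the sheaf of $\mathcal O_S$-linear differential operators: $\mathcal Diff^0=\mathcal O_X$ (acting by multiplication), and $D\in\mathcal Diff^m$ (i.e. $\operatorname{ord}D\le m$) if $D\circ a-a\circ D\in\mathcal Diff^{m-1}$ for all local sections $a$ of $\mathcal O_X$. A stratification on a quasi-coherent $\mathcal O_X$-module $E$ is an $\mathcal O_S$-linear homomorphism of sheaves of algebras $\nabla:\mathcal Diff(X/S)\to\mathcal End_{\mathcal O_S}(E)$ such that $\nabla(a)$ is multiplication by $a$ for $a\in\mathcal O_X$. Put $X^{(0)}=X$, and let $X^{(i+1)}=X^{(i)}\times_{S,F_S}S$, an $S$-scheme by the second projection, where $F_S$ is the absolute Frobenius of $S$. Let $F:X^{(i)}\to X^{(i+1)}$ be the relative Frobenius over $S$, and $F^i:X\to X^{(i)}$ the $i$-fold composite. For $t\in\mathcal O_S$ and $a\in\mathcal O_X$ write $t\otimes a$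 for the product of the pullbacks of $t$ and $a$ to $X^{(i)}$. A connection on an $\mathcal O_{X^{(i)}}$-module $M$ is an $\mathcal O_{X^{(i)}}$-linear map $\nabla:\mathcal Der(X^{(i)}/S)\to\mathcal End_{\mathcal O_S}(M)$ with $\nabla(\delta)(rm)=r\nabla(\delta)(m)+\delta(r)m$; it is integrable if $\nabla([\delta,\delta'])=[\nabla(\delta),\nabla(\delta')]$, and has $p$-curvature $0$ if $\nabla(\delta^p)=\nabla(\delta)^p$; $\ker\nabla$ is the subsheaf of sections killed by all $\nabla(\delta)$. Let $(E,\nabla)$ be a stratified sheaf on $X/S$. For $i\ge0$ let $E^{(i)}\subset E$ consist of the sections $e$ with $\nabla(D)(e)=0$ for all local differential operators $D$ with $\operatorname{ord}(D)<p^i$ and $D(1)=0$ (so $E^{(0)}=E$). Then, for all $i\ge 0$: 1. $E^{(i)}$ is a subsheaf of $f^{-1}\mathcal O_S$-modules of $E$, and it is a quasi-coherent sheaf on $X^{(i)}$: it is (via $F^i$) an $\mathcal O_{X^{(i)}}$-submodule of $F^i_*E$, the action being $(t\otimes a)e=t\,a^{p^i}e$. 2. There is a unique connection $\nabla^{(i)}$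 on the $\mathcal O_{X^{(i)}}$-module $E^{(i)}$ induced by $\nabla$, in the sense that $\nabla^{(i)}(\delta)(e)=\nabla(P)(e)$ whenever $\delta$ is a local section of $\mathcal Der(X^{(i)}/S)$ and $P$ is a differential operator on $X/S$ with $\operatorname{ord}(P)\le p^i$ and $P\circ (F^{i})^\sharp=(F^{i})^\sharp\circ\delta$. It is integrable and has $p$-curvature $0$. 3. $E^{(i+1)}=\ker\nabla^{(i)}$ as subsheaves of $E$, and the map $F^*E^{(i+1)}\to E^{(i)}$ adjoint to the inclusion $E^{(i+1)}\subset F_*E^{(i)}$ is an isomorphism. 4. Conversely, let $E^i$ $(i\ge0)$ be quasi-coherent sheaves on $X^{(i)}$ with isomorphisms $\sigma_i:F^*E^{i+1}\cong E^{i}$ $(i\ge0)$. Then there is a unique stratification on $E=E^0$ such that, for every $i\ge0$, the composite $E^{i+1}\to F_*E^{i}\to\cdots\to F^{i+1}_*E^0$ of the maps adjoint to $\sigma_i,\dots,\sigma_0$ is an isomorphism of $E^{i+1}$ onto $E^{(i+1)}$. -/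

import Mathlib

open CategoryTheory AlgebraicGeometry Limits TopologicalSpace

universe u

noncomputable section

namespace KatzGieseker

/-! ### Frobenius -/

section Frobenius

theorem natCast_eq_zero_of_over {k : Type u} [Field k] (p : ℕ) [CharP k p] {X : Scheme.{u}}
    (s : X ⟶ Spec (.of k)) (U : X.Opens) : (p : Γ(X, U)) = 0 := by
  have h : (p : k) = 0 := CharP.cast_eq_zero k p
  let φ : k →+* Γ(X, U) := ((Scheme.ΓSpecIso (.of k)).inv ≫ s.appLE ⊤ U le_top).hom
  rw [← map_natCast φ, h, map_zero]

variable {k : Type u} [Field k] (p : ℕ) [hp : Fact p.Prime] [CharP k p]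

/-- The ring homomorphism `a ↦ a ^ p` of a commutative ring in which `p = 0`
(the zero ring is allowed). -/
def powHom {R : Type*} [CommRing R] (h : (p : R) = 0) : R →+* R where
  toFun a := a ^ p
  map_one' := one_pow p
  map_mul' a b := mul_pow a b p
  map_zero' := zero_pow hp.out.ne_zero
  map_add' a b := by
    obtain ⟨r, hr⟩ := exists_add_pow_prime_eq hp.out a b
    simp [hr, h]

/-- The absolute Frobenius of a scheme over a field of characteristic `p`: the identity on the
underlying space and `a ↦ a ^ p` on sections. -/
def absFrobenius {X : Scheme.{u}} (s : X ⟶ Spec (.of k)) : X ⟶ X where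
  base := 𝟙 _
  c :=
    { app U := CommRingCat.ofHom (powHom p (natCast_eq_zero_of_over p s U.unop))
      naturality U V i := by
        ext a
        exact (map_pow (X.presheaf.map i).hom a p).symm }
  prop x := by
    refine ⟨fun a ha => ?_⟩
    obtain ⟨U, hx, a, rfl⟩ := X.presheaf.exists_germ_eq a
    rw [PresheafedSpace.stalkMap_germ_apply] at ha
    have ha' : IsUnit (X.presheaf.germ U x hx (a ^ p)) := ha
    rw [map_pow] at ha'
    exact (isUnit_pow_iff hp.out.ne_zero).1 ha'

theorem absFrobenius_comp {X S : Scheme.{u}} (f : X ⟶ S) (s : S ⟶ Spec (.of k)) :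
    absFrobenius p (f ≫ s) ≫ f = f ≫ absFrobenius p s := by
  refine Scheme.Hom.ext rfl fun U => ?_
  ext a
  have h : X.presheaf.map (𝟙 (Opposite.op (f ⁻¹ᵁ U))) = 𝟙 _ := X.presheaf.map_id _
  have h' := congr($h ((f.app U).hom a ^ p))
  exact h'.trans (map_pow (f.app U).hom a p).symm

variable {S : Scheme.{u}} (s : S ⟶ Spec (.of k))

/-- The Frobenius twist `Y^{(1)} = Y ×_{S, F_S} S` of a scheme `Y` over `S`, as a scheme over `S`
through the second projection. -/
def frobTwist (Y : Over S) : Over S :=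
  Over.mk (pullback.snd Y.hom (absFrobenius p s))

/-- The relative Frobenius `F_{Y/S} : Y ⟶ Y^{(1)}`, with components the absolute Frobenius of `Y`
and the structure morphism of `Y`. -/
def relFrobenius (Y : Over S) : Y.left ⟶ (frobTwist p s Y).left :=
  pullback.lift (absFrobenius p (Y.hom ≫ s)) Y.hom (absFrobenius_comp p Y.hom s)

variable {X : Scheme.{u}} (f : X ⟶ S)

/-- The iterated Frobenius twist of `X / S` as an object over `S`. -/
def twistOver : ℕ → Over S
  | 0 => Over.mk f
  | i + 1 => frobTwist p s (twistOver i)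

/-- The scheme `X^{(i)}`. -/
abbrev twist (i : ℕ) : Scheme.{u} := (twistOver p s f i).left

/-- The structure morphism `X^{(i)} ⟶ S`. -/
abbrev twistHom (i : ℕ) : twist p s f i ⟶ S := (twistOver p s f i).hom

/-- The projection `X^{(i)} ⟶ X` (with `a ↦ 1 ⊗ a` on functions). -/
def twistProj : ∀ i : ℕ, twist p s f i ⟶ X
  | 0 => 𝟙 X
  | i + 1 => pullback.fst (twistHom p s f i) (absFrobenius p s) ≫ twistProj i

/-- The relative Frobenius `X^{(i)} ⟶ X^{(i+1)}` of `X^{(i)} / S`. -/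
def frob (i : ℕ) : twist p s f i ⟶ twist p s f (i + 1) :=
  relFrobenius p s (twistOver p s f i)

/-- The `i`-fold relative Frobenius `X ⟶ X^{(i)}`. -/
def frobIter : ∀ i : ℕ, X ⟶ twist p s f i
  | 0 => 𝟙 X
  | i + 1 => frobIter i ≫ frob p s f i

end Frobenius

/-! ### Differential operators -/

section DiffOps

variable {X S : Scheme.{u}}

/-- Restriction of functions. -/
abbrev resO {U V : X.Opens} (h : V ≤ U) : Γ(X, U) →+* Γ(X, V) :=
  (X.presheaf.map (homOfLE h).op).hom

/-- Restriction of sections of a sheaf of modules. -/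
abbrev resM (E : X.Modules) {U V : X.Opens} (h : V ≤ U) : Γ(E, U) →+ Γ(E, V) :=
  (E.presheaf.map (homOfLE h).op).hom

theorem resO_resO {U V W : X.Opens} (h : V ≤ U) (h' : W ≤ V) (a : Γ(X, U)) :
    resO h' (resO h a) = resO (h'.trans h) a := by
  simp only [resO, ← CommRingCat.comp_apply, ← Functor.map_comp]
  rfl

/-- Families of additive endomorphisms of `Γ(X, V)`, one for each open `V ≤ U`, with pointwise
addition and composition. -/
abbrev OpFamily (X : Scheme.{u}) (U : X.Opens) : Type u :=
  ∀ V : {V : X.Opens // V ≤ U}, AddMonoid.End Γ(X, V.1)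

/-- Restriction of a family of endomorphisms to a smaller open set. -/
def OpFamily.res {U U' : X.Opens} (h : U' ≤ U) : OpFamily X U →+* OpFamily X U' :=
  RingHom.pi fun V => Pi.evalRingHom _ (⟨V.1, V.2.trans h⟩ : {V : X.Opens // V ≤ U})

/-- Multiplication by `a ∈ Γ(X, U)`. -/
def scalarOp {U : X.Opens} (a : Γ(X, U)) : OpFamily X U :=
  fun V => AddMonoidHom.mulLeft (resO V.2 a)

/-- The sections over `U` of the sheaf of rings `ℰnd_{𝒪_S}(𝒪_X)`: endomorphisms of the sheaf
`𝒪_X` restricted to `U` that are linear over functions coming from `S`. -/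
def endSections (f : X ⟶ S) (U : X.Opens) : Subring (OpFamily X U) where
  carrier := {D |
    (∀ (V W : {V : X.Opens // V ≤ U}) (h : W.1 ≤ V.1) (a : Γ(X, V.1)), resO h (D V a) = D W (resO h a)) ∧
    (∀ (V : {V : X.Opens // V ≤ U}) (T : S.Opens) (h : V.1 ≤ f ⁻¹ᵁ T) (t : Γ(S, T)) (a : Γ(X, V.1)),
      D V ((f.appLE T V.1 h).hom t * a) = (f.appLE T V.1 h).hom t * D V a)}
  mul_mem' {D D'} hD hD' := by
    refine ⟨fun V W h a => ?_, fun V T h t a => ?_⟩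
    · change resO h (D V (D' V a)) = D W (D' W (resO h a))
      rw [hD.1 V W h, hD'.1 V W h]
    · change D V (D' V (_ * a)) = _ * D V (D' V a)
      rw [hD'.2 V T h, hD.2 V T h]
  one_mem' := ⟨fun _ _ _ _ => rfl, fun _ _ _ _ _ => rfl⟩
  add_mem' {D D'} hD hD' := by
    refine ⟨fun V W h a => ?_, fun V T h t a => ?_⟩
    · change resO h (D V a + D' V a) = D W (resO h a) + D' W (resO h a)
      rw [map_add, hD.1 V W h, hD'.1 V W h]
    · change D V (_ * a) + D' V (_ * a) = _ * (D V a + D' V a)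
      rw [hD.2 V T h, hD'.2 V T h, mul_add]
  zero_mem' := by
    refine ⟨fun V W h a => ?_, fun V T h t a => ?_⟩
    · exact map_zero (resO h)
    · exact (mul_zero _).symm
  neg_mem' {D} hD := by
    refine ⟨fun V W h a => ?_, fun V T h t a => ?_⟩
    · change resO h (-D V a) = -D W (resO h a)
      rw [map_neg, hD.1 V W h]
    · change -D V (_ * a) = _ * -D V a
      rw [hD.2 V T h, mul_neg]

/-- `IsOrderLE m U D` says that `D` is of order at most `m` on `U`: multiplication by a function
if `m = 0`, and for `m + 1` that `D_a = D ∘ a - a ∘ D` is of order at most `m` for every local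
section `a` of `𝒪_X` over an open subset of `U`. -/
def IsOrderLE : ℕ → ∀ U : X.Opens, OpFamily X U → Prop
  | 0, _, D => ∃ a, D = scalarOp a
  | m + 1, U, D => ∀ (V : X.Opens) (h : V ≤ U) (a : Γ(X, V)),
      IsOrderLE m V (D.res h * scalarOp a - scalarOp a * D.res h)

theorem res_scalarOp {U V : X.Opens} (h : V ≤ U) (a : Γ(X, U)) :
    OpFamily.res h (scalarOp a) = scalarOp (resO h a) := by
  funext W
  ext b
  change resO _ a * b = resO _ (resO h a) * b
  rw [resO_resO]

theorem res_res {U V W : X.Opens} (h : V ≤ U) (h' : W ≤ V) (D : OpFamily X U) :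
    (D.res h).res h' = D.res (h'.trans h) := rfl

theorem res_self {U : X.Opens} (D : OpFamily X U) : D.res le_rfl = D := rfl

theorem scalarOp_add {U : X.Opens} (a b : Γ(X, U)) :
    scalarOp (a + b) = scalarOp a + scalarOp b := by
  funext W
  ext c
  change resO _ (a + b) * c = resO _ a * c + resO _ b * c
  rw [map_add, add_mul]

theorem scalarOp_mul {U : X.Opens} (a b : Γ(X, U)) :
    scalarOp (a * b) = scalarOp a * scalarOp b := by
  funext W
  ext c
  change resO _ (a * b) * c = resO _ a * (resO _ b * c)
  rw [map_mul, mul_assoc]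

theorem scalarOp_zero {U : X.Opens} : scalarOp (0 : Γ(X, U)) = 0 := by
  funext W
  ext c
  change resO _ 0 * c = 0
  rw [map_zero, zero_mul]

theorem scalarOp_one {U : X.Opens} : scalarOp (1 : Γ(X, U)) = 1 := by
  funext W
  ext c
  change resO _ 1 * c = c
  rw [map_one, one_mul]

theorem scalarOp_neg {U : X.Opens} (a : Γ(X, U)) : scalarOp (-a) = -scalarOp a := by
  rw [eq_neg_iff_add_eq_zero, ← scalarOp_add, neg_add_cancel, scalarOp_zero]

theorem scalarOp_comm {U : X.Opens} (a b : Γ(X, U)) :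
    scalarOp a * scalarOp b - scalarOp b * scalarOp a = 0 := by
  rw [← scalarOp_mul, ← scalarOp_mul, mul_comm, sub_self]

theorem neg_commutator {R : Type*} [Ring R] (x y : R) :
    -x * y - y * -x = -(x * y - y * x) := by
  rw [neg_mul, mul_neg]
  abel

namespace IsOrderLE

theorem zero : ∀ (m : ℕ) (U : X.Opens), IsOrderLE m U 0
  | 0, _ => ⟨0, scalarOp_zero.symm⟩
  | m + 1, U => fun V h a => by simpa using zero m V

theorem res : ∀ {m : ℕ} {U V : X.Opens} (h : V ≤ U) {D : OpFamily X U},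
    IsOrderLE m U D → IsOrderLE m V (D.res h)
  | 0, _, _, h, _, ⟨a, ha⟩ => ⟨resO h a, by rw [ha, res_scalarOp]⟩
  | _ + 1, _, _, h, _, hD => fun W h' a => hD W (h'.trans h) a

theorem succ : ∀ {m : ℕ} {U : X.Opens} {D : OpFamily X U},
    IsOrderLE m U D → IsOrderLE (m + 1) U D
  | 0, _, _, ⟨a, ha⟩ => fun V h b => by
      rw [ha, res_scalarOp, scalarOp_comm]
      exact zero 0 V
  | _ + 1, _, _, hD => fun V h a => succ (hD V h a)

theorem mono {m n : ℕ} (hmn : m ≤ n) {U : X.Opens} {D : OpFamily X U} (hD : IsOrderLE m U D) :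
    IsOrderLE n U D := by
  induction hmn with
  | refl => exact hD
  | step _ ih => exact ih.succ

theorem add : ∀ {m : ℕ} {U : X.Opens} {D D' : OpFamily X U},
    IsOrderLE m U D → IsOrderLE m U D' → IsOrderLE m U (D + D')
  | 0, _, _, _, ⟨a, ha⟩, ⟨b, hb⟩ => ⟨a + b, by rw [ha, hb, scalarOp_add]⟩
  | m + 1, _, D, D', hD, hD' => fun V h a => by
      have := add (hD V h a) (hD' V h a)
      rw [map_add]
      convert this using 1
      noncomm_ring

theorem neg : ∀ {m : ℕ} {U : X.Opens} {D : OpFamily X U},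
    IsOrderLE m U D → IsOrderLE m U (-D)
  | 0, _, _, ⟨a, ha⟩ => ⟨-a, by rw [ha, scalarOp_neg]⟩
  | m + 1, _, D, hD => fun V h a => by
      have := neg (hD V h a)
      rw [map_neg]
      convert this using 1
      exact neg_commutator _ _

theorem mul_aux : ∀ (N : ℕ) {m n : ℕ} {U : X.Opens} {D D' : OpFamily X U}, m + n = N →
    IsOrderLE m U D → IsOrderLE n U D' → IsOrderLE N U (D * D')
  | 0, m, n, U, D, D', hN, hD, hD' => by
      obtain ⟨rfl, rfl⟩ : m = 0 ∧ n = 0 := by omega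
      obtain ⟨a, rfl⟩ := hD
      obtain ⟨b, rfl⟩ := hD'
      exact ⟨a * b, (scalarOp_mul a b).symm⟩
  | N + 1, m, n, U, D, D', hN, hD, hD' => fun V h a => by
      have key : OpFamily.res h (D * D') * scalarOp a - scalarOp a * OpFamily.res h (D * D') =
          D.res h * (D'.res h * scalarOp a - scalarOp a * D'.res h) +
            (D.res h * scalarOp a - scalarOp a * D.res h) * D'.res h := by
        rw [map_mul, mul_sub, sub_mul]
        simp only [mul_assoc]
        abel
      rw [key]
      refine add ?_ ?_
      · cases n with
        | zero =>
          obtain ⟨b, rfl⟩ := hD'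
          rw [res_scalarOp, scalarOp_comm, mul_zero]
          exact zero N V
        | succ n => exact mul_aux N (by omega) (hD.res h) (hD' V h a)
      · cases m with
        | zero =>
          obtain ⟨b, rfl⟩ := hD
          rw [res_scalarOp, scalarOp_comm, zero_mul]
          exact zero N V
        | succ m => exact mul_aux N (by omega) (hD V h a) (hD'.res h)

end IsOrderLE

theorem res_mem_endSections (f : X ⟶ S) {U V : X.Opens} (h : V ≤ U) {D : OpFamily X U}
    (hD : D ∈ endSections f U) : D.res h ∈ endSections f V :=
  ⟨fun A B hBA a => hD.1 ⟨A.1, A.2.trans h⟩ ⟨B.1, B.2.trans h⟩ hBA a,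
    fun A T hT t a => hD.2 ⟨A.1, A.2.trans h⟩ T hT t a⟩

theorem scalarOp_mem_endSections (f : X ⟶ S) {U : X.Opens} (a : Γ(X, U)) :
    scalarOp a ∈ endSections f U := by
  refine ⟨fun V W h b => ?_, fun V T h t b => ?_⟩
  · change resO h (resO _ a * b) = resO _ a * resO h b
    rw [map_mul, resO_resO]
  · exact mul_left_comm _ _ _

/-- The sections over `U` of the sheaf of rings `𝒟iff(X/S) = ⋃ₘ 𝒟iff^m` of differential operators.
The union is one of sheaves, so a section is an element of `ℰnd_{𝒪_S}(𝒪_X)(U)` that is locally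
of finite order. -/
def diffOps (f : X ⟶ S) (U : X.Opens) : Subring (OpFamily X U) where
  carrier := {D | D ∈ endSections f U ∧
    ∀ x ∈ U, ∃ (V : X.Opens) (h : V ≤ U), x ∈ V ∧ ∃ m, IsOrderLE m V (D.res h)}
  mul_mem' {D D'} hD hD' := by
    refine ⟨mul_mem hD.1 hD'.1, fun x hx => ?_⟩
    obtain ⟨V, h, hxV, m, hm⟩ := hD.2 x hx
    obtain ⟨V', h', hxV', m', hm'⟩ := hD'.2 x hx
    refine ⟨V ⊓ V', inf_le_left.trans h, ⟨hxV, hxV'⟩, m + m', ?_⟩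
    rw [map_mul]
    exact IsOrderLE.mul_aux _ rfl (hm.res inf_le_left) (hm'.res inf_le_right)
  one_mem' := ⟨one_mem _, fun x hx => ⟨U, le_rfl, hx, 0, 1, scalarOp_one.symm⟩⟩
  add_mem' {D D'} hD hD' := by
    refine ⟨add_mem hD.1 hD'.1, fun x hx => ?_⟩
    obtain ⟨V, h, hxV, m, hm⟩ := hD.2 x hx
    obtain ⟨V', h', hxV', m', hm'⟩ := hD'.2 x hx
    refine ⟨V ⊓ V', inf_le_left.trans h, ⟨hxV, hxV'⟩, max m m', ?_⟩
    rw [map_add]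
    exact ((hm.res inf_le_left).mono (le_max_left _ _)).add
      ((hm'.res inf_le_right).mono (le_max_right _ _))
  zero_mem' := ⟨zero_mem _, fun x hx => ⟨U, le_rfl, hx, 0, IsOrderLE.zero 0 U⟩⟩
  neg_mem' {D} hD := by
    refine ⟨neg_mem hD.1, fun x hx => ?_⟩
    obtain ⟨V, h, hxV, m, hm⟩ := hD.2 x hx
    exact ⟨V, h, hxV, m, by rw [map_neg]; exact hm.neg⟩

/-- Restriction of differential operators. -/
def diffOps.res (f : X ⟶ S) {U V : X.Opens} (h : V ≤ U) (D : diffOps f U) : diffOps f V :=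
  ⟨D.1.res h, res_mem_endSections f h D.2.1, fun x hx => by
    obtain ⟨W, hW, hxW, m, hm⟩ := D.2.2 x (h hx)
    exact ⟨W ⊓ V, inf_le_right, ⟨hxW, hx⟩, m, hm.res inf_le_left⟩⟩

/-- Multiplication by a function, as a differential operator. -/
def diffOps.scalar (f : X ⟶ S) {U : X.Opens} (a : Γ(X, U)) : diffOps f U :=
  ⟨scalarOp a, scalarOp_mem_endSections f a, fun _ hx => ⟨U, le_rfl, hx, 0, a, rfl⟩⟩

/-- The sections over `U` of the sheaf `𝒟er(X/S)` of `𝒪_S`-linear derivations of `𝒪_X`. -/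
def derivations (f : X ⟶ S) (U : X.Opens) : AddSubgroup (OpFamily X U) where
  carrier := {D | D ∈ endSections f U ∧
    ∀ (V : {V : X.Opens // V ≤ U}) (a b : Γ(X, V.1)), D V (a * b) = a * D V b + D V a * b}
  add_mem' {D D'} hD hD' := ⟨add_mem hD.1 hD'.1, fun V a b => by
    change D V (a * b) + D' V (a * b) = a * (D V b + D' V b) + (D V a + D' V a) * b
    rw [hD.2, hD'.2]
    ring⟩
  zero_mem' := ⟨zero_mem _, fun V a b => by
    change (0 : Γ(X, V.1)) = a * 0 + 0 * b
    ring⟩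
  neg_mem' {D} hD := ⟨neg_mem hD.1, fun V a b => by
    change -D V (a * b) = a * -D V b + -D V a * b
    rw [hD.2]
    ring⟩

/-- Restriction of derivations. -/
def derivations.res (f : X ⟶ S) {U V : X.Opens} (h : V ≤ U) (D : derivations f U) :
    derivations f V :=
  ⟨D.1.res h, res_mem_endSections f h D.2.1, fun W a b => D.2.2 ⟨W.1, W.2.trans h⟩ a b⟩

/-- The product `c D` of a function and a derivation. -/
def derivations.smul (f : X ⟶ S) {U : X.Opens} (c : Γ(X, U)) (D : derivations f U) :
    derivations f U :=
  ⟨scalarOp c * D.1, mul_mem (scalarOp_mem_endSections f c) D.2.1, fun V a b => by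
    change resO _ c * D.1 V (a * b) = a * (resO _ c * D.1 V b) + resO _ c * D.1 V a * b
    rw [D.2.2]
    ring⟩

end DiffOps

/-! ### Stratifications and connections -/

section Structures

variable {X S : Scheme.{u}}

/-- A stratification on `E`, that is, an action of the sheaf of rings `𝒟iff(X/S)` on `E` extending
the multiplication by functions. The endomorphism `∇(D)` of `E` restricted to `U` is, on an open
`V ≤ U`, the action of the restriction of `D` to `V`; it is automatically `𝒪_S`-linear because
`D` commutes with functions from `S`. -/
@[ext]
structure Stratification (f : X ⟶ S) (E : X.Modules) where
  /-- the action of differential operators on sections -/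
  nabla (U : X.Opens) : diffOps f U →+* AddMonoid.End Γ(E, U)
  nabla_res {U V : X.Opens} (h : V ≤ U) (D : diffOps f U) (e : Γ(E, U)) :
    resM E h (nabla U D e) = nabla V (diffOps.res f h D) (resM E h e)
  nabla_scalar {U : X.Opens} (a : Γ(X, U)) (e : Γ(E, U)) :
    nabla U (diffOps.scalar f a) e = a • e

/-- The subsheaf of `E` of sections killed by `∇(D)` for all (local) differential operators `D`
of order `< N` with `D(1) = 0`. For `N = p ^ i` this is `E^{(i)}`. -/
def Stratification.killed {f : X ⟶ S} {E : X.Modules} (nab : Stratification f E) (N : ℕ)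
    (U : X.Opens) : AddSubgroup Γ(E, U) where
  carrier := {e | ∀ (V : X.Opens) (h : V ≤ U) (D : diffOps f V),
    (∃ m < N, IsOrderLE m V D.1) → D.1 ⟨V, le_rfl⟩ 1 = 0 → nab.nabla V D (resM E h e) = 0}
  add_mem' {e e'} he he' V h D hD h1 := by
    rw [map_add, map_add, he V h D hD h1, he' V h D hD h1, add_zero]
  zero_mem' V h D hD h1 := by rw [map_zero, map_zero]
  neg_mem' {e} he V h D hD h1 := by rw [map_neg, map_neg, he V h D hD h1, neg_zero]

/-- A connection on `M` relative to `g : X ⟶ S`: an `𝒪_X`-linear map of sheaves from `𝒟er(X/S)` to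
endomorphisms of `M` that satisfies the Leibniz rule (hence takes `𝒪_S`-linear values). -/
@[ext]
structure Connection (g : X ⟶ S) (M : X.Modules) where
  /-- covariant derivatives of sections -/
  nabla (U : X.Opens) : derivations g U →+ AddMonoid.End Γ(M, U)
  nabla_res {U V : X.Opens} (h : V ≤ U) (D : derivations g U) (m : Γ(M, U)) :
    resM M h (nabla U D m) = nabla V (derivations.res g h D) (resM M h m)
  nabla_smul {U : X.Opens} (c : Γ(X, U)) (D : derivations g U) (m : Γ(M, U)) :
    nabla U (derivations.smul g c D) m = c • nabla U D m
  leibniz {U : X.Opens} (D : derivations g U) (a : Γ(X, U)) (m : Γ(M, U)) :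
    nabla U D (a • m) = a • nabla U D m + D.1 ⟨U, le_rfl⟩ a • m

namespace Connection

variable {g : X ⟶ S} {M : X.Modules}

/-- Integrability: `∇([D, D']) = [∇(D), ∇(D')]`. Here `B` is the derivation `[D, D']`. -/
def IsIntegrable (c : Connection g M) : Prop :=
  ∀ (U : X.Opens) (D D' B : derivations g U), B.1 = D.1 * D'.1 - D'.1 * D.1 →
    c.nabla U B = c.nabla U D * c.nabla U D' - c.nabla U D' * c.nabla U D

/-- Vanishing of the `p`-curvature: `∇(D ^ p) = ∇(D) ^ p`. Here `B` is the `p`-fold iterate of `D`,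
which is a derivation in characteristic `p`. -/
def PCurvatureZero (c : Connection g M) (p : ℕ) : Prop :=
  ∀ (U : X.Opens) (D B : derivations g U), B.1 = D.1 ^ p → c.nabla U B = c.nabla U D ^ p

/-- The sections over `U` of the kernel of the connection. -/
def ker (c : Connection g M) (U : X.Opens) : Set Γ(M, U) :=
  {m | ∀ (V : X.Opens) (h : V ≤ U) (D : derivations g V), c.nabla V D (resM M h m) = 0}

end Connection

/-- A family of subgroups of sections is a subsheaf of `f⁻¹𝒪_S`-modules of `E`. -/
structure IsSubsheafOverBase (f : X ⟶ S) (E : X.Modules)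
    (P : ∀ U : X.Opens, AddSubgroup Γ(E, U)) : Prop where
  res {U V : X.Opens} (h : V ≤ U) (e : Γ(E, U)) : e ∈ P U → resM E h e ∈ P V
  local' {U : X.Opens} (e : Γ(E, U)) :
    (∀ x ∈ U, ∃ (V : X.Opens) (h : V ≤ U), x ∈ V ∧ resM E h e ∈ P V) → e ∈ P U
  smul {U : X.Opens} (T : S.Opens) (h : U ≤ f ⁻¹ᵁ T) (t : Γ(S, T)) (e : Γ(E, U)) :
    e ∈ P U → (f.appLE T U h).hom t • e ∈ P U

/-- A morphism `ι : M ⟶ φ_* E` on sections, with values written as sections of `E`. -/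
def onSections {Y : Scheme.{u}} {φ : X ⟶ Y} {E : X.Modules} {M : Y.Modules}
    (ι : M ⟶ (Scheme.Modules.pushforward φ).obj E) (V : Y.Opens) :
    Γ(M, V) →+ Γ(E, φ ⁻¹ᵁ V) :=
  (ι.app V).hom

/-- Let `φ : X ⟶ Y` be a morphism and `P` a family of subgroups of sections of `E`.
The morphism `ι : M ⟶ φ_* E` of `𝒪_Y`-modules identifies `M` with the part `φ_* P` of `φ_* E`:
it is injective on sections with image `P`. -/
def Identifies {Y : Scheme.{u}} (φ : X ⟶ Y) {E : X.Modules}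
    (P : ∀ U : X.Opens, AddSubgroup Γ(E, U)) {M : Y.Modules}
    (ι : M ⟶ (Scheme.Modules.pushforward φ).obj E) : Prop :=
  ∀ V : Y.Opens, Function.Injective (onSections ι V) ∧
    Set.range (onSections ι V) = (P (φ ⁻¹ᵁ V) : Set Γ(E, φ ⁻¹ᵁ V))

/-- Let `φ : X ⟶ Y` be a morphism over `S`, `E` a stratified sheaf on `X/S` and
`ι : M ⟶ φ_* E`. The connection `c` on `M` relative to `Y/S` is induced by the stratification
through operators of order at most `N`: one has `∇(δ) m = ∇(P) m` whenever `P` is a differential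
operator on `X` of order at most `N` lifting the derivation `δ` of `Y`, that is,
`P ∘ φ^♯ = φ^♯ ∘ δ`. -/
def Stratification.Induces {Y : Scheme.{u}} {f : X ⟶ S} {E : X.Modules}
    (nab : Stratification f E) (N : ℕ) (φ : X ⟶ Y) (g : Y ⟶ S) {M : Y.Modules}
    (ι : M ⟶ (Scheme.Modules.pushforward φ).obj E) (c : Connection g M) : Prop :=
  ∀ (V : Y.Opens) (δ : derivations g V) (P : diffOps f (φ ⁻¹ᵁ V)), IsOrderLE N _ P.1 →
    (∀ (W : Y.Opens) (h : W ≤ V) (r : Γ(Y, W)),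
      P.1 ⟨φ ⁻¹ᵁ W, (Opens.map φ.base).monotone h⟩ ((φ.app W).hom r) =
        (φ.app W).hom (δ.1 ⟨W, h⟩ r)) →
    ∀ m : Γ(M, V),
      onSections ι V (c.nabla V δ m) = nab.nabla (φ ⁻¹ᵁ V) P (onSections ι V m)

end Structures

/-! ### Sequences of Frobenius descents -/

section Descent

variable {k : Type u} [Field k] (p : ℕ) [hp : Fact p.Prime] [CharP k p]
  {S X : Scheme.{u}} (s : S ⟶ Spec (.of k)) (f : X ⟶ S)

/-- For sheaves `E i` on `X^{(i)}` with isomorphisms `σ i : F^* E (i+1) ≅ E i`, the resulting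
morphism from `E i` to the pushforward of `E 0` along `X ⟶ X^{(i)}`: the composite of the adjoints
`E (j+1) ⟶ F_* E j` of the `σ j`, for `j < i`. -/
def descentMap (E : ∀ i, (twist p s f i).Modules)
    (σ : ∀ i, (Scheme.Modules.pullback (frob p s f i)).obj (E (i + 1)) ≅ E i) :
    ∀ i, E i ⟶ (Scheme.Modules.pushforward (frobIter p s f i)).obj (E 0 : X.Modules)
  | 0 => (Scheme.Modules.pushforwardId X).inv.app (E 0 : X.Modules)
  | i + 1 =>
      (Scheme.Modules.pullbackPushforwardAdjunction (frob p s f i)).homEquiv _ _ (σ i).hom ≫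
        (Scheme.Modules.pushforward (frob p s f i)).map (descentMap E σ i) ≫
        (Scheme.Modules.pushforwardComp (frobIter p s f i) (frob p s f i)).hom.app _

end Descent

end KatzGieseker

end

open KatzGieseker

noncomputable section

namespace KatzGieseker

/-! ### Gluing of sections -/

section Gluing

/-! All questions are local, and locally `X` has étale coordinates `x₁, …, x_d` over `S`. The
relative Frobenius square of an étale map is cartesian, so, as for affine space, the monomials `x^α`
with exponents below `p^i` form a basis of the functions on `X` over those on `X^{(i)}`
(`IsChart.localBasis_frobIter`). Two facts connect this basis with differential operators. An
operator of order less than `p^i` is linear over `X^{(i)}`, because in characteristic `p` the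
commutator with `a^{p^i}` is the `p^i`-fold iterated commutator with `a` (`apply_frobIter_mul`).
Conversely, the operator `R_α` that sends a function to its coefficient at `x^α` is a product of
one-variable projections, each of order at most `p^i - 1` (`MonoBasis.proj_insert`,
`MonoBasis.proj_singleton_order`).

If `e` lies in `E^{(i)}` and `ord D < p^i`, then `∇(D)(b e) = D(b) e`, since `D ∘ b - D(b)` kills
`1`. For an arbitrary section `e`, each `∇(R_α) e` lies in `E^{(i)}`: an operator `D` of order less
than `p^i` with `D(1) = 0` is linear over `X^{(i)}`, so `D ∘ R_α = 0`. Applying `∇` to `∑ x^α R_α =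
1` gives `e = ∑ x^α ∇(R_α) e`, whence `E = ⊕ x^α E^{(i)}` locally (`IsLevel.modBasis_killedHom`).
Quasi-coherence of `E^{(i)}` follows by taking coefficients at `1`. Writing exponents in base `p`
and cancelling the basis at level `i` from that at level `i + 1` gives a basis of `E^{(i)}` over
`E^{(i+1)}`, which is the isomorphism `F^* E^{(i+1)} ≅ E^{(i)}`.

On a tensor product `φ_* 𝒪_X ⊗ M` over `𝒪_Y`, every `𝒪_Y`-linear operator `D` acts as `D ⊗ 1`, and
this action is unique (`IsLocallyTensor.exists_isAct`, `IsLocallyTensor.actUnique`). Both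
constructions of the theorem have this form. The connection on `E^{(i)}` is `δ ⊗ 1` with respect to
`E^{(i+1)}`; integrability and vanishing `p`-curvature follow from uniqueness of actions. It is the
only induced connection because a derivation of `X^{(i)}` lifts locally to an operator of order at
most `p^i`, acting on the coefficients of the `x^α`. Its kernel is `E^{(i+1)}` because `y_k ∂_k`
multiplies `y^β` by `β_k`, which is invertible when `0 < β_k < p`.

For a sequence of descents, an operator of order less than `p^i` acts on `E⁰` as `D ⊗ 1` with
respect to `E^i`. The images of the `E^i` in `E⁰` decrease, so the actions at different levels
agree, and they glue to a stratification. Comparing coefficients of `1` identifies the image of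
`E^i` with `E^{(i)}`. -/

theorem exists_section_of_locally {T : TopCat.{u}} (F : TopCat.Sheaf (Type u) T) (U : Opens T)
    (P : ∀ W : Opens T, W ≤ U → F.1.obj (.op W) → Prop)
    (hres : ∀ (W W' : Opens T) (h : W ≤ U) (h' : W' ≤ W) (e : F.1.obj (.op W)),
      P W h e → P W' (h'.trans h) (F.1.map (homOfLE h').op e))
    (huniq : ∀ (W : Opens T) (h : W ≤ U) (e e' : F.1.obj (.op W)), P W h e → P W h e' → e = e')
    (hex : ∀ x ∈ U, ∃ (W : Opens T) (h : W ≤ U), x ∈ W ∧ ∃ e, P W h e) :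
    ∃ e : F.1.obj (.op U), ∀ x ∈ U, ∃ (W : Opens T) (h : W ≤ U), x ∈ W ∧
      P W h (F.1.map (homOfLE h).op e) := by
  choose W hW hxW e he using fun x : U => hex x.1 x.2
  obtain ⟨s, hs, -⟩ := F.existsUnique_gluing' (fun x : U => W x) U (fun x => homOfLE (hW x))
    (fun x hx => Opens.mem_iSup.2 ⟨⟨x, hx⟩, hxW ⟨x, hx⟩⟩) e (fun x y => by
      refine huniq (W x ⊓ W y) (inf_le_left.trans (hW x)) _ _ ?_ ?_
      · exact hres _ _ (hW x) inf_le_left _ (he x)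
      · exact hres _ _ (hW y) inf_le_right _ (he y))
  refine ⟨s, fun x hx => ⟨W ⟨x, hx⟩, hW _, hxW _, ?_⟩⟩
  have h := hs ⟨x, hx⟩
  have h' := he ⟨x, hx⟩
  rw [← h] at h'
  exact h'

variable {X : Scheme.{u}}

theorem sheaf_section_ext {T : TopCat.{u}} (F : TopCat.Sheaf (Type u) T) {U : Opens T}
    (s t : F.1.obj (.op U))
    (h : ∀ x ∈ U, ∃ (W : Opens T) (h : W ≤ U), x ∈ W ∧
      F.1.map (homOfLE h).op s = F.1.map (homOfLE h).op t) : s = t := by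
  choose W hW hxW e using fun x : U => h x.1 x.2
  exact F.eq_of_locally_eq' (fun x : U => W x) U (fun x => homOfLE (hW x))
    (fun x hx => Opens.mem_iSup.2 ⟨⟨x, hx⟩, hxW ⟨x, hx⟩⟩) s t e

/-- The sheaf of sets underlying a sheaf of modules. -/
def typeSheafM (N : X.Modules) : TopCat.Sheaf (Type u) X :=
  ⟨N.presheaf ⋙ forget Ab, (TopCat.Presheaf.isSheaf_iff_isSheaf_comp' (forget Ab) _).1 N.isSheaf⟩

/-- The sheaf of sets underlying the structure sheaf. -/
def typeSheafO (X : Scheme.{u}) : TopCat.Sheaf (Type u) X :=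
  ⟨X.presheaf ⋙ forget CommRingCat,
    (TopCat.Presheaf.isSheaf_iff_isSheaf_comp' (forget CommRingCat) _).1 X.sheaf.2⟩

theorem resM_resM (N : X.Modules) {U V W : X.Opens} (h : V ≤ U) (h' : W ≤ V) (e : Γ(N, U)) :
    resM N h' (resM N h e) = resM N (h'.trans h) e := by
  have := congr($(N.presheaf.map_comp (homOfLE h).op (homOfLE h').op).hom e)
  exact this.symm

theorem resM_self (N : X.Modules) {U : X.Opens} (h : U ≤ U) (e : Γ(N, U)) : resM N h e = e :=
  congr($(N.presheaf.map_id (.op U)).hom e)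

theorem resO_self {U : X.Opens} (h : U ≤ U) (a : Γ(X, U)) : resO h a = a :=
  congr($(X.presheaf.map_id (.op U)).hom a)

theorem resM_smul (N : X.Modules) {U V : X.Opens} (h : V ≤ U) (a : Γ(X, U)) (e : Γ(N, U)) :
    resM N h (a • e) = resO h a • resM N h e :=
  N.map_smul (homOfLE h) a e

theorem sectionM_ext (N : X.Modules) {U : X.Opens} (s t : Γ(N, U))
    (h : ∀ x ∈ U, ∃ (W : X.Opens) (h : W ≤ U), x ∈ W ∧ resM N h s = resM N h t) : s = t :=
  sheaf_section_ext (typeSheafM N) s t h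

theorem sectionO_ext {U : X.Opens} (s t : Γ(X, U))
    (h : ∀ x ∈ U, ∃ (W : X.Opens) (h : W ≤ U), x ∈ W ∧ resO h s = resO h t) : s = t :=
  sheaf_section_ext (typeSheafO X) s t h

theorem exists_sectionM (N : X.Modules) (U : X.Opens)
    (P : ∀ W : X.Opens, W ≤ U → Γ(N, W) → Prop)
    (hres : ∀ (W W' : X.Opens) (h : W ≤ U) (h' : W' ≤ W) (e : Γ(N, W)),
      P W h e → P W' (h'.trans h) (resM N h' e))
    (huniq : ∀ (W : X.Opens) (h : W ≤ U) (e e' : Γ(N, W)), P W h e → P W h e' → e = e')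
    (hex : ∀ x ∈ U, ∃ (W : X.Opens) (h : W ≤ U), x ∈ W ∧ ∃ e, P W h e) :
    ∃ e : Γ(N, U), ∀ x ∈ U, ∃ (W : X.Opens) (h : W ≤ U), x ∈ W ∧ P W h (resM N h e) :=
  exists_section_of_locally (typeSheafM N) U P hres huniq hex

theorem exists_sectionO (U : X.Opens)
    (P : ∀ W : X.Opens, W ≤ U → Γ(X, W) → Prop)
    (hres : ∀ (W W' : X.Opens) (h : W ≤ U) (h' : W' ≤ W) (e : Γ(X, W)),
      P W h e → P W' (h'.trans h) (resO h' e))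
    (huniq : ∀ (W : X.Opens) (h : W ≤ U) (e e' : Γ(X, W)), P W h e → P W h e' → e = e')
    (hex : ∀ x ∈ U, ∃ (W : X.Opens) (h : W ≤ U), x ∈ W ∧ ∃ e, P W h e) :
    ∃ e : Γ(X, U), ∀ x ∈ U, ∃ (W : X.Opens) (h : W ≤ U), x ∈ W ∧ P W h (resO h e) :=
  exists_section_of_locally (typeSheafO X) U P hres huniq hex

/-- Families of additive maps between the sections of two sheaves of modules, one for each open
subset of `U`. -/
abbrev ModFam (N N' : X.Modules) (U : X.Opens) : Type u :=
  ∀ W : {W : X.Opens // W ≤ U}, Γ(N, W.1) →+ Γ(N', W.1)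

namespace ModFam

variable {N N' : X.Modules}

/-- Restriction of a family to a smaller open set. -/
def res {U U' : X.Opens} (L : ModFam N N' U) (h : U' ≤ U) : ModFam N N' U' :=
  fun W => L ⟨W.1, W.2.trans h⟩

/-- Compatibility with restriction. -/
def IsNatural {U : X.Opens} (L : ModFam N N' U) : Prop :=
  ∀ (V W : {V : X.Opens // V ≤ U}) (h : W.1 ≤ V.1) (e : Γ(N, V.1)),
    resM N' h (L V e) = L W (resM N h e)

theorem IsNatural.res {U U' : X.Opens} {L : ModFam N N' U} (hL : L.IsNatural) (h : U' ≤ U) :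
    (L.res h).IsNatural :=
  fun V W hVW e => hL ⟨V.1, V.2.trans h⟩ ⟨W.1, W.2.trans h⟩ hVW e

/-- Natural families can be glued. -/
theorem exists_glue (U : X.Opens) (Q : ∀ W : X.Opens, W ≤ U → ModFam N N' W → Prop)
    (hres : ∀ (W W' : X.Opens) (h : W ≤ U) (h' : W' ≤ W) (L : ModFam N N' W),
      Q W h L → Q W' (h'.trans h) (L.res h'))
    (hnat : ∀ (W : X.Opens) (h : W ≤ U) (L : ModFam N N' W), Q W h L → L.IsNatural)
    (huniq : ∀ (W : X.Opens) (h : W ≤ U) (L L' : ModFam N N' W), Q W h L → Q W h L' → L = L')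
    (hex : ∀ x ∈ U, ∃ (W : X.Opens) (h : W ≤ U), x ∈ W ∧ ∃ L, Q W h L) :
    ∃ L : ModFam N N' U, L.IsNatural ∧
      ∀ (W : X.Opens) (h : W ≤ U) (L' : ModFam N N' W), Q W h L' → L.res h = L' := by
  -- The value at `e` is glued from the values of the local families at restrictions of `e`;
  -- uniqueness of the local families makes these agree on overlaps.
  have key : ∀ (W : {W : X.Opens // W ≤ U}) (e : Γ(N, W.1)), ∃ e' : Γ(N', W.1),
      ∀ x ∈ W.1, ∃ (W' : X.Opens) (h : W' ≤ W.1), x ∈ W' ∧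
        ∃ L, Q W' (h.trans W.2) L ∧ resM N' h e' = L ⟨W', le_rfl⟩ (resM N h e) := by
    intro W e
    refine exists_sectionM N' W.1
      (fun W' h e' => ∃ L, Q W' (h.trans W.2) L ∧ e' = L ⟨W', le_rfl⟩ (resM N h e)) ?_ ?_ ?_
    · rintro V V' h h' _ ⟨L, hL, rfl⟩
      refine ⟨L.res h', hres _ _ _ h' _ hL, ?_⟩
      rw [hnat _ _ _ hL ⟨V, le_rfl⟩ ⟨V', h'⟩ h', resM_resM]
      rfl
    · rintro V h _ _ ⟨L, hL, rfl⟩ ⟨L', hL', rfl⟩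
      rw [huniq _ _ _ _ hL hL']
    · intro x hx
      obtain ⟨V, hV, hxV, L, hL⟩ := hex x (W.2 hx)
      exact ⟨V ⊓ W.1, inf_le_right, ⟨hxV, hx⟩, _, L.res inf_le_left,
        hres _ _ hV inf_le_left _ hL, rfl⟩
  choose G hG using key
  have hu : ∀ (W : {W : X.Opens // W ≤ U}) (e : Γ(N, W.1)) (W' : X.Opens) (h : W' ≤ W.1)
      (L : ModFam N N' W'), Q W' (h.trans W.2) L →
      resM N' h (G W e) = L ⟨W', le_rfl⟩ (resM N h e) := by
    intro W e W' h L hL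
    refine sectionM_ext N' _ _ fun x hx => ?_
    obtain ⟨V, hV, hxV, L', hL', hV'⟩ := hG W e x (h hx)
    refine ⟨V ⊓ W', inf_le_right, ⟨hxV, hx⟩, ?_⟩
    have e1 := huniq _ _ _ _ (hres _ _ _ inf_le_left _ hL')
      (hres _ _ (h.trans W.2) (inf_le_right : V ⊓ W' ≤ W') _ hL)
    have e2 := congr(resM N' (inf_le_left : V ⊓ W' ≤ V) $hV')
    rw [resM_resM, hnat _ _ _ hL' ⟨V, le_rfl⟩ ⟨V ⊓ W', inf_le_left⟩ inf_le_left, resM_resM] at e2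
    rw [resM_resM, hnat _ _ _ hL ⟨W', le_rfl⟩ ⟨V ⊓ W', inf_le_right⟩ inf_le_right, resM_resM, e2]
    exact congr($e1 ⟨V ⊓ W', le_rfl⟩ _)
  -- Equality in `N'` may be tested on open sets that carry a local family. Additivity and
  -- naturality of `G` are thereby inherited from the local families.
  have hext : ∀ (W : {W : X.Opens // W ≤ U}) (s t : Γ(N', W.1)),
      (∀ (W' : X.Opens) (h : W' ≤ W.1) (L : ModFam N N' W'), Q W' (h.trans W.2) L →
        resM N' h s = resM N' h t) → s = t := by
    intro W s t hst
    refine sectionM_ext N' _ _ fun x hx => ?_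
    obtain ⟨V, hV, hxV, L, hL⟩ := hex x (W.2 hx)
    exact ⟨V ⊓ W.1, inf_le_right, ⟨hxV, hx⟩, hst _ _ _ (hres _ _ hV inf_le_left _ hL)⟩
  refine ⟨fun W => AddMonoidHom.mk' (G W) fun e e' => hext W _ _ fun W' h L hL => ?_,
    fun V W h e => hext W _ _ fun W' h' L hL => ?_, fun W h L' hL' => ?_⟩
  · rw [map_add, hu _ _ _ _ _ hL, hu _ _ _ _ _ hL, hu _ _ _ _ _ hL, map_add, map_add]
  · change resM N' h' (resM N' h (G V e)) = resM N' h' (G W (resM N h e))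
    rw [resM_resM, hu V e W' (h'.trans h) L hL, hu W _ W' h' L hL, resM_resM]
  · funext V
    ext e
    change G ⟨V.1, V.2.trans h⟩ e = L' V e
    have := hu ⟨V.1, V.2.trans h⟩ e V.1 le_rfl _ (hres _ _ h V.2 _ hL')
    rw [resM_self, resM_self] at this
    exact this

end ModFam

end Gluing

end KatzGieseker

end



noncomputable section

namespace KatzGieseker

/-! ### Local bases along a homeomorphism -/

section LocalBasis

variable {X Y Z : Scheme.{u}} {φ : X ⟶ Y}

/-- The Frobenius morphisms are homeomorphisms, so data on open subsets of `X` can be indexed by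
open subsets of `Y`. This is what allows sheaves and operators on `X` to be described by coordinates
over `Y`. -/
theorem exists_preimage_eq (hφ : IsHomeomorph φ) (W : X.Opens) : ∃ V : Y.Opens, φ ⁻¹ᵁ V = W := by
  refine ⟨⟨φ '' W, hφ.isOpenMap _ W.2⟩, ?_⟩
  ext x
  exact hφ.injective.mem_set_image

theorem le_of_preimage_le (hφ : IsHomeomorph φ) {V V' : Y.Opens} (h : φ ⁻¹ᵁ V ≤ φ ⁻¹ᵁ V') :
    V ≤ V' := by
  intro y hy
  obtain ⟨x, rfl⟩ := hφ.surjective y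
  exact h hy

theorem preimage_le {V V' : Y.Opens} (h : V ≤ V') : φ ⁻¹ᵁ V ≤ φ ⁻¹ᵁ V' :=
  (Opens.map φ.base).monotone h

theorem resO_app (φ : X ⟶ Y) {V V' : Y.Opens} (h : V' ≤ V) (h' : φ ⁻¹ᵁ V' ≤ φ ⁻¹ᵁ V)
    (a : Γ(Y, V)) :
    resO h' ((φ.app V).hom a) = (φ.app V').hom (resO h a) := by
  have := congr($(φ.naturality (homOfLE h).op).hom a)
  exact this.symm

theorem resM_onSections {N : X.Modules} {M : Y.Modules}
    (j : M ⟶ (Scheme.Modules.pushforward φ).obj N) {V V' : Y.Opens} (h : V' ≤ V)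
    (h' : φ ⁻¹ᵁ V' ≤ φ ⁻¹ᵁ V) (m : Γ(M, V)) :
    resM N h' (onSections j V m) = onSections j V' (resM M h m) := by
  have := congr($(j.mapPresheaf.naturality (homOfLE h).op).hom m)
  exact this.symm

theorem onSections_smul {N : X.Modules} {M : Y.Modules}
    (j : M ⟶ (Scheme.Modules.pushforward φ).obj N) {V : Y.Opens} (a : Γ(Y, V)) (m : Γ(M, V)) :
    onSections j V (a • m) = (φ.app V).hom a • onSections j V m :=
  j.app_smul a m

/-- On every open subset of `V₀`, the functions `b` are a basis of `φ_* 𝒪_X` over `𝒪_Y`. -/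
def LocalBasis (φ : X ⟶ Y) (V₀ : Y.Opens) {I : Type} [Fintype I] (b : I → Γ(X, φ ⁻¹ᵁ V₀)) : Prop :=
  ∀ (V : Y.Opens) (h : V ≤ V₀), Function.Bijective fun c : I → Γ(Y, V) =>
    ∑ i, resO (preimage_le h) (b i) * (φ.app V).hom (c i)

/-- On every open subset of `V₀`, every section of `φ_* N` is uniquely a combination of sections
of `M` with coefficients `b`. -/
def ModBasis (φ : X ⟶ Y) {N : X.Modules} {M : Y.Modules}
    (j : M ⟶ (Scheme.Modules.pushforward φ).obj N) (V₀ : Y.Opens) {I : Type} [Fintype I]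
    (b : I → Γ(X, φ ⁻¹ᵁ V₀)) : Prop :=
  ∀ (V : Y.Opens) (h : V ≤ V₀), Function.Bijective fun m : I → Γ(M, V) =>
    ∑ i, resO (preimage_le h) (b i) • onSections j V (m i)

/-- Locally on `Y`, the sheaf `φ_* 𝒪_X` is free of finite rank and `φ_* N` is its tensor product
with `M` through `j`. -/
def IsLocallyTensor (φ : X ⟶ Y) {N : X.Modules} {M : Y.Modules}
    (j : M ⟶ (Scheme.Modules.pushforward φ).obj N) : Prop :=
  ∀ y : Y, ∃ (V₀ : Y.Opens) (I : Type) (_ : Fintype I) (b : I → Γ(X, φ ⁻¹ᵁ V₀)),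
    y ∈ V₀ ∧ LocalBasis φ V₀ b ∧ ModBasis φ j V₀ b

variable {N : X.Modules} {M : Y.Modules} {j : M ⟶ (Scheme.Modules.pushforward φ).obj N}

/-- A local basis writes every section, locally, as a finite sum of multiples of sections of `M`. A
local and additive property therefore only has to be tested on such multiples. -/
theorem IsLocallyTensor.induction (hφ : IsHomeomorph φ) (hj : IsLocallyTensor φ j) {U : X.Opens}
    (P : ∀ W : X.Opens, W ≤ U → Γ(N, W) → Prop)
    (hloc : ∀ (W : X.Opens) (h : W ≤ U) (e : Γ(N, W)),
      (∀ x ∈ W, ∃ (W' : X.Opens) (h' : W' ≤ W), x ∈ W' ∧ P W' (h'.trans h) (resM N h' e)) →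
      P W h e)
    (hadd : ∀ (W : X.Opens) (h : W ≤ U) (e e' : Γ(N, W)), P W h e → P W h e' → P W h (e + e'))
    (hgen : ∀ (V : Y.Opens) (h : φ ⁻¹ᵁ V ≤ U) (a : Γ(X, φ ⁻¹ᵁ V)) (m : Γ(M, V)),
      P (φ ⁻¹ᵁ V) h (a • onSections j V m))
    (W : X.Opens) (h : W ≤ U) (e : Γ(N, W)) : P W h e := by
  refine hloc W h e fun x hx => ?_
  obtain ⟨V₁, rfl⟩ := exists_preimage_eq hφ W
  obtain ⟨V₀, I, _, b, hy, -, hb⟩ := hj (φ x)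
  have h1 : φ ⁻¹ᵁ (V₀ ⊓ V₁) ≤ φ ⁻¹ᵁ V₁ := preimage_le inf_le_right
  refine ⟨φ ⁻¹ᵁ (V₀ ⊓ V₁), h1, ⟨hy, hx⟩, ?_⟩
  obtain ⟨m, hm⟩ := (hb (V₀ ⊓ V₁) inf_le_left).2 (resM N h1 e)
  rw [← hm]
  refine Finset.sum_induction _ (P (φ ⁻¹ᵁ (V₀ ⊓ V₁)) (h1.trans h)) (fun _ _ => hadd _ _ _ _) ?_
    fun i _ => hgen _ _ _ _
  -- The empty sum is the generator `0 • 0`.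
  simpa using hgen (V₀ ⊓ V₁) (h1.trans h) 0 0

theorem IsLocallyTensor.modFam_ext (hφ : IsHomeomorph φ) (hj : IsLocallyTensor φ j)
    {N' : X.Modules} {U : X.Opens} {L L' : ModFam N N' U} (hL : L.IsNatural) (hL' : L'.IsNatural)
    (h : ∀ (V : Y.Opens) (h : φ ⁻¹ᵁ V ≤ U) (a : Γ(X, φ ⁻¹ᵁ V)) (m : Γ(M, V)),
      L ⟨_, h⟩ (a • onSections j V m) = L' ⟨_, h⟩ (a • onSections j V m)) : L = L' := by
  funext W
  ext e
  refine hj.induction hφ (fun W h e => L ⟨W, h⟩ e = L' ⟨W, h⟩ e) ?_ ?_ h W.1 W.2 e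
  · intro W h e H
    refine sectionM_ext N' _ _ fun x hx => ?_
    obtain ⟨W', h', hxW', H'⟩ := H x hx
    refine ⟨W', h', hxW', ?_⟩
    rw [hL ⟨W, h⟩ ⟨W', h'.trans h⟩ h', hL' ⟨W, h⟩ ⟨W', h'.trans h⟩ h']
    exact H'
  · intro W h e e' H H'
    rw [map_add, map_add, H, H']

/-- A natural `𝒪_Y`-balanced biadditive map on `𝒪_X × M` with values in `N'`. -/
structure BalancedMap (φ : X ⟶ Y) (M : Y.Modules) (N' : X.Modules) (U : X.Opens) where
  /-- the biadditive map on sections -/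
  map (V : Y.Opens) (h : φ ⁻¹ᵁ V ≤ U) : Γ(X, φ ⁻¹ᵁ V) →+ Γ(M, V) →+ Γ(N', φ ⁻¹ᵁ V)
  map_res {V V' : Y.Opens} (h : φ ⁻¹ᵁ V ≤ U) (h' : V' ≤ V) (a : Γ(X, φ ⁻¹ᵁ V)) (m : Γ(M, V)) :
    resM N' (preimage_le h') (map V h a m) =
      map V' ((preimage_le h').trans h) (resO (preimage_le h') a) (resM M h' m)
  balanced {V : Y.Opens} (h : φ ⁻¹ᵁ V ≤ U) (c : Γ(Y, V)) (a : Γ(X, φ ⁻¹ᵁ V)) (m : Γ(M, V)) :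
    map V h (a * (φ.app V).hom c) m = map V h a (c • m)

/-- The universal property of the tensor product for natural balanced maps. -/
theorem IsLocallyTensor.exists_extension (hφ : IsHomeomorph φ) (hj : IsLocallyTensor φ j)
    {N' : X.Modules} {U : X.Opens} (τ : BalancedMap φ M N' U) :
    ∃ L : ModFam N N' U, L.IsNatural ∧
      ∀ (V : Y.Opens) (h : φ ⁻¹ᵁ V ≤ U) (a : Γ(X, φ ⁻¹ᵁ V)) (m : Γ(M, V)),
        L ⟨_, h⟩ (a • onSections j V m) = τ.map V h a m := by
  -- The condition `Q` determines `L`, so by gluing it is enough to construct `L` near each point,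
  -- where a basis is available.
  let Q : ∀ W : X.Opens, W ≤ U → ModFam N N' W → Prop := fun W hW L => L.IsNatural ∧
    ∀ (V : Y.Opens) (h : φ ⁻¹ᵁ V ≤ W) (a : Γ(X, φ ⁻¹ᵁ V)) (m : Γ(M, V)),
        L ⟨_, h⟩ (a • onSections j V m) = τ.map V (h.trans hW) a m
  have hex : ∀ x ∈ U, ∃ (W : X.Opens) (h : W ≤ U), x ∈ W ∧ ∃ L, Q W h L := by
    intro x hx
    obtain ⟨V₁, rfl⟩ := exists_preimage_eq hφ U
    obtain ⟨V₀, I, _, b, hy, hc, hb⟩ := hj (φ x)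
    have hV₁ : φ ⁻¹ᵁ (V₀ ⊓ V₁) ≤ φ ⁻¹ᵁ V₁ := preimage_le inf_le_right
    refine ⟨φ ⁻¹ᵁ (V₀ ⊓ V₁), hV₁, ⟨hy, hx⟩, ?_⟩
    let β : ∀ V : Y.Opens, V ≤ V₀ ⊓ V₁ → (I → Γ(M, V)) ≃+ Γ(N, φ ⁻¹ᵁ V) := fun V h =>
      { Equiv.ofBijective _ (hb V (h.trans inf_le_left)) with
        map_add' := fun m m' => by
          simp only [Equiv.toFun_as_coe, Equiv.ofBijective_apply, Pi.add_apply, map_add,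
            smul_add, Finset.sum_add_distrib] }
    have hβ : ∀ V h m, β V h m = ∑ i, resO (preimage_le (h.trans inf_le_left)) (b i) •
        onSections j V (m i) := fun V h m => rfl
    -- In coordinates the desired map has to be `∑ bᵢ ⊗ mᵢ ↦ ∑ τ(bᵢ, mᵢ)`.
    let γ : ∀ V : Y.Opens, V ≤ V₀ ⊓ V₁ → (I → Γ(M, V)) →+ Γ(N', φ ⁻¹ᵁ V) := fun V h =>
      ∑ i, (τ.map V (preimage_le (h.trans inf_le_right))
        (resO (preimage_le (h.trans inf_le_left)) (b i))).comp (Pi.evalAddMonoidHom _ i)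
    have hγ : ∀ V h m, γ V h m = ∑ i, τ.map V (preimage_le (h.trans inf_le_right))
        (resO (preimage_le (h.trans inf_le_left)) (b i)) (m i) := fun V h m => by
      simp [γ]
    let ℓ : ∀ V : Y.Opens, V ≤ V₀ ⊓ V₁ → Γ(N, φ ⁻¹ᵁ V) →+ Γ(N', φ ⁻¹ᵁ V) := fun V h =>
      (γ V h).comp (β V h).symm.toAddMonoidHom
    have hℓ : ∀ V h m, ℓ V h (β V h m) = γ V h m := fun V h m => by simp [ℓ]
    have hℓres : ∀ V h V' (h' : V' ≤ V) e, resM N' (preimage_le h') (ℓ V h e) =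
        ℓ V' (h'.trans h) (resM N (preimage_le h') e) := by
      intro V h V' h' e
      obtain ⟨m, rfl⟩ := (β V h).surjective e
      have e1 : resM N (preimage_le h') (β V h m) =
          β V' (h'.trans h) (fun i => resM M h' (m i)) := by
        simp only [hβ, map_sum, resM_smul, resO_resO, resM_onSections j h']
      rw [e1, hℓ _ h, hℓ _ (h'.trans h), hγ _ h, hγ _ (h'.trans h), map_sum]
      refine Finset.sum_congr rfl fun i _ => ?_
      rw [τ.map_res _ h', resO_resO]
    -- Expand `a` in the basis; balancedness moves its coordinates from the first argument of `τ` to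
    -- the second.
    have hℓgen : ∀ V h a m, ℓ V h (a • onSections j V m) =
        τ.map V (preimage_le (h.trans inf_le_right)) a m := by
      intro V h a m
      obtain ⟨c, rfl⟩ := (hc V (h.trans inf_le_left)).2 a
      have e1 : (∑ i, resO (preimage_le (h.trans inf_le_left)) (b i) * (φ.app V).hom (c i)) •
          onSections j V m = β V h (fun i => c i • m) := by
        simp only [hβ, onSections_smul, Finset.sum_smul, mul_smul]
      simp only [e1]
      rw [hℓ _ h, hγ _ h, map_sum, AddMonoidHom.finsetSum_apply]
      exact Finset.sum_congr rfl fun i _ => (τ.balanced _ _ _ _).symm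
    have key : ∀ W : {W : X.Opens // W ≤ φ ⁻¹ᵁ (V₀ ⊓ V₁)},
        ∃ G : Γ(N, W.1) →+ Γ(N', W.1), ∀ (V : Y.Opens) (h : V ≤ V₀ ⊓ V₁)
          (hV : φ ⁻¹ᵁ V ≤ W.1) (e : Γ(N, W.1)), resM N' hV (G e) = ℓ V h (resM N hV e) := by
      rintro ⟨W, hW⟩
      obtain ⟨V, rfl⟩ := exists_preimage_eq hφ W
      exact ⟨ℓ V (le_of_preimage_le hφ hW), fun V' h hV e =>
        hℓres V (le_of_preimage_le hφ hW) V' (le_of_preimage_le hφ hV) e⟩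
    choose G hG using key
    refine ⟨G, ?_, ?_⟩
    · rintro ⟨V, hV⟩ ⟨W, hW⟩ h e
      obtain ⟨W, rfl⟩ := exists_preimage_eq hφ W
      have := hG ⟨_, hW⟩ W (le_of_preimage_le hφ hW) le_rfl (resM N h e)
      rw [resM_self, resM_self] at this
      rw [this]
      exact hG ⟨V, hV⟩ W (le_of_preimage_le hφ hW) h e
    · intro V h a m
      have := hG ⟨_, h⟩ V (le_of_preimage_le hφ h) le_rfl (a • onSections j V m)
      rw [resM_self, resM_self] at this
      rw [this, hℓgen _ (le_of_preimage_le hφ h)]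
  obtain ⟨L, hL, hQ⟩ := ModFam.exists_glue (N := N) (N' := N') U Q
    (fun W W' h h' L hL => ⟨hL.1.res h', fun V hV a m => hL.2 V (hV.trans h') a m⟩)
    (fun _ _ _ h => h.1)
    (fun W h L L' hL hL' => hj.modFam_ext hφ hL.1 hL'.1
      fun V hV a m => (hL.2 V hV a m).trans (hL'.2 V hV a m).symm) hex
  refine ⟨L, hL, fun V h a m => sectionM_ext N' _ _ fun x hx => ?_⟩
  obtain ⟨W, hW, hxW, L', hL'⟩ := hex x (h hx)
  obtain ⟨V₁, rfl⟩ := exists_preimage_eq hφ W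
  have h1 : φ ⁻¹ᵁ (V ⊓ V₁) ≤ φ ⁻¹ᵁ V := preimage_le inf_le_left
  have h2 : φ ⁻¹ᵁ (V ⊓ V₁) ≤ φ ⁻¹ᵁ V₁ := preimage_le inf_le_right
  refine ⟨_, h1, ⟨hx, hxW⟩, ?_⟩
  rw [hL ⟨_, h⟩ ⟨_, h1.trans h⟩ h1, τ.map_res h (inf_le_left : V ⊓ V₁ ≤ V), resM_smul,
    resM_onSections j (inf_le_left : V ⊓ V₁ ≤ V), ← hL'.2 _ h2, ← hQ _ hW _ hL']
  rfl

end LocalBasis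

end KatzGieseker

end



noncomputable section

namespace KatzGieseker

/-! ### Algebra of bases -/

section BasisAlgebra

variable {G G' H : Type*} [AddCommGroup G] [AddCommGroup G'] [AddCommGroup H]
  {I J : Type*} [Fintype I] [Fintype J]

/-- Expanding in the first basis and then expanding every coordinate in the second is a composite of
bijections, after currying the index set. -/
theorem bijective_basis_comp (ι : G →+ H) (ι' : G' →+ G) (b : I → AddMonoid.End H)
    (b' : J → AddMonoid.End G) (b'' : J → AddMonoid.End H) (hb : ∀ j g, ι (b' j g) = b'' j (ι g))
    (h : Function.Bijective fun m : I → G => ∑ i, b i (ι (m i)))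
    (h' : Function.Bijective fun m : J → G' => ∑ j, b' j (ι' (m j))) :
    Function.Bijective fun m : I × J → G' => ∑ i, (b i.1) (b'' i.2 (ι (ι' (m i)))) := by
  have h1 : Function.Bijective fun m : I → J → G' => fun i => ∑ j, b' j (ι' (m i j)) :=
    Function.Bijective.piMap fun _ => h'
  have h2 := h.comp (h1.comp (Equiv.curry I J G').bijective)
  convert h2 using 2 with m
  rw [Fintype.sum_prod_type]
  refine Finset.sum_congr rfl fun i _ => ?_
  simp only [Function.comp, map_sum, hb, Equiv.curry_apply, Function.curry]

/-- Because `b i₀ = 1`, an element of `G` is the coordinate at `i₀` of its image in `H`. For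
injectivity, coordinates are extended by zero away from `i₀`; for surjectivity, the coordinates with
first index `i₀` are selected. -/
theorem bijective_basis_of_comp [DecidableEq I] (ι : G →+ H) (ι' : G' →+ G)
    (b : I → AddMonoid.End H)
    (b' : J → AddMonoid.End G) (b'' : J → AddMonoid.End H) (hb : ∀ j g, ι (b' j g) = b'' j (ι g))
    (i₀ : I) (hi₀ : b i₀ = 1)
    (h : Function.Bijective fun m : I → G => ∑ i, b i (ι (m i)))
    (h' : Function.Bijective fun m : I × J → G' => ∑ i, (b i.1) (b'' i.2 (ι (ι' (m i))))) :
    Function.Bijective fun m : J → G' => ∑ j, b' j (ι' (m j)) := by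
  have key : ∀ m : I × J → G', (∑ i, (b i.1) (b'' i.2 (ι (ι' (m i))))) =
      ∑ i, b i (ι (∑ j, b' j (ι' (m (i, j))))) := by
    intro m
    rw [Fintype.sum_prod_type]
    refine Finset.sum_congr rfl fun i _ => ?_
    simp only [map_sum, hb]
  have key' : ∀ g : G, (∑ i, b i (ι ((Pi.single i₀ g : I → G) i))) = ι g := by
    intro g
    rw [Finset.sum_eq_single i₀]
    · simp [hi₀]
    · intro i _ hi
      simp [hi]
    · simp
  constructor
  · intro m m' hm
    have : (fun x : I × J => if x.1 = i₀ then m x.2 else 0) =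
        (fun x : I × J => if x.1 = i₀ then m' x.2 else 0) := by
      apply h'.1
      simp only [key]
      refine Finset.sum_congr rfl fun i _ => ?_
      by_cases hi : i = i₀
      · simp only [hi, if_true]
        exact congr(b i₀ (ι $hm))
      · simp [hi]
    funext j
    simpa using congr_fun this (i₀, j)
  · intro g
    obtain ⟨m, hm⟩ := h'.2 (ι g)
    simp only [key] at hm
    rw [← key' g] at hm
    have := congr_fun (h.1 hm) i₀
    exact ⟨fun j => m (i₀, j), by simpa using this⟩

end BasisAlgebra

/-! ### Bases along a composite of two morphisms -/

section Basis

variable {X Y Z : Scheme.{u}} {φ : X ⟶ Y} {ψ : Y ⟶ Z}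

/-- Multiplication by a function on sections of a sheaf of modules. -/
def smulEnd (N : X.Modules) {U : X.Opens} (a : Γ(X, U)) : AddMonoid.End Γ(N, U) :=
  DistribSMul.toAddMonoidHom _ a

theorem LocalBasis.reindex {V₀ : Y.Opens} {I J : Type} [Fintype I] [Fintype J]
    {b : I → Γ(X, φ ⁻¹ᵁ V₀)} (hb : LocalBasis φ V₀ b) (e : J ≃ I) :
    LocalBasis φ V₀ (b ∘ e) := by
  intro V h
  convert (hb V h).comp (e.arrowCongr (Equiv.refl _)).bijective using 2 with c
  simpa using (e.sum_comp fun i => resO (preimage_le h) (b i) * (φ.app V).hom (c (e.symm i)))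

theorem ModBasis.reindex {N : X.Modules} {M : Y.Modules}
    {j : M ⟶ (Scheme.Modules.pushforward φ).obj N} {V₀ : Y.Opens} {I J : Type} [Fintype I]
    [Fintype J] {b : I → Γ(X, φ ⁻¹ᵁ V₀)} (hb : ModBasis φ j V₀ b) (e : J ≃ I) :
    ModBasis φ j V₀ (b ∘ e) := by
  intro V h
  convert (hb V h).comp (e.arrowCongr (Equiv.refl _)).bijective using 2 with c
  simpa using (e.sum_comp fun i => resO (preimage_le h) (b i) • onSections j V (c (e.symm i)))

theorem LocalBasis.comp {V₀ : Y.Opens} {V₁ : Z.Opens} (h₁ : ψ ⁻¹ᵁ V₁ ≤ V₀) {I J : Type}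
    [Fintype I] [Fintype J] {b : I → Γ(X, φ ⁻¹ᵁ V₀)} {b' : J → Γ(Y, ψ ⁻¹ᵁ V₁)}
    (hb : LocalBasis φ V₀ b) (hb' : LocalBasis ψ V₁ b') :
    LocalBasis (φ ≫ ψ) V₁ (fun i : I × J =>
      (resO (preimage_le h₁) (b i.1) * (φ.app _).hom (b' i.2) : Γ(X, φ ⁻¹ᵁ ψ ⁻¹ᵁ V₁))) := by
  intro V h
  have := bijective_basis_comp (φ.app (ψ ⁻¹ᵁ V)).hom.toAddMonoidHom (ψ.app V).hom.toAddMonoidHom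
    (fun i => AddMonoidHom.mulLeft (resO (preimage_le ((preimage_le h).trans h₁)) (b i)))
    (fun i => AddMonoidHom.mulLeft (resO (preimage_le h) (b' i)))
    (fun i => AddMonoidHom.mulLeft ((φ.app (ψ ⁻¹ᵁ V)).hom (resO (preimage_le h) (b' i))))
    (fun i g => map_mul (φ.app (ψ ⁻¹ᵁ V)).hom _ _) (hb _ ((preimage_le h).trans h₁)) (hb' _ h)
  have e : (fun c : I × J → Γ(Z, V) => ∑ i, resO (X := X) (preimage_le (preimage_le h))
      (resO (preimage_le h₁) (b i.1) * (φ.app _).hom (b' i.2)) *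
        (φ.app (ψ ⁻¹ᵁ V)).hom ((ψ.app V).hom (c i))) = (fun c : I × J → Γ(Z, V) => ∑ i,
          resO (preimage_le ((preimage_le h).trans h₁)) (b i.1) *
            ((φ.app (ψ ⁻¹ᵁ V)).hom (resO (preimage_le h) (b' i.2)) *
              (φ.app (ψ ⁻¹ᵁ V)).hom ((ψ.app V).hom (c i)))) := by
    funext c
    refine Finset.sum_congr rfl fun i _ => ?_
    rw [map_mul, resO_resO, mul_assoc, resO_app φ (preimage_le h)]
  have h2 := e ▸ this
  have h3 : ∀ c : Γ(Z, V), ((φ ≫ ψ).app V).hom c = (φ.app (ψ ⁻¹ᵁ V)).hom ((ψ.app V).hom c) :=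
    fun c => congr($(Scheme.Hom.comp_app φ ψ V).hom c)
  simp only [h3]
  exact h2

variable {N : X.Modules} {M : Y.Modules} {M' : Z.Modules}

/-- The composite `M' ⟶ ψ_* M ⟶ ψ_* φ_* N`. -/
def compOn (j : M ⟶ (Scheme.Modules.pushforward φ).obj N)
    (j' : M' ⟶ (Scheme.Modules.pushforward ψ).obj M) :
    M' ⟶ (Scheme.Modules.pushforward (φ ≫ ψ)).obj N :=
  j' ≫ (Scheme.Modules.pushforward ψ).map j ≫
    (Scheme.Modules.pushforwardComp φ ψ).hom.app _

variable {j : M ⟶ (Scheme.Modules.pushforward φ).obj N}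
  {j' : M' ⟶ (Scheme.Modules.pushforward ψ).obj M}

theorem ModBasis.comp {V₀ : Y.Opens} {V₁ : Z.Opens} (h₁ : ψ ⁻¹ᵁ V₁ ≤ V₀) {I J : Type}
    [Fintype I] [Fintype J] {b : I → Γ(X, φ ⁻¹ᵁ V₀)} {b' : J → Γ(Y, ψ ⁻¹ᵁ V₁)}
    (hb : ModBasis φ j V₀ b) (hb' : ModBasis ψ j' V₁ b') :
    ModBasis (φ ≫ ψ) (compOn j j') V₁ (fun i : I × J =>
      (resO (preimage_le h₁) (b i.1) * (φ.app _).hom (b' i.2) : Γ(X, φ ⁻¹ᵁ ψ ⁻¹ᵁ V₁))) := by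
  intro V h
  have := bijective_basis_comp (onSections j (ψ ⁻¹ᵁ V)) (onSections j' V)
    (fun i => smulEnd N (resO (preimage_le ((preimage_le h).trans h₁)) (b i)))
    (fun i => smulEnd M (resO (preimage_le h) (b' i)))
    (fun i => smulEnd N ((φ.app (ψ ⁻¹ᵁ V)).hom (resO (preimage_le h) (b' i))))
    (fun i g => onSections_smul _ _ _) (hb _ ((preimage_le h).trans h₁)) (hb' _ h)
  have e : (fun c : I × J → Γ(M', V) => ∑ i, resO (X := X) (preimage_le (preimage_le h))
      (resO (preimage_le h₁) (b i.1) * (φ.app _).hom (b' i.2)) •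
        onSections j _ (onSections j' V (c i))) = (fun c : I × J → Γ(M', V) => ∑ i,
          smulEnd N (resO (preimage_le ((preimage_le h).trans h₁)) (b i.1))
            (smulEnd N ((φ.app (ψ ⁻¹ᵁ V)).hom (resO (preimage_le h) (b' i.2)))
              (onSections j _ (onSections j' V (c i))))) := by
    funext c
    refine Finset.sum_congr rfl fun i _ => ?_
    rw [map_mul, resO_resO, mul_smul, resO_app φ (preimage_le h)]
    rfl
  exact e ▸ this

/-- Cancellation of the first basis. It passes from bases of `E` over `E^{(i)}` and over `E^{(i+1)}`
to a basis of `E^{(i)}` over `E^{(i+1)}`. -/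
theorem ModBasis.of_comp {V₀ : Y.Opens} {V₁ : Z.Opens} (h₁ : ψ ⁻¹ᵁ V₁ ≤ V₀) {I J : Type}
    [Fintype I] [DecidableEq I] [Fintype J] {b : I → Γ(X, φ ⁻¹ᵁ V₀)} {b' : J → Γ(Y, ψ ⁻¹ᵁ V₁)}
    (i₀ : I) (hi₀ : b i₀ = 1)
    (hb : ModBasis φ j V₀ b)
    (hb' : ModBasis (φ ≫ ψ) (compOn j j') V₁ (fun i : I × J =>
      (resO (preimage_le h₁) (b i.1) * (φ.app _).hom (b' i.2) : Γ(X, φ ⁻¹ᵁ ψ ⁻¹ᵁ V₁)))) :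
    ModBasis ψ j' V₁ b' := by
  intro V h
  refine bijective_basis_of_comp (onSections j (ψ ⁻¹ᵁ V)) (onSections j' V)
    (fun i => smulEnd N (resO (preimage_le ((preimage_le h).trans h₁)) (b i)))
    (fun i => smulEnd M (resO (preimage_le h) (b' i)))
    (fun i => smulEnd N ((φ.app (ψ ⁻¹ᵁ V)).hom (resO (preimage_le h) (b' i))))
    (fun i g => onSections_smul _ _ _) i₀ ?_ (hb _ ((preimage_le h).trans h₁)) ?_
  · ext e
    change resO (preimage_le ((preimage_le h).trans h₁)) (b i₀) • e = e
    rw [hi₀, map_one, one_smul]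
  · have e : (fun c : I × J → Γ(M', V) => ∑ i, resO (X := X) (preimage_le (preimage_le h))
      (resO (preimage_le h₁) (b i.1) * (φ.app _).hom (b' i.2)) •
        onSections j _ (onSections j' V (c i))) = (fun c : I × J → Γ(M', V) => ∑ i,
          smulEnd N (resO (preimage_le ((preimage_le h).trans h₁)) (b i.1))
            (smulEnd N ((φ.app (ψ ⁻¹ᵁ V)).hom (resO (preimage_le h) (b' i.2)))
              (onSections j _ (onSections j' V (c i))))) := by
      funext c
      refine Finset.sum_congr rfl fun i _ => ?_
      rw [map_mul, resO_resO, mul_smul, resO_app φ (preimage_le h)]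
      rfl
    exact e ▸ hb' V h

end Basis

/-! ### The adjoint of a locally tensor map is an isomorphism -/

section Adjoint

variable {X Y : Scheme.{u}} {φ : X ⟶ Y} {N : X.Modules} {M : Y.Modules}

/-- A natural family of linear maps is a morphism of sheaves of modules. -/
theorem exists_hom_of_modFam {N N' : X.Modules} (L : ModFam N N' ⊤) (hL : L.IsNatural)
    (hs : ∀ W (a : Γ(X, W)) (e : Γ(N, W)), L ⟨W, le_top⟩ (a • e) = a • L ⟨W, le_top⟩ e) :
    ∃ g : N ⟶ N', ∀ W (e : Γ(N, W)), g.app W e = L ⟨W, le_top⟩ e :=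
  ⟨⟨{ app := fun U => ModuleCat.ofHom
          { toFun := L ⟨U.unop, le_top⟩
            map_add' := map_add _
            map_smul' := hs U.unop }
      naturality := fun {U V} i => by
        ext e
        exact (hL ⟨U.unop, le_top⟩ ⟨V.unop, le_top⟩ i.unop.le e).symm }⟩, fun W e => rfl⟩

/-- The universal property of the local tensor product gives a candidate inverse `g`, sending `a •
j(m)` to `a • η(m)` with `η` the unit of the adjunction. One composite is the identity by the
adjunction, the other by checking generators. -/
theorem IsLocallyTensor.isIso_adjoint (hφ : IsHomeomorph φ)
    {j : M ⟶ (Scheme.Modules.pushforward φ).obj N} (hj : IsLocallyTensor φ j) :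
    IsIso (((Scheme.Modules.pullbackPushforwardAdjunction φ).homEquiv _ _).symm j) := by
  let adj := Scheme.Modules.pullbackPushforwardAdjunction φ
  let N' := (Scheme.Modules.pullback φ).obj M
  let η : M ⟶ (Scheme.Modules.pushforward φ).obj N' := adj.unit.app M
  let τ : BalancedMap φ M N' ⊤ :=
    { map := fun V h => AddMonoidHom.mk' (fun a => AddMonoidHom.mk' (fun m =>
        a • onSections η V m) (fun m m' => by rw [map_add, smul_add]))
          (fun a a' => by ext m; exact add_smul _ _ _)
      map_res := fun {V V'} h h' a m => by
        change resM N' _ (a • onSections η V m) = resO (preimage_le h') a • onSections η V' (resM M h' m)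
        rw [resM_smul, resM_onSections η h']
      balanced := fun {V} h c a m => by
        change (a * (φ.app V).hom c) • onSections η V m = a • onSections η V (c • m)
        rw [onSections_smul, mul_smul] }
  obtain ⟨L, hL, hLτ⟩ := hj.exists_extension hφ τ
  have hs : ∀ W (a : Γ(X, W)) (e : Γ(N, W)), L ⟨W, le_top⟩ (a • e) = a • L ⟨W, le_top⟩ e := by
    intro W a e
    refine hj.induction hφ (U := ⊤) (fun W _ e => ∀ a : Γ(X, W),
      L ⟨W, le_top⟩ (a • e) = a • L ⟨W, le_top⟩ e) ?_ ?_ ?_ W le_top e a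
    · intro W h e H a
      refine sectionM_ext N' _ _ fun x hx => ?_
      obtain ⟨W', h', hxW', H'⟩ := H x hx
      refine ⟨W', h', hxW', ?_⟩
      rw [hL ⟨W, h⟩ ⟨W', h'.trans h⟩ h', resM_smul, resM_smul, hL ⟨W, h⟩ ⟨W', h'.trans h⟩ h']
      exact H' _
    · intro W h e e' H H' a
      rw [smul_add, map_add, map_add, H, H', smul_add]
    · intro V h a m b
      rw [← mul_smul, hLτ, hLτ]
      exact mul_smul _ _ _
  obtain ⟨g, hg⟩ := exists_hom_of_modFam L hL hs
  have h1 : j ≫ (Scheme.Modules.pushforward φ).map g = η := by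
    ext V m
    have := hLτ V le_top 1 m
    rw [one_smul] at this
    refine (hg _ _).trans (this.trans ?_)
    exact one_smul _ _
  have h2 : (adj.homEquiv _ _).symm j ≫ g = 𝟙 _ := by
    rw [← adj.homEquiv_naturality_right_symm, h1]
    exact (adj.homEquiv _ _).symm_apply_eq.2 (adj.homEquiv_id M).symm
  have hη : η ≫ (Scheme.Modules.pushforward φ).map ((adj.homEquiv _ _).symm j) = j := by
    rw [← adj.homEquiv_unit, Equiv.apply_symm_apply]
  refine ⟨g, h2, ?_⟩
  ext W e
  have h3 : ∀ V (m : Γ(M, V)), ((adj.homEquiv _ _).symm j).app _ (onSections η V m) =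
      onSections j V m := fun V m => by
    have := congr(onSections $hη V m)
    exact this
  refine hj.induction hφ (U := ⊤) (fun W _ e =>
    ((adj.homEquiv _ _).symm j).app W (g.app W e) = e) ?_ ?_ ?_ W le_top e
  · intro W h e H
    refine sectionM_ext N _ _ fun x hx => ?_
    obtain ⟨W', h', hxW', H'⟩ := H x hx
    refine ⟨W', h', hxW', ?_⟩
    refine Eq.trans ?_ H'
    have e1 := congr($((g ≫ (adj.homEquiv _ _).symm j).mapPresheaf.naturality (homOfLE h').op).hom e)
    exact e1.symm
  · intro W h e e' H H'
    rw [map_add, map_add, H, H']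
  · intro V h a m
    rw [hg, hLτ]
    change ((adj.homEquiv _ _).symm j).app _ (a • onSections η V m) = _
    rw [Scheme.Modules.Hom.app_smul, h3]

end Adjoint

end KatzGieseker

end



noncomputable section

namespace KatzGieseker

/-! ### Frobenius and étale algebras -/

section EtaleFrobenius

open TensorProduct

/-- A finitely generated idempotent ideal is generated by an idempotent element, and a nilpotent
idempotent is zero. -/
theorem eq_bot_of_isIdempotentElem_of_fg {R : Type*} [CommRing R] {I : Ideal R} (hI : IsIdempotentElem I)
    (hfg : I.FG) (hnil : ∀ x ∈ I, IsNilpotent x) : I = ⊥ := by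
  obtain ⟨e, he, rfl⟩ := (Ideal.isIdempotentElem_iff_of_fg I hfg).1 hI
  obtain ⟨n, hn⟩ := hnil e (Ideal.mem_span_singleton_self e)
  have : e = 0 := by
    rcases n.eq_zero_or_pos with rfl | h
    · rw [pow_zero] at hn
      rw [← mul_one e, hn, mul_zero]
    · rw [← hn, he.pow_eq h.ne']
  rw [this]
  exact Ideal.span_singleton_eq_bot.2 rfl

/-- Since `b ^ p` comes from `C`, the elements `1 ⊗ b - b ⊗ 1` are nilpotent. They generate the
ideal of the diagonal, which is finitely generated and idempotent, hence zero; so `C → B` is an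
epimorphism. It is integral of finite type, hence finite, and a finite epimorphism is surjective.
The kernel is then finitely generated, idempotent by étaleness, and nil by the second condition, so
it vanishes too. -/
theorem bijective_algebraMap_of_etale {p : ℕ} [hp : Fact p.Prime] {C B : Type*} [CommRing C]
    [CommRing B] [Algebra C B] [Algebra.Etale C B] (hB : (p : B) = 0)
    (h1 : ∀ b : B, ∃ c, algebraMap C B c = b ^ p) (h2 : ∀ c, algebraMap C B c = 0 → c ^ p = 0) :
    Function.Bijective (algebraMap C B) := by
  have hT : (p : B ⊗[C] B) = 0 := by
    have := congr(Algebra.TensorProduct.includeLeftRingHom (R := C) (B := B) $hB)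
    rwa [map_natCast, map_zero] at this
  have hbot : KaehlerDifferential.ideal C B = ⊥ := by
    refine eq_bot_of_isIdempotentElem_of_fg ((Ideal.cotangent_subsingleton_iff _).mp <|
      inferInstanceAs <| Subsingleton Ω[B⁄C]) (KaehlerDifferential.ideal_fg C B) fun x hx => ?_
    rw [← mem_nilradical]
    revert x
    change KaehlerDifferential.ideal C B ≤ nilradical _
    rw [← KaehlerDifferential.span_range_eq_ideal, Ideal.span_le]
    rintro _ ⟨b, rfl⟩
    refine ⟨p, ?_⟩
    obtain ⟨c, hc⟩ := h1 b
    have := map_sub (powHom p hT) ((1 : B) ⊗ₜ[C] b) (b ⊗ₜ[C] (1 : B))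
    refine this.trans ?_
    change ((1 : B) ⊗ₜ[C] b) ^ p - (b ⊗ₜ[C] (1 : B)) ^ p = 0
    rw [Algebra.TensorProduct.tmul_pow, Algebra.TensorProduct.tmul_pow, one_pow, ← hc,
      Algebra.algebraMap_eq_smul_one, TensorProduct.tmul_smul, TensorProduct.smul_tmul', sub_self]
  have hepi : Algebra.IsEpi C B := (Algebra.isEpi_iff_forall_one_tmul_eq C B).2 fun b => by
    have := KaehlerDifferential.one_smul_sub_smul_one_mem_ideal C b
    rw [hbot, Ideal.mem_bot, sub_eq_zero] at this
    exact this
  have hIntegral : Algebra.IsIntegral C B := ⟨fun b => by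
    obtain ⟨c, hc⟩ := h1 b
    refine IsIntegral.of_pow hp.out.pos ?_
    rw [← hc]
    exact isIntegral_algebraMap⟩
  have hfin : Module.Finite C B := Algebra.IsIntegral.finite
  have hsurj := (Algebra.isEpi_iff_surjective_algebraMap_of_finite (R := C) (A := B)).1 hepi
  refine ⟨?_, hsurj⟩
  rw [RingHom.injective_iff_ker_eq_bot]
  refine eq_bot_of_isIdempotentElem_of_fg
    ((Algebra.FormallyEtale.iff_of_surjective hsurj).1 inferInstance) ?_ fun x hx => ⟨p, h2 x hx⟩
  exact Algebra.FinitePresentation.ker_fG_of_surjective (Algebra.ofId C B) hsurj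

theorem natCast_eq_zero_of_hom (p : ℕ) {R T : Type*} [CommRing R] [CommRing T] (φ : R →+* T)
    (h : (p : R) = 0) : (p : T) = 0 := by
  rw [← map_natCast φ, h, map_zero]

variable (p : ℕ) [hp : Fact p.Prime]

/-- The pushout `T` is étale over `A`, and so is `B`; therefore the comparison map `π : T ⟶ B` is
étale. The Frobenius of `B` factors as `inr ≫ π` and that of `T` as `π ≫ inr`, which are the two
conditions under which an étale map is bijective. -/
theorem isPushout_frobenius_of_etale {A B : CommRingCat.{u}} (g : A ⟶ B) (hg : g.hom.Etale)
    (hA : (p : A) = 0) (hB : (p : B) = 0) :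
    IsPushout (CommRingCat.ofHom (powHom p hA)) g g (CommRingCat.ofHom (powHom p hB)) := by
  set φ := CommRingCat.ofHom (powHom p hA)
  set φ' := CommRingCat.ofHom (powHom p hB)
  have w : φ ≫ g = g ≫ φ' := by
    ext a
    exact map_pow g.hom a p
  let T := pushout φ g
  have hT : (p : T) = 0 := natCast_eq_zero_of_hom p (pushout.inl φ g).hom hA
  let π : T ⟶ B := pushout.desc g φ' w
  have hinl : (pushout.inl φ g).hom.Etale :=
    (((RingHom.isStableUnderCobaseChange_toMorphismProperty_iff).2
      RingHom.Etale.isStableUnderBaseChange).of_isPushout (f' := pushout.inl φ g)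
        (IsPushout.of_hasPushout φ g) hg)
  have hπ : (pushout.inl φ g) ≫ π = g := pushout.inl_desc _ _ _
  have hπ' : (pushout.inr φ g) ≫ π = φ' := pushout.inr_desc _ _ _
  have hπe : π.hom.Etale := by
    algebraize [(pushout.inl φ g).hom, π.hom, g.hom]
    have : IsScalarTower A T B := .of_algebraMap_eq fun x => congr($(hπ).hom x).symm
    exact RingHom.etale_algebraMap.2 (Algebra.Etale.of_restrictScalars A T B)
  have hfr : CommRingCat.ofHom (powHom p hT) = π ≫ pushout.inr φ g := by
    apply pushout.hom_ext
    · rw [← Category.assoc, hπ, ← pushout.condition]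
      ext a
      exact (map_pow (pushout.inl φ g).hom a p).symm
    · rw [← Category.assoc, hπ']
      ext a
      exact (map_pow (pushout.inr φ g).hom a p).symm
  have hbij : Function.Bijective π.hom := by
    algebraize [π.hom]
    refine bijective_algebraMap_of_etale (p := p) hB (fun b => ?_) fun c hc => ?_
    · exact ⟨(pushout.inr φ g).hom b, congr($(hπ').hom b)⟩
    · have := congr($(hfr).hom c)
      refine this.trans ?_
      change (pushout.inr φ g).hom (π.hom c) = 0
      rw [show π.hom c = 0 from hc, map_zero]
  have : IsIso π := by
    rw [ConcreteCategory.isIso_iff_bijective]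
    exact hbij
  exact (IsPushout.of_hasPushout φ g).of_iso (Iso.refl _) (Iso.refl _) (Iso.refl _) (asIso π)
    (by simp) (by simp) (by simpa using hπ) (by simpa using hπ')

attribute [local instance] MvPolynomial.algebraMvPolynomial in
theorem isPushout_mvPolynomial {R R' : CommRingCat.{u}} (φ : R ⟶ R') (σ : Type) :
    IsPushout φ (CommRingCat.ofHom (MvPolynomial.C (σ := σ)))
      (CommRingCat.ofHom (MvPolynomial.C (σ := σ)))
      (CommRingCat.ofHom (MvPolynomial.map (σ := σ) φ.hom)) := by
  algebraize [φ.hom]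
  exact CommRingCat.isPushout_of_isPushout R R' (MvPolynomial σ R) (MvPolynomial σ R')

/-- A finite basis stays a basis after base change. -/
theorem bijective_basis_of_isPushout {A A' B B' : CommRingCat.{u}} {n : A ⟶ A'} {g : A ⟶ B}
    {g' : A' ⟶ B'} {F : B ⟶ B'} (h : IsPushout n g g' F) {J : Type} [Fintype J] (b : J → A')
    (hb : Function.Bijective fun c : J → A => ∑ j, b j * n.hom (c j)) :
    Function.Bijective fun c : J → B => ∑ j, g'.hom (b j) * F.hom (c j) := by
  algebraize [n.hom, g.hom, g'.hom, F.hom, (g ≫ F).hom]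
  have t1 : IsScalarTower A B B' := .of_algebraMap_eq fun _ => rfl
  have t2 : IsScalarTower A A' B' := .of_algebraMap_eq fun x => congr($(h.w).hom x).symm
  have hp : Algebra.IsPushout A A' B B' := CommRingCat.isPushout_iff_isPushout.1 h
  let e : (J → A) ≃ₗ[A] A' := LinearEquiv.ofBijective
    { toFun := fun c => ∑ j, b j * n.hom (c j)
      map_add' := fun c c' => by simp [mul_add, Finset.sum_add_distrib]
      map_smul' := fun a c => by
        simp only [Pi.smul_apply, smul_eq_mul, map_mul, RingHom.id_apply, Finset.smul_sum]
        refine Finset.sum_congr rfl fun j _ => ?_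
        rw [Algebra.smul_def]
        exact mul_left_comm _ _ _ } hb
  let β : Module.Basis J A A' := Module.Basis.ofEquivFun e.symm
  have hβ : ∀ j, β j = b j := fun j => by
    classical
    simp only [β, Module.Basis.coe_ofEquivFun, LinearEquiv.symm_symm]
    change (∑ i, b i * n.hom ((Pi.single j 1 : J → A) i)) = b j
    rw [Finset.sum_eq_single j]
    · simp
    · intro i _ hi
      simp [hi]
    · simp
  let β' := hp.symm.out.basis β
  have := β'.equivFun.symm.bijective
  convert this using 2 with c
  rw [Module.Basis.equivFun_symm_apply]
  refine Finset.sum_congr rfl fun j _ => ?_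
  rw [IsBaseChange.basis_apply, hβ, Algebra.smul_def, mul_comm]
  rfl

/-- Division of exponents by `p` with remainder: the coefficient of the sum at `x^{β + p m}` is the
coefficient of `c β` at `x^m`, and every exponent has exactly one such form. -/
theorem bijective_mvPolynomial_expand {R : Type*} [CommRing R] (d : ℕ) :
    Function.Bijective fun c : (Fin d → Fin p) → MvPolynomial (Fin d) R =>
      ∑ β, (∏ i, MvPolynomial.X i ^ (β i : ℕ)) * MvPolynomial.expand p (c β) := by
  have hmon : ∀ β : Fin d → ℕ, (∏ i, MvPolynomial.X i ^ (β i) : MvPolynomial (Fin d) R) =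
      MvPolynomial.monomial (Finsupp.equivFunOnFinite.symm β) 1 := by
    intro β
    rw [MvPolynomial.monomial_eq, Finsupp.prod_fintype _ _ (by simp)]
    simp
  constructor
  · intro c c' h
    have key : ∀ (c : (Fin d → Fin p) → MvPolynomial (Fin d) R) (β : Fin d → Fin p)
        (m : Fin d →₀ ℕ), MvPolynomial.coeff
          (Finsupp.equivFunOnFinite.symm (fun i => (β i : ℕ)) + p • m)
          (∑ β, (∏ i, MvPolynomial.X i ^ (β i : ℕ)) * MvPolynomial.expand p (c β)) =
        MvPolynomial.coeff m (c β) := by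
      intro c β m
      rw [MvPolynomial.coeff_sum, Finset.sum_eq_single β]
      · rw [hmon fun i => (β i : ℕ), MvPolynomial.coeff_monomial_mul, one_mul,
          MvPolynomial.coeff_expand_smul _ hp.out.ne_zero]
      · intro β' _ hne
        rw [hmon fun i => (β' i : ℕ), MvPolynomial.coeff_monomial_mul']
        split_ifs with hle
        · obtain ⟨i, hi⟩ := Function.ne_iff.1 hne
          rw [MvPolynomial.coeff_expand_of_not_dvd (i := i), mul_zero]
          intro hdvd
          have h1 := hle i
          simp only [Finsupp.coe_tsub, Pi.sub_apply, Finsupp.coe_add, Pi.add_apply,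
            Finsupp.equivFunOnFinite_symm_apply_apply, Finsupp.coe_smul, Pi.smul_apply,
            smul_eq_mul] at hdvd h1
          have h2 : (β' i : ℕ) ≡ (β i : ℕ) + p * m i [MOD p] := (Nat.modEq_iff_dvd' h1).2 hdvd
          have h3 : (β' i : ℕ) ≡ (β i : ℕ) [MOD p] := by
            simpa [Nat.ModEq] using h2
          exact hi (Fin.ext (h3.eq_of_lt_of_lt (β' i).2 (β i).2))
        · rfl
      · simp
    funext β
    ext m
    rw [← key c, ← key c']
    exact congr(MvPolynomial.coeff _ $h)
  · intro q
    induction q using MvPolynomial.induction_on' with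
    | monomial u a =>
      classical
      refine ⟨Pi.single (fun i => ⟨u i % p, Nat.mod_lt _ hp.out.pos⟩)
        (MvPolynomial.monomial (Finsupp.equivFunOnFinite.symm fun i => u i / p) a), ?_⟩
      dsimp only
      rw [Finset.sum_eq_single (fun i => ⟨u i % p, Nat.mod_lt _ hp.out.pos⟩)]
      · rw [Pi.single_eq_same, MvPolynomial.expand_monomial, hmon fun i => u i % p,
          MvPolynomial.monomial_mul, one_mul]
        congr 2
        refine Finsupp.ext fun i => ?_
        simp [Nat.mod_add_div]
      · intro i _ hi
        rw [Pi.single_eq_of_ne hi, map_zero, mul_zero]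
      · simp
    | add q q' h h' =>
      obtain ⟨c, rfl⟩ := h
      obtain ⟨c', rfl⟩ := h'
      exact ⟨c + c', by simp [mul_add, Finset.sum_add_distrib]⟩

/-- Let `B` be étale over `R[x]` in characteristic `p`. The twist `B₁` of `B` is étale over
`R[x]`, and the monomials in `x` with exponents smaller than `p` are a basis of `B` over `B₁`
along the relative Frobenius. -/
theorem frobenius_basis_of_etale {R B B₁ : CommRingCat.{u}} (hR : (p : R) = 0) (hB : (p : B) = 0)
    {r : R ⟶ B} {r₁ : R ⟶ B₁} {q : B ⟶ B₁} {F : B₁ ⟶ B}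
    (h : IsPushout (CommRingCat.ofHom (powHom p hR)) r r₁ q) (hF : r₁ ≫ F = r)
    (hqF : q ≫ F = CommRingCat.ofHom (powHom p hB)) {d : ℕ}
    (g : MvPolynomial (Fin d) R →+* B) (hg : g.Etale) (hgr : g.comp MvPolynomial.C = r.hom) :
    (∃ g₁ : MvPolynomial (Fin d) R →+* B₁, g₁.Etale ∧ g₁.comp MvPolynomial.C = r₁.hom ∧
      ∀ i, g₁ (MvPolynomial.X i) = q.hom (g (MvPolynomial.X i))) ∧
    Function.Bijective fun c : (Fin d → Fin p) → B₁ =>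
      ∑ β, (∏ i, g (MvPolynomial.X i) ^ (β i : ℕ)) * F.hom (c β) := by
  let A := CommRingCat.of (MvPolynomial (Fin d) R)
  let gA : A ⟶ B := CommRingCat.ofHom g
  let φ := CommRingCat.ofHom (powHom p hR)
  let C : R ⟶ A := CommRingCat.ofHom MvPolynomial.C
  let m : A ⟶ A := CommRingCat.ofHom (MvPolynomial.map φ.hom)
  let n : A ⟶ A := CommRingCat.ofHom (MvPolynomial.expand p).toRingHom
  have hA : (p : A) = 0 := natCast_eq_zero_of_hom p MvPolynomial.C hR
  have hr : C ≫ gA = r := by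
    ext a
    exact congr($hgr a)
  -- The Frobenius of `A = R[x]` is `m ≫ n`, with `m` the Frobenius on coefficients and `n` the
  -- substitution `x ↦ x^p`. The map `m` is the base change of the Frobenius of `R`, so `B₁` is the
  -- base change of `B` along `m`.
  have s1 : IsPushout φ C C m := isPushout_mvPolynomial φ (Fin d)
  let g₁ : A ⟶ B₁ := s1.desc r₁ (gA ≫ q) (by rw [← Category.assoc, hr]; exact h.w)
  have hg1 : C ≫ g₁ = r₁ := s1.inl_desc _ _ _
  have hg1' : m ≫ g₁ = gA ≫ q := s1.inr_desc _ _ _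
  have s2 : IsPushout m gA g₁ q := by
    refine IsPushout.of_top (h₁₁ := φ) (v₁₁ := C) (v₁₂ := C) ?_ hg1' s1
    rw [hr, hg1]
    exact h
  have hmn : m ≫ n = CommRingCat.ofHom (powHom p hA) := by
    apply CommRingCat.hom_ext
    apply MvPolynomial.ringHom_ext
    · intro a
      change MvPolynomial.expand p (MvPolynomial.map φ.hom (MvPolynomial.C a)) =
        (MvPolynomial.C a) ^ p
      rw [MvPolynomial.map_C, MvPolynomial.expand_C, ← map_pow]
      rfl
    · intro i
      change MvPolynomial.expand p (MvPolynomial.map φ.hom (MvPolynomial.X i)) =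
        (MvPolynomial.X i) ^ p
      rw [MvPolynomial.map_X, MvPolynomial.expand_X]
  have hgX : ∀ i, g₁.hom (MvPolynomial.X i) = q.hom (g (MvPolynomial.X i)) := fun i => by
    have := congr($(hg1').hom (MvPolynomial.X i))
    refine Eq.trans ?_ this
    change g₁.hom _ = g₁.hom (MvPolynomial.map φ.hom (MvPolynomial.X i))
    rw [MvPolynomial.map_X]
  have w : n ≫ gA = g₁ ≫ F := by
    apply CommRingCat.hom_ext
    apply MvPolynomial.ringHom_ext
    · intro a
      change g (MvPolynomial.expand p (MvPolynomial.C a)) = (C ≫ g₁ ≫ F).hom a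
      rw [MvPolynomial.expand_C, ← Category.assoc, hg1, hF]
      exact congr($hgr a)
    · intro i
      change g (MvPolynomial.expand p (MvPolynomial.X i)) = F.hom (g₁.hom (MvPolynomial.X i))
      rw [MvPolynomial.expand_X, hgX, map_pow]
      exact congr($(hqF).hom (g (MvPolynomial.X i))).symm
  -- Cancel the square for `m` from the Frobenius square of the étale map `gA`. Thus `F` is a base
  -- change of `n`, and the monomial basis for `n` is carried over to `F`.
  have s3 : IsPushout n g₁ gA F := by
    refine IsPushout.of_left (h₁₁ := m) (h₂₁ := q) (v₁₁ := gA) ?_ w s2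
    rw [hmn, hqF]
    exact isPushout_frobenius_of_etale p gA hg hA hB
  refine ⟨⟨g₁.hom, ?_, congr(CommRingCat.Hom.hom $hg1), hgX⟩, ?_⟩
  · exact (((RingHom.isStableUnderCobaseChange_toMorphismProperty_iff).2
      RingHom.Etale.isStableUnderBaseChange).of_isPushout (f := gA) (f' := g₁) s2 hg)
  · have := bijective_basis_of_isPushout s3
      (fun β : Fin d → Fin p => ∏ i, MvPolynomial.X i ^ (β i : ℕ))
      (bijective_mvPolynomial_expand p d)
    convert this using 6 with c β
    change _ = g _
    rw [map_prod]
    simp only [map_pow]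

end EtaleFrobenius

end KatzGieseker

end



noncomputable section

namespace KatzGieseker

/-! ### Relative Frobenius: topology and functions -/

section PowMap

variable {X Y : Scheme.{u}}

/-- An endomorphism of a scheme that is the identity on points and `a ↦ a ^ n` on functions. -/
def IsPowMap (ρ : X ⟶ X) (n : ℕ) : Prop :=
  (∀ x, ρ x = x) ∧ ∀ (U : X.Opens) (h : ρ ⁻¹ᵁ U ≤ U) (a : Γ(X, U)),
    (ρ.app U).hom a = resO h a ^ n

theorem IsPowMap.preimage_eq {ρ : X ⟶ X} {n : ℕ} (h : IsPowMap ρ n) (U : X.Opens) :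
    ρ ⁻¹ᵁ U = U := by
  ext x
  change ρ x ∈ U ↔ x ∈ U
  rw [h.1]

theorem isPowMap_id : IsPowMap (𝟙 X) 1 :=
  ⟨fun _ => rfl, fun U h a => by
    rw [pow_one]
    exact (resO_self _ a).symm⟩

theorem IsPowMap.comp {ρ ρ' : X ⟶ X} {n n' : ℕ} (h : IsPowMap ρ n) (h' : IsPowMap ρ' n') :
    IsPowMap (ρ ≫ ρ') (n * n') := by
  refine ⟨fun x => ?_, fun U hU a => ?_⟩
  · rw [Scheme.Hom.comp_apply, h.1, h'.1]
  · have h1 : (ρ ≫ ρ').app U = _ := Scheme.Hom.comp_app ρ ρ' U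
    have h2 : ((ρ ≫ ρ').app U).hom a = (ρ.app (ρ' ⁻¹ᵁ U)).hom ((ρ'.app U).hom a) :=
      congr($(h1).hom a)
    rw [h2, h'.2 U (h'.preimage_eq U).le, h.2 _ (h.preimage_eq _).le, map_pow, resO_resO,
      ← pow_mul, mul_comm n' n]
    rfl

theorem IsPowMap.isHomeomorph {φ : X ⟶ Y} {ψ : Y ⟶ X} {n m : ℕ} (h : IsPowMap (φ ≫ ψ) n)
    (h' : IsPowMap (ψ ≫ φ) m) : IsHomeomorph φ :=
  (Homeomorph.mk (Equiv.mk φ ψ (fun x => (Scheme.Hom.comp_apply φ ψ x).symm.trans (h.1 x))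
    (fun x => (Scheme.Hom.comp_apply ψ φ x).symm.trans (h'.1 x)))
      φ.continuous ψ.continuous).isHomeomorph

variable {k : Type u} [Field k] (p : ℕ) [hp : Fact p.Prime] [CharP k p]

theorem isPowMap_absFrobenius (s : X ⟶ Spec (.of k)) : IsPowMap (absFrobenius p s) p :=
  ⟨fun _ => rfl, fun U h a => by
    have : resO h a = a := resO_self _ a
    exact congr($(this.symm) ^ p)⟩

variable {S : Scheme.{u}} (s : S ⟶ Spec (.of k))

/-- The projection from the Frobenius twist. -/
def twistFst (Y : Over S) : (frobTwist p s Y).left ⟶ Y.left :=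
  pullback.fst Y.hom (absFrobenius p s)

theorem isPullback_twist (Y : Over S) :
    IsPullback (twistFst p s Y) (frobTwist p s Y).hom Y.hom (absFrobenius p s) :=
  IsPullback.of_hasPullback _ _

theorem relFrobenius_twistFst (Y : Over S) :
    relFrobenius p s Y ≫ twistFst p s Y = absFrobenius p (Y.hom ≫ s) :=
  pullback.lift_fst _ _ _

theorem relFrobenius_hom (Y : Over S) : relFrobenius p s Y ≫ (frobTwist p s Y).hom = Y.hom :=
  pullback.lift_snd _ _ _

/-- Both composites of the relative Frobenius with the projection are absolute Frobenius morphisms,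
hence the identity on points. This makes both maps homeomorphisms. -/
theorem twistFst_relFrobenius (Y : Over S) :
    twistFst p s Y ≫ relFrobenius p s Y = absFrobenius p ((frobTwist p s Y).hom ≫ s) := by
  apply (isPullback_twist p s Y).hom_ext
  · rw [Category.assoc, relFrobenius_twistFst]
    exact (absFrobenius_comp p (twistFst p s Y) (Y.hom ≫ s)).symm
  · rw [Category.assoc, relFrobenius_hom, absFrobenius_comp]
    exact (isPullback_twist p s Y).w

theorem isHomeomorph_relFrobenius (Y : Over S) : IsHomeomorph (relFrobenius p s Y) :=
  IsPowMap.isHomeomorph (ψ := twistFst p s Y) (n := p) (m := p)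
    (by rw [relFrobenius_twistFst]; exact isPowMap_absFrobenius p _)
    (by rw [twistFst_relFrobenius]; exact isPowMap_absFrobenius p _)

theorem isHomeomorph_twistFst (Y : Over S) : IsHomeomorph (twistFst p s Y) :=
  IsPowMap.isHomeomorph (ψ := relFrobenius p s Y) (n := p) (m := p)
    (by rw [twistFst_relFrobenius]; exact isPowMap_absFrobenius p _)
    (by rw [relFrobenius_twistFst]; exact isPowMap_absFrobenius p _)

instance isAffineHom_absFrobenius : IsAffineHom (absFrobenius p s) := ⟨fun _ h => h⟩

instance isAffineHom_twistFst (Y : Over S) : IsAffineHom (twistFst p s Y) :=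
  isAffineHom_isStableUnderBaseChange.of_isPullback (isPullback_twist p s Y).flip
    (isAffineHom_absFrobenius p s)

theorem relFrobenius_preimage (Y : Over S) (U : Y.left.Opens) :
    relFrobenius p s Y ⁻¹ᵁ twistFst p s Y ⁻¹ᵁ U = U := by
  have := (isPowMap_absFrobenius p (Y.hom ≫ s)).preimage_eq U
  rw [← relFrobenius_twistFst] at this
  exact this

theorem twist_preimage_le {Y : Over S} {T : S.Opens} {U : Y.left.Opens} (h : U ≤ Y.hom ⁻¹ᵁ T) :
    twistFst p s Y ⁻¹ᵁ U ≤ (frobTwist p s Y).hom ⁻¹ᵁ T := by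
  intro y hy
  have h1 := h hy
  have h2 : Y.hom (twistFst p s Y y) = (frobTwist p s Y).hom y := by
    rw [← Scheme.Hom.comp_apply, (isPullback_twist p s Y).w]
    rfl
  change Y.hom (twistFst p s Y y) ∈ T at h1
  rw [h2] at h1
  exact h1

/-- Sections of a fibre product over affine open sets form a tensor product. The absolute Frobenius
is the identity on points, so the same `T` serves as source and target in `S`. -/
theorem isPushout_twist {Y : Over S} {T : S.Opens} (hT : IsAffineOpen T) {U : Y.left.Opens}
    (hU : IsAffineOpen U) (h : U ≤ Y.hom ⁻¹ᵁ T) :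
    IsPushout (CommRingCat.ofHom (powHom p (natCast_eq_zero_of_over p s T)))
      (Y.hom.appLE T U h)
      ((frobTwist p s Y).hom.appLE T (twistFst p s Y ⁻¹ᵁ U) (twist_preimage_le p s h))
      ((twistFst p s Y).app U) := by
  have hUY : twistFst p s Y ⁻¹ᵁ U = twistFst p s Y ⁻¹ᵁ U ⊓ (frobTwist p s Y).hom ⁻¹ᵁ T :=
    (inf_eq_left.2 (twist_preimage_le p s h)).symm
  have key := (isIso_pushoutSection_iff (isPullback_twist p s Y) (US := T) (UT := T) (UX := U)
    le_rfl h hUY).1 (isIso_pushoutSection_of_isAffineOpen _ _ _ _ hT hT hU)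
  have e : (absFrobenius p s).appLE T T le_rfl =
      CommRingCat.ofHom (powHom p (natCast_eq_zero_of_over p s T)) := by
    ext a
    exact resO_self _ _
  rw [e, Scheme.Hom.appLE_eq_app] at key
  exact key.flip

end PowMap

/-! ### Bases from a basis of the topology -/

section Criterion

variable {X Y : Scheme.{u}} {φ : X ⟶ Y}

/-- Being a local basis concerns all open sets, whereas étale coordinates give the bijection only on
certain affine ones. Injectivity is local, and the coefficients found locally are unique, so they
glue. -/
theorem localBasis_of_forall_exists {V₀ : Y.Opens} {I : Type} [Fintype I] (b : I → Γ(X, φ ⁻¹ᵁ V₀))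
    (hb : ∀ (V : Y.Opens), V ≤ V₀ → ∀ y ∈ V, ∃ (W : Y.Opens) (_ : W ≤ V) (hW : W ≤ V₀), y ∈ W ∧
      Function.Bijective fun c : I → Γ(Y, W) =>
        ∑ i, resO (preimage_le hW) (b i) * (φ.app W).hom (c i)) :
    LocalBasis φ V₀ b := by
  have hres : ∀ (V W : Y.Opens) (hV : V ≤ V₀) (h : W ≤ V) (c : I → Γ(Y, V)),
      resO (preimage_le h) (∑ i, resO (preimage_le hV) (b i) * (φ.app V).hom (c i)) =
        ∑ i, resO (preimage_le (h.trans hV)) (b i) * (φ.app W).hom (resO h (c i)) := by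
    intro V W hV h c
    simp only [map_sum, map_mul, resO_resO, resO_app φ h (preimage_le h)]
  have hinj : ∀ (V : Y.Opens) (h : V ≤ V₀), Function.Injective fun c : I → Γ(Y, V) =>
      ∑ i, resO (preimage_le h) (b i) * (φ.app V).hom (c i) := by
    intro V hV c c' hc
    funext i
    refine sectionO_ext _ _ fun y hy => ?_
    obtain ⟨W, h, hW, hyW, hbij⟩ := hb V hV y hy
    refine ⟨W, h, hyW, ?_⟩
    refine congr_fun (hbij.1 (a₁ := fun i => resO h (c i)) (a₂ := fun i => resO h (c' i)) ?_) i
    dsimp only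
    rw [← hres V W hV h, ← hres V W hV h]
    exact congr(resO (preimage_le h) $hc)
  intro V hV
  refine ⟨hinj V hV, fun e => ?_⟩
  have hc : ∀ i, ∃ r : Γ(Y, V), ∀ y ∈ V, ∃ (W : Y.Opens) (h : W ≤ V), y ∈ W ∧
      ∃ c : I → Γ(Y, W), (∑ i, resO (preimage_le (h.trans hV)) (b i) * (φ.app W).hom (c i)) =
        resO (preimage_le h) e ∧ resO h r = c i := by
    intro i
    refine exists_sectionO V (fun W h r => ∃ c : I → Γ(Y, W),
      (∑ i, resO (preimage_le (h.trans hV)) (b i) * (φ.app W).hom (c i)) =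
        resO (preimage_le h) e ∧ r = c i) ?_ ?_ ?_
    · rintro W W' h h' _ ⟨c, hc, rfl⟩
      refine ⟨fun i => resO h' (c i), ?_, rfl⟩
      rw [← hres W W' (h.trans hV) h', hc, resO_resO]
    · rintro W h _ _ ⟨c, hc, rfl⟩ ⟨c', hc', rfl⟩
      exact congr_fun (hinj W (h.trans hV) (hc.trans hc'.symm)) i
    · intro y hy
      obtain ⟨W, h, hW, hyW, hbij⟩ := hb V hV y hy
      obtain ⟨c, hc⟩ := hbij.2 (resO (preimage_le h) e)
      exact ⟨W, h, hyW, c i, c, hc, rfl⟩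
  choose c hc using hc
  refine ⟨c, sectionO_ext _ _ fun x hx => ?_⟩
  obtain ⟨W, h, hW, hyW, hbij⟩ := hb V hV (φ x) hx
  refine ⟨φ ⁻¹ᵁ W, preimage_le h, hyW, ?_⟩
  obtain ⟨c₀, hc₀⟩ := hbij.2 (resO (preimage_le h) e)
  dsimp only at hc₀ ⊢
  rw [hres V W hV h, ← hc₀]
  refine Finset.sum_congr rfl fun i _ => ?_
  congr 2
  refine sectionO_ext _ _ fun y hy => ?_
  obtain ⟨W', h', hyW', c', hc', hi⟩ := hc i y (h hy)
  refine ⟨W' ⊓ W, inf_le_right, ⟨hyW', hy⟩, ?_⟩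
  rw [resO_resO]
  have e1 : resO (inf_le_left.trans h' : W' ⊓ W ≤ V) (c i) =
      resO (inf_le_left : W' ⊓ W ≤ W') (c' i) := by rw [← hi, resO_resO]
  refine e1.trans ?_
  refine congr_fun (hinj (W' ⊓ W) (inf_le_right.trans hW)
    (a₁ := fun i => resO (inf_le_left : W' ⊓ W ≤ W') (c' i))
    (a₂ := fun i => resO (inf_le_right : W' ⊓ W ≤ W) (c₀ i)) ?_) i
  dsimp only
  rw [← hres W' (W' ⊓ W) (h'.trans hV) inf_le_left, ← hres W (W' ⊓ W) hW inf_le_right, hc', hc₀,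
    resO_resO, resO_resO]

end Criterion

/-! ### Étale coordinates -/

section Charts

variable {Y S : Scheme.{u}}

/-- `U` is an affine open subset of `Y` with étale coordinates `x` over an affine open subset
of `S`. -/
def IsChart (g : Y ⟶ S) (U : Y.Opens) {d : ℕ} (x : Fin d → Γ(Y, U)) : Prop :=
  IsAffineOpen U ∧ ∃ (T : S.Opens) (_ : IsAffineOpen T) (h : U ≤ g ⁻¹ᵁ T)
    (G : MvPolynomial (Fin d) Γ(S, T) →+* Γ(Y, U)), G.Etale ∧
      G.comp MvPolynomial.C = (g.appLE T U h).hom ∧ ∀ i, G (MvPolynomial.X i) = x i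

theorem exists_isChart (g : Y ⟶ S) [Smooth g] (y : Y) :
    ∃ (U : Y.Opens) (d : ℕ) (x : Fin d → Γ(Y, U)), y ∈ U ∧ IsChart g U x := by
  obtain ⟨T, hT, U, hU, hy, h, hs⟩ := Smooth.exists_isStandardSmooth g y
  obtain ⟨d, G, hG, hG'⟩ := hs.exists_etale_mvPolynomial
  exact ⟨U, d, fun i => G (MvPolynomial.X i), hy, hU, T, hT, h, G, hG', hG, fun _ => rfl⟩

theorem IsChart.basicOpen {g : Y ⟶ S} {U : Y.Opens} {d : ℕ} {x : Fin d → Γ(Y, U)}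
    (hx : IsChart g U x) (a : Γ(Y, U)) :
    IsChart g (Y.basicOpen a) fun i => resO (Y.basicOpen_le a) (x i) := by
  obtain ⟨hU, T, hT, h, G, hG, hGC, hGx⟩ := hx
  refine ⟨hU.basicOpen a, T, hT, (Y.basicOpen_le a).trans h,
    (resO (Y.basicOpen_le a)).comp G, ?_, ?_, fun i => congr(resO (Y.basicOpen_le a) $(hGx i))⟩
  · refine RingHom.Etale.stableUnderComposition _ _ hG ?_
    have := hU.isLocalization_basicOpen a
    have h2 : Algebra.Etale Γ(Y, U) Γ(Y, Y.basicOpen a) := Algebra.Etale.of_isLocalizationAway a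
    exact RingHom.etale_algebraMap.2 h2
  · rw [RingHom.comp_assoc, hGC, ← CommRingCat.hom_comp, Scheme.Hom.appLE_map]

variable {k : Type u} [Field k] (p : ℕ) [hp : Fact p.Prime] [CharP k p] (s : S ⟶ Spec (.of k))

theorem isChart_twist_and_bijective {Y : Over S} {U : Y.left.Opens} {d : ℕ}
    {x : Fin d → Γ(Y.left, U)} (hx : IsChart Y.hom U x) :
    IsChart (frobTwist p s Y).hom (twistFst p s Y ⁻¹ᵁ U)
      (fun i => ((twistFst p s Y).app U).hom (x i)) ∧
    Function.Bijective fun c : (Fin d → Fin p) → Γ((frobTwist p s Y).left, twistFst p s Y ⁻¹ᵁ U) =>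
      ∑ β, (∏ i, resO (relFrobenius_preimage p s Y U).le (x i) ^ (β i : ℕ)) *
        ((relFrobenius p s Y).app _).hom (c β) := by
  obtain ⟨hU, T, hT, h, G, hG, hGC, hGx⟩ := hx
  have hle := (relFrobenius_preimage p s Y U).ge
  have hFr : ∀ r, ((relFrobenius p s Y).appLE (twistFst p s Y ⁻¹ᵁ U) U hle).hom r =
      resO hle (((relFrobenius p s Y).app _).hom r) := fun r => rfl
  have hF : (frobTwist p s Y).hom.appLE T (twistFst p s Y ⁻¹ᵁ U) (twist_preimage_le p s h) ≫
      (relFrobenius p s Y).appLE (twistFst p s Y ⁻¹ᵁ U) U hle = Y.hom.appLE T U h := by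
    rw [Scheme.Hom.appLE_comp_appLE]
    simp only [relFrobenius_hom]
  have hqF : (twistFst p s Y).app U ≫ (relFrobenius p s Y).appLE (twistFst p s Y ⁻¹ᵁ U) U hle =
      CommRingCat.ofHom (powHom p (natCast_eq_zero_of_over p (Y.hom ≫ s) U)) := by
    rw [← Scheme.Hom.appLE_eq_app, Scheme.Hom.appLE_comp_appLE]
    simp only [relFrobenius_twistFst]
    ext a
    exact resO_self _ _
  obtain ⟨⟨G₁, hG₁, hG₁C, hG₁x⟩, hbij⟩ := frobenius_basis_of_etale p
    (natCast_eq_zero_of_over p s T) (natCast_eq_zero_of_over p (Y.hom ≫ s) U)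
    (isPushout_twist p s hT hU h) hF hqF G hG hGC
  refine ⟨⟨hU.preimage _, T, hT, twist_preimage_le p s h, G₁, hG₁, hG₁C, fun i => ?_⟩, ?_⟩
  · rw [hG₁x, hGx]
  · have hl := (relFrobenius_preimage p s Y U).le
    -- The preimage of the twist of `U` under Frobenius equals `U`, but not definitionally;
    -- restriction between the two transports the basis.
    have hb : Function.Bijective (resO hl) := by
      refine Function.bijective_iff_has_inverse.2 ⟨resO hle, fun a => ?_, fun a => ?_⟩
      · rw [resO_resO, resO_self]
      · rw [resO_resO, resO_self]
    have := hb.comp hbij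
    convert this using 2 with c
    simp only [Function.comp, map_sum, map_mul, map_prod, map_pow, hGx]
    refine Finset.sum_congr rfl fun β _ => ?_
    rw [hFr, resO_resO, resO_self]

/-- Basic open subsets of a chart are charts for the restricted coordinates. Since the projection
from the twist is a homeomorphism, their preimages are enough open sets to test a local basis. -/
theorem IsChart.localBasis_relFrobenius {Y : Over S} {U : Y.left.Opens} {d : ℕ}
    {x : Fin d → Γ(Y.left, U)} (hx : IsChart Y.hom U x) :
    LocalBasis (relFrobenius p s Y) (twistFst p s Y ⁻¹ᵁ U) fun β : Fin d → Fin p =>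
      ∏ i, resO (relFrobenius_preimage p s Y U).le (x i) ^ (β i : ℕ) := by
  refine localBasis_of_forall_exists _ fun V hV y hy => ?_
  obtain ⟨V', rfl⟩ := exists_preimage_eq (isHomeomorph_twistFst p s Y) V
  have hV' := le_of_preimage_le (isHomeomorph_twistFst p s Y) hV
  obtain ⟨a, ha, hya⟩ := hx.1.exists_basicOpen_le (⟨twistFst p s Y y, hy⟩ : V') (hV' hy)
  refine ⟨twistFst p s Y ⁻¹ᵁ Y.left.basicOpen a, preimage_le ha,
    preimage_le (Y.left.basicOpen_le a), hya, ?_⟩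
  have := (isChart_twist_and_bijective p s (hx.basicOpen a)).2
  convert this using 6 with c β
  rw [map_prod]
  refine Finset.prod_congr rfl fun i _ => ?_
  rw [map_pow, resO_resO, resO_resO]

end Charts

end KatzGieseker

end



noncomputable section

namespace KatzGieseker

/-! ### Iterated twists -/

section Iterated

variable {k : Type u} [Field k] (p : ℕ) [hp : Fact p.Prime] [CharP k p]
  {S X : Scheme.{u}} (s : S ⟶ Spec (.of k)) (f : X ⟶ S)

/-- The projection `X^{(i+1)} ⟶ X^{(i)}`. -/
def twistStep (i : ℕ) : twist p s f (i + 1) ⟶ twist p s f i := twistFst p s (twistOver p s f i)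

theorem twistProj_succ (i : ℕ) : twistProj p s f (i + 1) =
    twistStep p s f i ≫ twistProj p s f i := rfl

theorem frob_preimage_twistStep (i : ℕ) (U : (twist p s f i).Opens) :
    frob p s f i ⁻¹ᵁ twistStep p s f i ⁻¹ᵁ U = U :=
  relFrobenius_preimage p s (twistOver p s f i) U

theorem frob_app_twistStep (i : ℕ) (U : (twist p s f i).Opens)
    (h : frob p s f i ⁻¹ᵁ twistStep p s f i ⁻¹ᵁ U ≤ U) (a : Γ(twist p s f i, U)) :
    ((frob p s f i).app _).hom (((twistStep p s f i).app U).hom a) = resO h a ^ p := by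
  have h2 := isPowMap_absFrobenius p ((twistOver p s f i).hom ≫ s)
  rw [← relFrobenius_twistFst] at h2
  have h3 := h2.2 U h a
  rw [Scheme.Hom.comp_app] at h3
  exact h3

theorem twistStep_preimage_le {i : ℕ} {T : S.Opens} {U : (twist p s f i).Opens}
    (h : U ≤ twistHom p s f i ⁻¹ᵁ T) :
    twistStep p s f i ⁻¹ᵁ U ≤ twistHom p s f (i + 1) ⁻¹ᵁ T :=
  twist_preimage_le p s (Y := twistOver p s f i) h

theorem isPushout_twistStep {i : ℕ} {T : S.Opens} (hT : IsAffineOpen T)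
    {U : (twist p s f i).Opens} (hU : IsAffineOpen U) (h : U ≤ twistHom p s f i ⁻¹ᵁ T) :
    IsPushout (CommRingCat.ofHom (powHom p (natCast_eq_zero_of_over p s T)))
      ((twistHom p s f i).appLE T U h)
      ((twistHom p s f (i + 1)).appLE T (twistStep p s f i ⁻¹ᵁ U) (twistStep_preimage_le p s f h))
      ((twistStep p s f i).app U) :=
  isPushout_twist p s (Y := twistOver p s f i) hT hU h

/-- The absolute Frobenius commutes with every morphism, so the last Frobenius can be moved to the
front, where it is the absolute Frobenius of `X`. Each step contributes one factor `p`. -/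
theorem isPowMap_frobIter_twistProj : ∀ i : ℕ,
    IsPowMap (frobIter p s f i ≫ twistProj p s f i) (p ^ i)
  | 0 => by
    rw [pow_zero]
    exact isPowMap_id
  | i + 1 => by
    have h : frobIter p s f (i + 1) ≫ twistProj p s f (i + 1) =
        absFrobenius p (f ≫ s) ≫ frobIter p s f i ≫ twistProj p s f i := by
      have h1 : frobIter p s f (i + 1) ≫ twistProj p s f (i + 1) =
          frobIter p s f i ≫ (relFrobenius p s (twistOver p s f i) ≫
            twistFst p s (twistOver p s f i)) ≫ twistProj p s f i := by
        simp only [frobIter, twistProj_succ, Category.assoc]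
        rfl
      rw [h1, relFrobenius_twistFst, ← Category.assoc, ← Category.assoc]
      congr 1
      exact (absFrobenius_comp p (frobIter p s f i) ((twistOver p s f i).hom ≫ s)).symm
    rw [h, pow_succ']
    exact (isPowMap_absFrobenius p _).comp (isPowMap_frobIter_twistProj i)

theorem isHomeomorph_frob (i : ℕ) : IsHomeomorph (frob p s f i) :=
  isHomeomorph_relFrobenius p s _

theorem isHomeomorph_frobIter : ∀ i : ℕ, IsHomeomorph (frobIter p s f i)
  | 0 => (Homeomorph.refl X).isHomeomorph
  | i + 1 => by
    have h : ⇑(frobIter p s f (i + 1)) = frob p s f i ∘ frobIter p s f i := by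
      funext x
      exact Scheme.Hom.comp_apply _ _ x
    rw [h]
    exact (isHomeomorph_frob p s f i).comp (isHomeomorph_frobIter i)

theorem frobIter_twistHom : ∀ i : ℕ, frobIter p s f i ≫ twistHom p s f i = f
  | 0 => Category.id_comp _
  | i + 1 => by
    have h : frob p s f i ≫ twistHom p s f (i + 1) = twistHom p s f i :=
      relFrobenius_hom p s _
    change (frobIter p s f i ≫ frob p s f i) ≫ twistHom p s f (i + 1) = f
    rw [Category.assoc, h, frobIter_twistHom i]

theorem frobIter_preimage_twistHom (i : ℕ) (T : S.Opens) :
    frobIter p s f i ⁻¹ᵁ twistHom p s f i ⁻¹ᵁ T = f ⁻¹ᵁ T :=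
  congrArg (fun g : X ⟶ S => g ⁻¹ᵁ T) (frobIter_twistHom p s f i)

theorem frobIter_succ_app (i : ℕ) {V : (twist p s f (i + 1)).Opens}
    (c : Γ(twist p s f (i + 1), V)) : ((frobIter p s f (i + 1)).app V).hom c =
      ((frobIter p s f i).app _).hom (((frob p s f i).app V).hom c) := by
  have := congr($(Scheme.Hom.comp_app (frobIter p s f i) (frob p s f i) V).hom c)
  exact this

theorem frobIter_preimage_twistProj (i : ℕ) (U : X.Opens) :
    frobIter p s f i ⁻¹ᵁ twistProj p s f i ⁻¹ᵁ U = U :=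
  (isPowMap_frobIter_twistProj p s f i).preimage_eq U

theorem frobIter_app_twistProj (i : ℕ) (U : X.Opens)
    (h : frobIter p s f i ⁻¹ᵁ twistProj p s f i ⁻¹ᵁ U ≤ U) (a : Γ(X, U)) :
    ((frobIter p s f i).app _).hom (((twistProj p s f i).app U).hom a) = resO h a ^ p ^ i := by
  have h1 := (isPowMap_frobIter_twistProj p s f i).2 U h a
  have h2 := congr($(Scheme.Hom.comp_app (frobIter p s f i) (twistProj p s f i) U).hom a)
  exact h2.symm.trans h1

theorem frob_preimage_twistProj (i : ℕ) (U : X.Opens) :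
    frob p s f i ⁻¹ᵁ twistProj p s f (i + 1) ⁻¹ᵁ U = twistProj p s f i ⁻¹ᵁ U :=
  frob_preimage_twistStep p s f i (twistProj p s f i ⁻¹ᵁ U)

/-- The functions on `X^{(i)}` induced by functions on `X`. -/
def coord (i : ℕ) {U : X.Opens} {d : ℕ} (x : Fin d → Γ(X, U)) :
    Fin d → Γ(twist p s f i, twistProj p s f i ⁻¹ᵁ U) :=
  fun j => ((twistProj p s f i).app U).hom (x j)

theorem IsChart.coord {U : X.Opens} {d : ℕ} {x : Fin d → Γ(X, U)} (hx : IsChart f U x) :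
    ∀ i, IsChart (twistHom p s f i) (twistProj p s f i ⁻¹ᵁ U) (KatzGieseker.coord p s f i x)
  | 0 => hx
  | i + 1 => (isChart_twist_and_bijective p s (IsChart.coord hx i)).1

/-- The monomials in the coordinates of `X^{(i)}` with exponents less than `p`. -/
def frobMono (i : ℕ) {U : X.Opens} {d : ℕ} (x : Fin d → Γ(X, U)) (β : Fin d → Fin p) :
    Γ(twist p s f i, frob p s f i ⁻¹ᵁ twistProj p s f (i + 1) ⁻¹ᵁ U) :=
  ∏ j, resO (frob_preimage_twistProj p s f i U).le (KatzGieseker.coord p s f i x j) ^ (β j : ℕ)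

/-- The monomials in the coordinates of `X` with exponents less than `p ^ i`. -/
def iterMono (i : ℕ) {U : X.Opens} {d : ℕ} (x : Fin d → Γ(X, U)) (α : Fin d → Fin (p ^ i)) :
    Γ(X, frobIter p s f i ⁻¹ᵁ twistProj p s f i ⁻¹ᵁ U) :=
  ∏ j, resO (frobIter_preimage_twistProj p s f i U).le (x j) ^ (α j : ℕ)

theorem IsChart.localBasis_frob {U : X.Opens} {d : ℕ} {x : Fin d → Γ(X, U)} (hx : IsChart f U x)
    (i : ℕ) : LocalBasis (frob p s f i) (twistProj p s f (i + 1) ⁻¹ᵁ U) (frobMono p s f i x) :=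
  (hx.coord p s f i).localBasis_relFrobenius p s

/-- Splitting off the last digit in base `p`. -/
def digitsEquiv (d i : ℕ) :
    (Fin d → Fin (p ^ (i + 1))) ≃ (Fin d → Fin (p ^ i)) × (Fin d → Fin p) :=
  (Equiv.arrowCongr (Equiv.refl _)
    ((finCongr (pow_succ' p i)).trans (finProdFinEquiv.symm.trans (Equiv.prodComm _ _)))).trans
      (Equiv.arrowProdEquivProdArrow _ _ _)

omit hp in
theorem digitsEquiv_apply (d i : ℕ) (α : Fin d → Fin (p ^ (i + 1))) (j : Fin d) :
    (α j : ℕ) = (digitsEquiv p d i α).1 j + p ^ i * (digitsEquiv p d i α).2 j := by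
  obtain ⟨β, rfl⟩ := (digitsEquiv p d i).symm.surjective α
  rw [Equiv.apply_symm_apply]
  rfl

/-- Write `α = α₁ + p^i α₂` with `α₁ < p^i` and `α₂ < p`. The coordinates of `X^{(i)}` pull back to
the powers `x_j^{p^i}`, so they account for the factor with exponent `α₂`. -/
theorem iterMono_succ (i : ℕ) {U : X.Opens} {d : ℕ} (x : Fin d → Γ(X, U))
    (α : Fin d → Fin (p ^ (i + 1))) :
    iterMono p s f (i + 1) x α =
      resO (preimage_le (frob_preimage_twistProj p s f i U).le)
        (iterMono p s f i x (digitsEquiv p d i α).1) *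
      ((frobIter p s f i).app _).hom (frobMono p s f i x (digitsEquiv p d i α).2) := by
  have h : ∀ j, ((frobIter p s f i).app (frob p s f i ⁻¹ᵁ twistProj p s f (i + 1) ⁻¹ᵁ U)).hom
      (resO (frob_preimage_twistProj p s f i U).le (KatzGieseker.coord p s f i x j)) =
      resO (frobIter_preimage_twistProj p s f (i + 1) U).le (x j) ^ p ^ i := by
    intro j
    rw [← resO_app (frobIter p s f i) (frob_preimage_twistProj p s f i U).le
      (preimage_le (frob_preimage_twistProj p s f i U).le)]
    refine (congr(resO (preimage_le (φ := frobIter p s f i) (frob_preimage_twistProj p s f i U).le)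
      $(frobIter_app_twistProj p s f i U (frobIter_preimage_twistProj p s f i U).le (x j)))).trans ?_
    rw [map_pow, resO_resO]
    rfl
  simp only [iterMono, frobMono, map_prod, map_pow, h, resO_resO]
  rw [← Finset.prod_mul_distrib]
  refine Finset.prod_congr rfl fun j _ => ?_
  rw [digitsEquiv_apply p d i α j, pow_add, pow_mul]
  rfl

omit hp in
theorem localBasis_id {V₀ : X.Opens} {I : Type} [Fintype I] [Unique I]
    (b : I → Γ(X, 𝟙 X ⁻¹ᵁ V₀)) (hb : b default = 1) : LocalBasis (𝟙 X) V₀ b := by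
  intro V hV
  have hbij := (Equiv.funUnique I Γ(X, V)).bijective
  refine (congrArg Function.Bijective (funext fun c => ?_)).mpr hbij
  rw [Fintype.sum_unique, hb, map_one, one_mul]
  rfl

theorem IsChart.localBasis_frobIter {U : X.Opens} {d : ℕ} {x : Fin d → Γ(X, U)}
    (hx : IsChart f U x) : ∀ i,
      LocalBasis (frobIter p s f i) (twistProj p s f i ⁻¹ᵁ U) (iterMono p s f i x)
  | 0 => by
    have : Unique (Fin d → Fin (p ^ 0)) := by
      rw [pow_zero]
      infer_instance
    have h : ∀ α : Fin d → Fin (p ^ 0), iterMono p s f 0 x α = 1 := fun α =>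
      Finset.prod_eq_one fun j _ => by
        rw [Nat.lt_one_iff.1 (lt_of_lt_of_eq (α j).is_lt (pow_zero p)), pow_zero]
    exact localBasis_id _ (h _)
  | i + 1 => by
    have h := ((IsChart.localBasis_frobIter hx i).comp (frob_preimage_twistProj p s f i U).le
      (hx.localBasis_frob p s f i)).reindex (digitsEquiv p d i)
    have e : iterMono p s f (i + 1) x = _ := funext fun α => iterMono_succ p s f i x α
    rw [e]
    exact h

/-- The subring of functions on an open subset of `X` generated by functions from `S` and `p ^ i`-th powers. -/
def frobSubring (i : ℕ) (W : X.Opens) : Subring Γ(X, W) :=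
  Subring.closure ({a | ∃ (T : S.Opens) (h : W ≤ f ⁻¹ᵁ T) (t : Γ(S, T)), a = (f.appLE T W h).hom t} ∪
    Set.range fun a : Γ(X, W) => a ^ p ^ i)

omit hp in
theorem resO_mem_frobSubring {i : ℕ} {W W' : X.Opens} (h : W' ≤ W) {a : Γ(X, W)}
    (ha : a ∈ frobSubring p f i W) : resO h a ∈ frobSubring p f i W' := by
  have : frobSubring p f i W ≤ (frobSubring p f i W').comap (resO h) := by
    refine Subring.closure_le.2 ?_
    rintro _ (⟨T, hT, t, rfl⟩ | ⟨a, rfl⟩)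
    · refine Subring.subset_closure (Or.inl ⟨T, h.trans hT, t, ?_⟩)
      exact congr($(Scheme.Hom.appLE_map f hT (homOfLE h).op).hom t)
    · exact Subring.subset_closure (Or.inr ⟨resO h a, (map_pow _ _ _).symm⟩)
  exact this ha

/-- In characteristic `p` the map `a ↦ a^p` is a ring homomorphism, so only generators have to be
tested. -/
theorem pow_mem_frobSubring (s : S ⟶ Spec (.of k)) {i : ℕ} {W : X.Opens} {a : Γ(X, W)}
    (ha : a ∈ frobSubring p f i W) :
    a ^ p ∈ frobSubring p f (i + 1) W := by
  have : frobSubring p f i W ≤ (frobSubring p f (i + 1) W).comap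
      (powHom p (natCast_eq_zero_of_over p (f ≫ s) W)) := by
    refine Subring.closure_le.2 ?_
    rintro _ (⟨T, hT, t, rfl⟩ | ⟨a, rfl⟩)
    · have h : (f.appLE T W hT).hom t ∈ frobSubring p f (i + 1) W :=
        Subring.subset_closure (Or.inl ⟨T, hT, t, rfl⟩)
      exact pow_mem h p
    · refine Subring.subset_closure (Or.inr ⟨a, ?_⟩)
      change a ^ p ^ (i + 1) = (a ^ p ^ i) ^ p
      rw [pow_succ, pow_mul]
  exact this ha

/-- The functions on an open subset of `Z` whose pullback to `X` belongs to `frobSubring` near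
a given point. -/
def nearSubring {Z : Scheme.{u}} (φ : X ⟶ Z) (V : Z.Opens) (x : X) (hx : x ∈ φ ⁻¹ᵁ V) (i : ℕ) :
    Subring Γ(Z, V) where
  carrier := {c | ∃ (W : X.Opens) (h : W ≤ φ ⁻¹ᵁ V), x ∈ W ∧
    resO h ((φ.app V).hom c) ∈ frobSubring p f i W}
  mul_mem' := by
    rintro c₁ c₂ ⟨W₁, h₁, hx₁, m₁⟩ ⟨W₂, h₂, hx₂, m₂⟩
    refine ⟨W₁ ⊓ W₂, inf_le_left.trans h₁, ⟨hx₁, hx₂⟩, ?_⟩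
    have := mul_mem (resO_mem_frobSubring p f (inf_le_left : W₁ ⊓ W₂ ≤ W₁) m₁)
      (resO_mem_frobSubring p f (inf_le_right : W₁ ⊓ W₂ ≤ W₂) m₂)
    rwa [resO_resO, resO_resO, ← map_mul, ← map_mul] at this
  one_mem' := ⟨φ ⁻¹ᵁ V, le_rfl, hx, by
    rw [map_one, map_one]
    exact one_mem _⟩
  add_mem' := by
    rintro c₁ c₂ ⟨W₁, h₁, hx₁, m₁⟩ ⟨W₂, h₂, hx₂, m₂⟩
    refine ⟨W₁ ⊓ W₂, inf_le_left.trans h₁, ⟨hx₁, hx₂⟩, ?_⟩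
    have := add_mem (resO_mem_frobSubring p f (inf_le_left : W₁ ⊓ W₂ ≤ W₁) m₁)
      (resO_mem_frobSubring p f (inf_le_right : W₁ ⊓ W₂ ≤ W₂) m₂)
    rwa [resO_resO, resO_resO, ← map_add, ← map_add] at this
  zero_mem' := ⟨φ ⁻¹ᵁ V, le_rfl, hx, by
    rw [map_zero, map_zero]
    exact zero_mem _⟩
  neg_mem' := by
    rintro c₁ ⟨W₁, h₁, hx₁, m₁⟩
    exact ⟨W₁, h₁, hx₁, by rw [map_neg, map_neg]; exact neg_mem m₁⟩

omit hp in
-- A subring containing the images of both maps receives a map from the pushout, which splits the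
-- inclusion of the subring.
theorem eq_top_of_isPushout {A B C D : CommRingCat.{u}} {a : A ⟶ B} {b : A ⟶ C} {r : B ⟶ D}
    {q : C ⟶ D} (h : IsPushout a b r q) (K : Subring D) (hr : ∀ t, r.hom t ∈ K)
    (hq : ∀ t, q.hom t ∈ K) : K = ⊤ := by
  let K' := CommRingCat.of K
  let r' : B ⟶ K' := CommRingCat.ofHom (r.hom.codRestrict K hr)
  let q' : C ⟶ K' := CommRingCat.ofHom (q.hom.codRestrict K hq)
  let ι : K' ⟶ D := CommRingCat.ofHom K.subtype
  let σ := h.desc r' q' (by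
    ext t
    exact congr($(h.w).hom t))
  have hσ : σ ≫ ι = 𝟙 _ := by
    apply h.hom_ext
    · rw [← Category.assoc, h.inl_desc, Category.comp_id]
      rfl
    · rw [← Category.assoc, h.inr_desc, Category.comp_id]
      rfl
  rw [eq_top_iff]
  intro c _
  have h2 : ι.hom (σ.hom c) = c := congr($(hσ).hom c)
  rw [← h2]
  exact (σ.hom c).2

/-- Induction on `i`. On a small affine open set, the functions on `X^{(i+1)}` are generated by
functions from `S` and pullbacks of functions `b` on `X^{(i)}`; on `X`, such a pullback is the
`p`-th power of the pullback of `b` along `F^i`. The neighbourhood found for `b` depends on `b`,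
which is why the generation argument is run inside `nearSubring`. -/
theorem exists_mem_frobSubring [Smooth f] : ∀ (i : ℕ) (V : (twist p s f i).Opens)
    (c : Γ(twist p s f i, V)) (x : X), x ∈ frobIter p s f i ⁻¹ᵁ V →
    ∃ (W : X.Opens) (h : W ≤ frobIter p s f i ⁻¹ᵁ V), x ∈ W ∧
      resO h (((frobIter p s f i).app V).hom c) ∈ frobSubring p f i W
  | 0, V, c, x, hx => by
    refine ⟨frobIter p s f 0 ⁻¹ᵁ V, le_rfl, hx, ?_⟩
    rw [resO_self]
    exact Subring.subset_closure (Or.inr ⟨_, by simp only [pow_zero, pow_one]; rfl⟩)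
  | i + 1, V, c, x, hx => by
    obtain ⟨U, d, y, hxU, hy⟩ := exists_isChart f x
    obtain ⟨hU, T, hT, hUT, -⟩ := hy.coord p s f i
    obtain ⟨V', rfl⟩ := exists_preimage_eq (φ := twistStep p s f i)
      (isHomeomorph_twistFst p s (twistOver p s f i)) V
    have hxU' : frobIter p s f i x ∈ twistProj p s f i ⁻¹ᵁ U :=
      (frobIter_preimage_twistProj p s f i U).ge hxU
    have hxV' : frobIter p s f i x ∈ V' := by
      have h := preimage_le (φ := frobIter p s f i) (frob_preimage_twistStep p s f i V').le
      exact h hx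
    obtain ⟨a, ha, hxa⟩ := hU.exists_basicOpen_le (⟨frobIter p s f i x, hxV'⟩ : V') hxU'
    let U' : (twist p s f i).Opens := (twist p s f i).basicOpen a
    have hU'T : U' ≤ twistHom p s f i ⁻¹ᵁ T := ((twist p s f i).basicOpen_le a).trans hUT
    have hFle : U' ≤ frob p s f i ⁻¹ᵁ twistStep p s f i ⁻¹ᵁ U' :=
      (frob_preimage_twistStep p s f i U').ge
    have hxW : x ∈ frobIter p s f (i + 1) ⁻¹ᵁ twistStep p s f i ⁻¹ᵁ U' :=
      preimage_le (φ := frobIter p s f i) hFle hxa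
    have hK : nearSubring p f (frobIter p s f (i + 1)) (twistStep p s f i ⁻¹ᵁ U') x hxW (i + 1) =
        ⊤ := by
      refine eq_top_of_isPushout (isPushout_twistStep p s f hT (hU.basicOpen a) hU'T) _ ?_ ?_
      · intro t
        have hle : frobIter p s f (i + 1) ⁻¹ᵁ twistStep p s f i ⁻¹ᵁ U' ≤ f ⁻¹ᵁ T :=
          (preimage_le (φ := frobIter p s f (i + 1)) (twistStep_preimage_le p s f hU'T)).trans
            (frobIter_preimage_twistHom p s f (i + 1) T).le
        refine ⟨_, le_rfl, hxW, Subring.subset_closure (Or.inl ⟨T, hle, t, ?_⟩)⟩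
        rw [resO_self]
        have e1 := Scheme.Hom.appLE_comp_appLE (frobIter p s f (i + 1)) (twistHom p s f (i + 1)) T
          (twistStep p s f i ⁻¹ᵁ U') (frobIter p s f (i + 1) ⁻¹ᵁ twistStep p s f i ⁻¹ᵁ U')
          (twistStep_preimage_le p s f hU'T) le_rfl
        simp only [frobIter_twistHom] at e1
        rw [← e1, Scheme.Hom.appLE_eq_app]
        rfl
      · intro b
        obtain ⟨W, hW, hxW', hm⟩ := exists_mem_frobSubring i U' b x hxa
        have hle : W ≤ frobIter p s f (i + 1) ⁻¹ᵁ twistStep p s f i ⁻¹ᵁ U' :=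
          hW.trans (preimage_le (φ := frobIter p s f i) hFle)
        refine ⟨W, hle, hxW', ?_⟩
        have hl := (frob_preimage_twistStep p s f i U').le
        have e1 : resO hle (((frobIter p s f (i + 1)).app _).hom
            (((twistStep p s f i).app U').hom b)) =
            (resO hW (((frobIter p s f i).app U').hom b)) ^ p := by
          rw [frobIter_succ_app, frob_app_twistStep p s f i U' hl, map_pow, ← resO_app (frobIter p s f i)
            hl (preimage_le hl), ← map_pow]
          refine (resO_resO (preimage_le (φ := frobIter p s f i) hl) hle _).trans ?_
          rw [map_pow]
        rw [e1]
        exact pow_mem_frobSubring p f s hm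
    obtain ⟨W, h, hxW', hm⟩ := (hK ▸ Subring.mem_top (resO (preimage_le ha) c) :
      resO (preimage_le ha) c ∈ nearSubring p f (frobIter p s f (i + 1))
        (twistStep p s f i ⁻¹ᵁ U') x hxW (i + 1))
    refine ⟨W, h.trans (preimage_le (φ := frobIter p s f (i + 1)) (preimage_le ha)), hxW', ?_⟩
    rw [← resO_app (frobIter p s f (i + 1)) (preimage_le ha) (preimage_le (preimage_le ha)),
      resO_resO] at hm
    exact hm

end Iterated

end KatzGieseker

end



noncomputable section

namespace KatzGieseker

/-! ### Quasi-coherence -/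

section Quasicoherent

variable {X : Scheme.{u}}

/-- Sections of `M` over basic open subsets of `U` are fractions of sections over `U`. -/
def IsLocalizingOn (M : X.Modules) (U : X.Opens) : Prop :=
  ∀ a : Γ(X, U),
    (∀ e : Γ(M, X.basicOpen a), ∃ (n : ℕ) (e₀ : Γ(M, U)),
      resM M (X.basicOpen_le a) e₀ = resO (X.basicOpen_le a) a ^ n • e) ∧
    ∀ e₀ : Γ(M, U), resM M (X.basicOpen_le a) e₀ = 0 → ∃ n : ℕ, a ^ n • e₀ = 0

theorem fromSpec_image_le {U : X.Opens} (hU : IsAffineOpen U) (W : (Spec Γ(X, U)).Opens) :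
    hU.fromSpec ''ᵁ W ≤ U := by
  rintro _ ⟨x, _, rfl⟩
  have : hU.fromSpec x ∈ Set.range hU.fromSpec := ⟨x, rfl⟩
  rwa [hU.range_fromSpec] at this

theorem fromSpec_image_top {U : X.Opens} (hU : IsAffineOpen U) : hU.fromSpec ''ᵁ ⊤ = U := by
  ext x
  change x ∈ hU.fromSpec '' Set.univ ↔ _
  rw [Set.image_univ, hU.range_fromSpec]

/-- Sections of the restriction of `M` to the spectrum of an affine open set. -/
def toSpecSection {U : X.Opens} (hU : IsAffineOpen U) (M : X.Modules)
    (W : (Spec Γ(X, U)).Opens) : Γ(M, hU.fromSpec ''ᵁ W) →+ Γ(M.restrict hU.fromSpec, W) :=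
  (M.restrictAppIso hU.fromSpec W).inv.hom

theorem smul_toSpecSection {U : X.Opens} (hU : IsAffineOpen U) (M : X.Modules)
    {W : (Spec Γ(X, U)).Opens} (r : Γ(X, U)) (e : Γ(M, hU.fromSpec ''ᵁ W)) :
    r • toSpecSection hU M W e = toSpecSection hU M W (resO (fromSpec_image_le hU W) r • e) := by
  have h1 : (hU.fromSpec.appIso W).inv.hom ((Spec Γ(X, U)).presheaf.map W.leTop.op
      ((Scheme.ΓSpecIso Γ(X, U)).inv r)) = resO (fromSpec_image_le hU W) r := by
    have h2 : (Scheme.ΓSpecIso Γ(X, U)).inv ≫ (Spec Γ(X, U)).presheaf.map W.leTop.op =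
        X.presheaf.map (homOfLE (fromSpec_image_le hU W)).op ≫ (hU.fromSpec.appIso W).hom := by
      rw [Scheme.Hom.appIso_hom', Scheme.Hom.map_appLE, Scheme.Hom.appLE, hU.fromSpec_app_self,
        Category.assoc, ← Functor.map_comp]
      rfl
    have h3 := congr($(h2) ≫ (hU.fromSpec.appIso W).inv)
    rw [Category.assoc, Category.assoc, Iso.hom_inv_id, Category.comp_id] at h3
    exact congr($(h3).hom r)
  rw [Scheme.Modules.smul_Spec_def, ← h1]
  rfl

/-- Restriction along `fromSpec` leaves sections unchanged except for the propositional equality of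
`fromSpec ''ᵁ D a` with `X.basicOpen a`. The maps `τ` and `σ` record this identification, and the
conditions then correspond term by term. -/
theorem isLocalizing_restrict_iff {U : X.Opens} (hU : IsAffineOpen U) (M : X.Modules) :
    IsLocalizing (modulesSpecToSheaf.obj (M.restrict hU.fromSpec)) ↔ IsLocalizingOn M U := by
  have ht := fromSpec_image_top hU
  let D : Γ(X, U) → (Spec Γ(X, U)).Opens := fun a => PrimeSpectrum.basicOpen a
  have hb : ∀ a, hU.fromSpec ''ᵁ D a = X.basicOpen a := hU.fromSpec_image_basicOpen
  have hle : ∀ a, hU.fromSpec ''ᵁ D a ≤ hU.fromSpec ''ᵁ ⊤ := fun a => ht.symm ▸ fromSpec_image_le hU _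
  let τ : Γ(M, hU.fromSpec ''ᵁ ⊤) →+ (modulesSpecToSheaf.obj (M.restrict hU.fromSpec)).obj.obj (.op ⊤) :=
    toSpecSection hU M ⊤
  let σ : ∀ a, Γ(M, hU.fromSpec ''ᵁ D a) →+
    (modulesSpecToSheaf.obj (M.restrict hU.fromSpec)).obj.obj (.op (D a)) := fun a =>
    toSpecSection hU M (D a)
  have hτ : ∀ (r : Γ(X, U)) e, r • τ e = τ (resO (fromSpec_image_le hU ⊤) r • e) :=
    fun r e => smul_toSpecSection hU M r e
  have hσ : ∀ (a r : Γ(X, U)) e, r • σ a e = σ a (resO (fromSpec_image_le hU (D a)) r • e) :=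
    fun a r e => smul_toSpecSection hU M r e
  have hσi : ∀ a, Function.Injective (σ a) := fun a x y h => h
  have hτi : Function.Injective τ := fun x y h => h
  have hτs : Function.Surjective τ := fun x => ⟨x, rfl⟩
  have hσs : ∀ a, Function.Surjective (σ a) := fun a x => ⟨x, rfl⟩
  have hm : ∀ a e, ((modulesSpecToSheaf.obj (M.restrict hU.fromSpec)).obj.map
      (D a).leTop.op).hom (τ e) = σ a (resM M (hle a) e) := fun a e => rfl
  refine ⟨fun h a => ⟨fun e => ?_, fun e₀ he₀ => ?_⟩, fun h a => ⟨fun x => ?_, fun e => ?_, ?_⟩⟩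
  · obtain ⟨⟨e₀, ⟨_, n, rfl⟩⟩, h1⟩ := (h a).surj (σ a (resM M (hb a).le e))
    obtain ⟨e₀, rfl⟩ := hτs e₀
    refine ⟨n, resM M ht.ge e₀, ?_⟩
    have h4 := congr(resM M (hb a).ge $(hσi a ((hσ a _ _).symm.trans (h1.trans (hm a e₀)))))
    rw [resM_smul, resM_resM, resM_self, resM_resM, resO_resO] at h4
    rw [resM_resM, ← map_pow]
    exact h4.symm
  · obtain ⟨⟨_, n, rfl⟩, h1⟩ := (h a).exists_of_eq (x₁ := τ (resM M ht.le e₀)) (x₂ := 0) (by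
      rw [map_zero]
      refine (hm a _).trans ?_
      have h2 : resM M (hle a) (resM M ht.le e₀) =
          resM M (hb a).le (resM M (X.basicOpen_le a) e₀) := by rw [resM_resM, resM_resM]
      rw [h2, he₀, map_zero, map_zero])
    refine ⟨n, ?_⟩
    rw [smul_zero] at h1
    have h3 := hτi ((hτ (a ^ n) _).symm.trans (h1.trans (map_zero τ).symm))
    have h4 := congr(resM M ht.ge $h3)
    rw [resM_smul, resM_resM, resM_self, resO_resO, resO_self, map_zero] at h4
    exact h4
  · obtain ⟨_, n, rfl⟩ := x
    rw [map_pow]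
    exact (Scheme.Modules.isUnit_algebraMap_end_of_le_basicOpen a le_rfl).pow n
  · obtain ⟨e, rfl⟩ := hσs a e
    obtain ⟨n, e₀, he₀⟩ := (h a).1 (resM M (hb a).ge e)
    refine ⟨⟨τ (resM M ht.le e₀), ⟨_, n, rfl⟩⟩, ?_⟩
    refine (hσ a (a ^ n) e).trans (Eq.trans ?_ (hm a _).symm)
    have h2 := congr(resM M (hb a).le $he₀)
    rw [resM_smul, resM_resM, resM_resM, resM_self, map_pow, resO_resO] at h2
    rw [map_pow, resM_resM, h2]
  · intro e e' hee'
    obtain ⟨e, rfl⟩ := hτs e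
    obtain ⟨e', rfl⟩ := hτs e'
    have h1 := hσi a ((hm a e).symm.trans (hee'.trans (hm a e')))
    have h2 : resM M (X.basicOpen_le a) (resM M ht.ge (e - e')) = 0 := by
      have := congr(resM M (hb a).ge $h1)
      rw [resM_resM, resM_resM] at this
      rw [resM_resM, map_sub, this, sub_self]
    obtain ⟨n, hn⟩ := (h a).2 _ h2
    refine ⟨⟨_, n, rfl⟩, ?_⟩
    have h3 := congr(resM M ht.le $hn)
    rw [resM_smul, resM_resM, resM_self, map_zero, smul_sub, sub_eq_zero] at h3
    exact (hτ (a ^ n) e).trans (congr(τ $h3).trans (hτ (a ^ n) e').symm)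

theorem IsAffineOpen.isLocalizingOn {U : X.Opens} (hU : IsAffineOpen U) (M : X.Modules)
    [M.IsQuasicoherent] : IsLocalizingOn M U := by
  rw [← isLocalizing_restrict_iff hU, ← isIso_fromTildeΓ_iff_isLocalizing]
  infer_instance

/-- Transport of a presentation along an isomorphism. -/
def presentationOfIso {M N : X.Modules} (e : M ≅ N) (P : M.Presentation) : N.Presentation :=
  @SheafOfModules.Presentation.ofIsIso _ _ _ _ _ _ _ _ e.hom (inferInstanceAs (IsIso e.hom)) P

theorem nonempty_presentation_of_isIso {R : CommRingCat.{u}} (M : (Spec R).Modules)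
    [IsIso M.fromTildeΓ] : Nonempty (M.Presentation) :=
  ⟨presentationOfIso (asIso M.fromTildeΓ)
    (presentationTilde.{u} _ .univ (by simp) _ (Submodule.span_eq _))⟩

theorem nonempty_presentation_restrict {U : X.Opens} (hU : IsAffineOpen U) (M : X.Modules)
    (h : IsLocalizingOn M U) : Nonempty (M.restrict U.ι).Presentation := by
  have : IsIso (M.restrict hU.fromSpec).fromTildeΓ := by
    rw [isIso_fromTildeΓ_iff_isLocalizing, isLocalizing_restrict_iff]
    exact h
  obtain ⟨P⟩ := nonempty_presentation_of_isIso (M.restrict hU.fromSpec)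
  let P' := Scheme.Modules.presentationRestrict hU.isoSpec.hom P
  have e : hU.isoSpec.hom ≫ hU.fromSpec = U.ι := by
    rw [← hU.isoSpec_inv_ι, Iso.hom_inv_id_assoc]
  let iso : Scheme.Modules.restrictFunctor hU.fromSpec ⋙
      Scheme.Modules.restrictFunctor hU.isoSpec.hom ≅ Scheme.Modules.restrictFunctor U.ι :=
    (Scheme.Modules.restrictFunctorComp hU.isoSpec.hom hU.fromSpec).symm ≪≫
      Scheme.Modules.restrictFunctorCongr e
  exact ⟨presentationOfIso (iso.app M) P'⟩

theorem nonempty_presentation_over {U : X.Opens} (M : X.Modules)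
    (P : (M.restrict U.ι).Presentation) :
    Nonempty (SheafOfModules.over M U).Presentation := by
  let e := Scheme.Modules.overEquiv U
  let η : SheafOfModules.unit (X.ringCatSheaf.over U) ≅
      e.inverse.obj (SheafOfModules.unit (U : Scheme.{u}).ringCatSheaf) :=
    e.unitIso.app _ ≪≫ e.inverse.mapIso
      ((Scheme.Modules.overFunctorEquiv U).app (SheafOfModules.unit X.ringCatSheaf) ≪≫
        Scheme.Modules.restrictUnitIso U.ι)
  let iso : e.inverse.obj (M.restrict U.ι) ≅ SheafOfModules.over M U :=
    e.inverse.mapIso ((Scheme.Modules.overFunctorEquiv U).app M).symm ≪≫ (e.unitIso.app _).symm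
  have hpres : PreservesColimitsOfSize.{u, u} e.inverse := inferInstance
  exact ⟨SheafOfModules.Presentation.ofIsIso.{u, u, u} iso.hom
    (@SheafOfModules.Presentation.map _ _ _ _ _ _ _ _ _ _ _ _ _ P e.inverse hpres η)⟩

/-- The criterion by which `E^{(i)}` is shown to be quasi-coherent. On each of the affine open sets
the module is the one associated with its sections, which has a presentation; presentations on a
cover are what quasi-coherence requires. -/
theorem isQuasicoherent_of_isLocalizingOn (M : X.Modules)
    (h : ∀ x : X, ∃ U : X.Opens, x ∈ U ∧ IsAffineOpen U ∧ IsLocalizingOn M U) :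
    M.IsQuasicoherent := by
  choose U hxU hU hM using h
  have hP : ∀ x, Nonempty (SheafOfModules.over M (U x)).Presentation := fun x => by
    obtain ⟨P⟩ := nonempty_presentation_restrict (hU x) M (hM x)
    exact nonempty_presentation_over M P
  let q : SheafOfModules.QuasicoherentData (R := X.ringCatSheaf) M :=
    { I := X
      X := U
      coversTop := by
        rw [Opens.coversTop_iff, IsOpenCover, eq_top_iff]
        exact fun x _ => Opens.mem_iSup.2 ⟨x, hxU x⟩
      presentation := fun x => (hP x).some }
  exact q.isQuasicoherent

end Quasicoherent

end KatzGieseker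
end



noncomputable section

namespace KatzGieseker

/-! ### Construction of sheaves of modules -/

section ModData

variable {X : Scheme.{u}}

/-- Sections, restriction maps and gluing for a sheaf of modules. -/
structure ModData (X : Scheme.{u}) where
  /-- sections -/
  obj : X.Opens → Type u
  [group : ∀ U, AddCommGroup (obj U)]
  [module : ∀ U, Module Γ(X, U) (obj U)]
  /-- restriction maps -/
  res {U V : X.Opens} (h : V ≤ U) : obj U →+ obj V
  res_self (U : X.Opens) (e : obj U) : res le_rfl e = e
  res_res {U V W : X.Opens} (h : V ≤ U) (h' : W ≤ V) (e : obj U) :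
    res h' (res h e) = res (h'.trans h) e
  res_smul {U V : X.Opens} (h : V ≤ U) (a : Γ(X, U)) (e : obj U) :
    res h (a • e) = resO h a • res h e
  ext {U : X.Opens} (e e' : obj U) :
    (∀ x ∈ U, ∃ (V : X.Opens) (h : V ≤ U), x ∈ V ∧ res h e = res h e') → e = e'
  glue {ι : Type u} (U : ι → X.Opens) (e : ∀ i, obj (U i)) :
    (∀ i j, res (inf_le_left : U i ⊓ U j ≤ U i) (e i) =
      res (inf_le_right : U i ⊓ U j ≤ U j) (e j)) →
    ∃ s : obj (iSup U), ∀ i, res (le_iSup U i) s = e i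

attribute [instance] ModData.group ModData.module

namespace ModData

variable (D : ModData X)

/-- The underlying presheaf of abelian groups. -/
def presheaf : TopCat.Presheaf Ab.{u} X where
  obj U := AddCommGrpCat.of (D.obj U.unop)
  map i := AddCommGrpCat.ofHom (D.res i.unop.le)
  map_id U := by
    ext e
    exact D.res_self _ e
  map_comp i j := by
    ext e
    exact (D.res_res i.unop.le j.unop.le e).symm

/-- The sheaf of modules. -/
def toModules : X.Modules where
  val := @PresheafOfModules.ofPresheaf _ _ X.ringCatSheaf.obj D.presheaf
    (fun U => D.module U.unop) (fun {_ _} i r e => D.res_smul i.unop.le r e)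
  isSheaf := by
    refine (TopCat.Presheaf.isSheaf_iff_isSheafUniqueGluing D.presheaf).2 fun ι U sf hsf => ?_
    obtain ⟨s, hs⟩ := D.glue U sf hsf
    refine ⟨s, hs, fun t ht => D.ext _ _ fun x hx => ?_⟩
    obtain ⟨i, hi⟩ := Opens.mem_iSup.1 hx
    exact ⟨U i, le_iSup U i, hi, (ht i).trans (hs i).symm⟩

/-- Elements of `D.obj U` as sections. -/
def toSection {U : X.Opens} : D.obj U ≃+ Γ(D.toModules, U) := AddEquiv.refl _

theorem resM_toSection {U V : X.Opens} (h : V ≤ U) (e : D.obj U) :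
    resM D.toModules h (D.toSection e) = D.toSection (D.res h e) := rfl

theorem smul_toSection {U : X.Opens} (a : Γ(X, U)) (e : D.obj U) : a • D.toSection e = D.toSection (a • e) := rfl

end ModData

theorem exists_glueM (N : X.Modules) {ι : Type u} (U : ι → X.Opens) (e : ∀ i, Γ(N, U i))
    (h : ∀ i j, resM N (inf_le_left : U i ⊓ U j ≤ U i) (e i) =
      resM N (inf_le_right : U i ⊓ U j ≤ U j) (e j)) :
    ∃ s : Γ(N, iSup U), ∀ i, resM N (le_iSup U i) s = e i := by
  have h' : TopCat.Presheaf.IsCompatible (typeSheafM N).obj U e := h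
  obtain ⟨s, hs, -⟩ := (typeSheafM N).existsUnique_gluing U e h'
  exact ⟨s, hs⟩

/-- A hom of modules given on sections. -/
theorem exists_hom_of_sections {N N' : X.Modules} (L : ∀ W : X.Opens, Γ(N, W) →+ Γ(N', W))
    (hL : ∀ (V W : X.Opens) (h : W ≤ V) (e : Γ(N, V)), resM N' h (L V e) = L W (resM N h e))
    (hs : ∀ W (a : Γ(X, W)) (e : Γ(N, W)), L W (a • e) = a • L W e) :
    ∃ g : N ⟶ N', ∀ W (e : Γ(N, W)), g.app W e = L W e :=
  exists_hom_of_modFam (fun W => L W.1) (fun V W h e => hL V.1 W.1 h e) hs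

end ModData

/-! ### Bases from the adjoint isomorphism -/

section BasisOfAdjoint

variable {X Y : Scheme.{u}} {φ : X ⟶ Y}

/-- The image of an open set under a homeomorphism. -/
def imageOpen (hφ : IsHomeomorph φ) (W : X.Opens) : Y.Opens := ⟨φ '' W, hφ.isOpenMap _ W.2⟩

theorem preimage_imageOpen (hφ : IsHomeomorph φ) (W : X.Opens) : φ ⁻¹ᵁ imageOpen hφ W = W := by
  ext x
  exact hφ.injective.mem_set_image

theorem imageOpen_preimage (hφ : IsHomeomorph φ) (V : Y.Opens) :
    imageOpen hφ (φ ⁻¹ᵁ V) = V := by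
  ext y
  exact (Set.image_preimage_eq (V : Set Y) hφ.surjective) ▸ Iff.rfl

theorem imageOpen_mono (hφ : IsHomeomorph φ) {W W' : X.Opens} (h : W ≤ W') :
    imageOpen hφ W ≤ imageOpen hφ W' := Set.image_mono h

namespace LocalBasis

variable {V₀ : Y.Opens} {I : Type} [Fintype I] {b : I → Γ(X, φ ⁻¹ᵁ V₀)} (hb : LocalBasis φ V₀ b)

/-- The coordinates of a function with respect to a local basis. -/
def coef {V : Y.Opens} (h : V ≤ V₀) : Γ(X, φ ⁻¹ᵁ V) ≃+ (I → Γ(Y, V)) :=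
  ({ Equiv.ofBijective _ (hb V h) with
    map_add' := fun c c' => by
      simp only [Equiv.toFun_as_coe, Equiv.ofBijective_apply, Pi.add_apply, map_add,
        mul_add, Finset.sum_add_distrib] } : (I → Γ(Y, V)) ≃+ Γ(X, φ ⁻¹ᵁ V)).symm

theorem coef_symm {V : Y.Opens} (h : V ≤ V₀) (c : I → Γ(Y, V)) : (hb.coef h).symm c =
    ∑ i, resO (preimage_le h) (b i) * (φ.app V).hom (c i) := rfl

theorem sum_coef {V : Y.Opens} (h : V ≤ V₀) (a : Γ(X, φ ⁻¹ᵁ V)) :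
    (∑ i, resO (preimage_le h) (b i) * (φ.app V).hom (hb.coef h a i)) = a :=
  (hb.coef h).symm_apply_apply a

theorem coef_eq {V : Y.Opens} (h : V ≤ V₀) (a : Γ(X, φ ⁻¹ᵁ V)) (c : I → Γ(Y, V))
    (hc : (∑ i, resO (preimage_le h) (b i) * (φ.app V).hom (c i)) = a) : hb.coef h a = c := by
  rw [← hc, ← hb.coef_symm h, AddEquiv.apply_symm_apply]

theorem resO_coef {V V' : Y.Opens} (h : V ≤ V₀) (h' : V' ≤ V) (a : Γ(X, φ ⁻¹ᵁ V)) (i : I) :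
    resO h' (hb.coef h a i) = hb.coef (h'.trans h) (resO (preimage_le h') a) i := by
  refine (congr_fun (hb.coef_eq _ _ (fun i => resO h' (hb.coef h a i)) ?_) i).symm
  conv_rhs => rw [← hb.sum_coef h a]
  simp only [map_sum, map_mul, resO_resO, resO_app φ h' (preimage_le h')]

theorem coef_basis [DecidableEq I] {V : Y.Opens} (h : V ≤ V₀) (i : I) :
    hb.coef h (resO (preimage_le h) (b i)) = Pi.single i 1 := by
  refine hb.coef_eq h _ _ ?_
  rw [Finset.sum_eq_single i]
  · rw [Pi.single_eq_same, map_one, mul_one]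
  · intro k _ hk
    rw [Pi.single_eq_of_ne hk, map_zero, mul_zero]
  · simp

theorem coef_mul {V : Y.Opens} (h : V ≤ V₀) (a : Γ(X, φ ⁻¹ᵁ V)) (c : Γ(Y, V)) (i : I) :
    hb.coef h (a * (φ.app V).hom c) i = hb.coef h a i * c := by
  refine congr_fun (hb.coef_eq h _ (fun i => hb.coef h a i * c) ?_) i
  conv_rhs => rw [← hb.sum_coef h a, Finset.sum_mul]
  refine Finset.sum_congr rfl fun i _ => ?_
  rw [map_mul, mul_assoc]

theorem coef_mul_mul {V : Y.Opens} (h : V ≤ V₀) (a a' : Γ(X, φ ⁻¹ᵁ V)) (i : I) :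
    hb.coef h (a * a') i =
      ∑ l, hb.coef h (a * resO (preimage_le h) (b l)) i * hb.coef h a' l := by
  conv_lhs => rw [← hb.sum_coef h a', Finset.mul_sum]
  rw [map_sum, Finset.sum_apply]
  refine Finset.sum_congr rfl fun l _ => ?_
  rw [← mul_assoc, hb.coef_mul h]

/-- The tensor product of `φ_* 𝒪_X` and `M` over `V₀`, described by coordinates. -/
def tensorData (hφ : IsHomeomorph φ) (M : Y.Modules) : ModData X :=
  let im : X.Opens → Y.Opens := fun W => imageOpen hφ W ⊓ V₀
  have hle : ∀ W, im W ≤ V₀ := fun W => inf_le_right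
  have him : ∀ W, φ ⁻¹ᵁ im W ≤ W := fun W =>
    (preimage_le inf_le_left).trans (preimage_imageOpen hφ W).le
  have hmono : ∀ {W W' : X.Opens}, W' ≤ W → im W' ≤ im W := fun h =>
    inf_le_inf_right _ (imageOpen_mono hφ h)
  -- A function acts on coordinate vectors through the matrix of multiplication by it in the basis
  -- `b`.
  let act : ∀ W, Γ(X, W) → (I → Γ(M, im W)) → (I → Γ(M, im W)) := fun W a m k =>
    ∑ i, hb.coef (hle W) (resO (him W) a * resO (preimage_le (hle W)) (b i)) k • m i
  { obj := fun W => I → Γ(M, im W)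
    module := fun W =>
      { smul := act W
        one_smul := fun m => by
          classical
          funext k
          change ∑ i, hb.coef (hle W) (resO (him W) 1 * resO (preimage_le (hle W)) (b i)) k • m i = _
          rw [Finset.sum_eq_single k]
          · rw [map_one, one_mul, hb.coef_basis, Pi.single_eq_same, one_smul]
          · intro i _ hi
            rw [map_one, one_mul, hb.coef_basis, Pi.single_eq_of_ne hi.symm, zero_smul]
          · simp
        mul_smul := fun a a' m => by
          funext k
          change ∑ i, hb.coef (hle W) (resO (him W) (a * a') * resO (preimage_le (hle W)) (b i)) k • m i =
            ∑ l, hb.coef (hle W) (resO (him W) a * resO (preimage_le (hle W)) (b l)) k •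
              ∑ i, hb.coef (hle W) (resO (him W) a' * resO (preimage_le (hle W)) (b i)) l • m i
          simp only [map_mul, mul_assoc, Finset.smul_sum]
          rw [Finset.sum_comm]
          refine Finset.sum_congr rfl fun i _ => ?_
          rw [hb.coef_mul_mul (hle W), Finset.sum_smul]
          exact Finset.sum_congr rfl fun l _ => mul_smul _ _ _
        smul_zero := fun a => by
          funext k
          exact Finset.sum_eq_zero fun i _ => smul_zero _
        smul_add := fun a m m' => by
          funext k
          change ∑ i, _ • (m i + m' i) = ∑ i, _ • m i + ∑ i, _ • m' i
          simp only [smul_add, Finset.sum_add_distrib]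
        add_smul := fun a a' m => by
          funext k
          change ∑ i, hb.coef (hle W) (resO (him W) (a + a') * resO (preimage_le (hle W)) (b i)) k • m i =
            ∑ i, _ • m i + ∑ i, _ • m i
          rw [← Finset.sum_add_distrib]
          refine Finset.sum_congr rfl fun i _ => ?_
          rw [map_add, add_mul, map_add, Pi.add_apply, add_smul]
        zero_smul := fun m => by
          funext k
          refine Finset.sum_eq_zero fun i _ => ?_
          rw [map_zero, zero_mul, map_zero, Pi.zero_apply, zero_smul] }
    res := fun {W W'} h =>
      { toFun := fun m k => resM M (hmono h) (m k)
        map_zero' := by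
          funext k
          exact map_zero _
        map_add' := fun m m' => by
          funext k
          exact map_add _ _ _ }
    res_self := fun W m => by
      funext k
      exact resM_self _ _ _
    res_res := fun h h' m => by
      funext k
      exact resM_resM _ _ _ _
    res_smul := fun {W W'} h a m => by
      funext k
      change resM M (hmono h) (∑ i, hb.coef (hle W) (resO (him W) a *
          resO (preimage_le (hle W)) (b i)) k • m i) =
        ∑ i, hb.coef (hle W') (resO (him W') (resO h a) * resO (preimage_le (hle W')) (b i)) k •
          resM M (hmono h) (m i)
      rw [map_sum]
      refine Finset.sum_congr rfl fun i _ => ?_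
      rw [resM_smul, hb.resO_coef (hle W) (hmono h), map_mul, resO_resO, resO_resO, resO_resO]
    ext := fun {W} m m' hm => by
      funext k
      refine sectionM_ext M _ _ fun y hy => ?_
      obtain ⟨x, hx, rfl⟩ := hy.1
      obtain ⟨W', h, hxW', hmm⟩ := hm x hx
      exact ⟨im W', hmono h, ⟨⟨x, hxW', rfl⟩, hy.2⟩, congr_fun hmm k⟩
    glue := fun {ι} U m hm => by
      -- By injectivity of `φ`, the formation of images commutes with intersections.
      have hinf : ∀ i j, im (U i) ⊓ im (U j) ≤ im (U i ⊓ U j) := by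
        rintro i j _ ⟨⟨⟨x, hx, rfl⟩, h₀⟩, ⟨⟨x', hx', e⟩, -⟩⟩
        obtain rfl := hφ.injective e
        exact ⟨⟨x', ⟨hx, hx'⟩, rfl⟩, h₀⟩
      have key : ∀ k, ∃ s : Γ(M, iSup fun i => im (U i)),
          ∀ i, resM M (le_iSup (fun i => im (U i)) i) s = m i k := by
        refine fun k => exists_glueM M (fun i => im (U i)) (fun i => m i k) fun i j => ?_
        have := congr(resM M (hinf i j) $(congr_fun (hm i j) k))
        change resM M (hinf i j) (resM M _ (m i k)) = resM M (hinf i j) (resM M _ (m j k)) at this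
        rwa [resM_resM, resM_resM] at this
      choose s hs using key
      have hsup : im (iSup U) ≤ iSup fun i => im (U i) := by
        rintro _ ⟨⟨x, hx, rfl⟩, h₀⟩
        obtain ⟨i, hi⟩ := Opens.mem_iSup.1 hx
        exact Opens.mem_iSup.2 ⟨i, ⟨x, hi, rfl⟩, h₀⟩
      refine ⟨fun k => resM M hsup (s k), fun i => ?_⟩
      funext k
      change resM M _ (resM M hsup (s k)) = _
      rw [resM_resM]
      exact hs k i }

end LocalBasis

/-- The sections of `N` over the part of an open set in `U₀`. -/
def cutData (N : X.Modules) (U₀ : X.Opens) : ModData X where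
  obj W := Γ(N, W ⊓ U₀)
  module W := Module.compHom _ (resO (inf_le_left : W ⊓ U₀ ≤ W))
  res h := resM N (inf_le_inf_right _ h)
  res_self _ _ := resM_self _ _ _
  res_res _ _ _ := resM_resM _ _ _ _
  res_smul {W W'} h a e := by
    change resM N (inf_le_inf_right _ h) (resO (inf_le_left : W ⊓ U₀ ≤ W) a • e) =
      resO (inf_le_left : W' ⊓ U₀ ≤ W') (resO h a) • resM N (inf_le_inf_right _ h) e
    rw [resM_smul, resO_resO, resO_resO]
  ext {W} e e' he := sectionM_ext N _ _ fun x hx => by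
    obtain ⟨W', h, hxW', hee⟩ := he x hx.1
    exact ⟨W' ⊓ U₀, _, ⟨hxW', hx.2⟩, hee⟩
  glue {ι} U e he := by
    obtain ⟨s, hs⟩ := exists_glueM N (fun i => U i ⊓ U₀) e fun i j => by
      have hinf : (U i ⊓ U₀) ⊓ (U j ⊓ U₀) ≤ U i ⊓ U j ⊓ U₀ := fun x hx =>
        ⟨⟨hx.1.1, hx.2.1⟩, hx.1.2⟩
      have := congr(resM N hinf $(he i j))
      rwa [resM_resM, resM_resM] at this
    have hsup : iSup U ⊓ U₀ ≤ iSup fun i => U i ⊓ U₀ := by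
      rintro x ⟨hx, h₀⟩
      obtain ⟨i, hi⟩ := Opens.mem_iSup.1 hx
      exact Opens.mem_iSup.2 ⟨i, hi, h₀⟩
    refine ⟨resM N hsup s, fun i => ?_⟩
    change resM N _ (resM N hsup s) = _
    rw [resM_resM]
    exact hs i

/-! ### The universal property of a pullback, and its bases -/

section Adjoint

variable {N : X.Modules} {M : Y.Modules} {j : M ⟶ (Scheme.Modules.pushforward φ).obj N}

/-- When the adjoint of `j` is an isomorphism, `N` has the universal property of `φ^* M`: morphisms
out of `N` correspond to morphisms from `M` to a pushforward. -/
theorem hom_ext_of_isIso_adjoint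
    (h : IsIso (((Scheme.Modules.pullbackPushforwardAdjunction φ).homEquiv _ _).symm j))
    {N' : X.Modules} {g g' : N ⟶ N'}
    (hg : ∀ (V : Y.Opens) (m : Γ(M, V)),
      g.app _ (onSections j V m) = g'.app _ (onSections j V m)) : g = g' := by
  let adj := Scheme.Modules.pullbackPushforwardAdjunction φ
  have h1 : j ≫ (Scheme.Modules.pushforward φ).map g =
      j ≫ (Scheme.Modules.pushforward φ).map g' := by
    ext V m
    exact hg V m
  rw [← cancel_epi ((adj.homEquiv _ _).symm j), ← adj.homEquiv_naturality_right_symm,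
    ← adj.homEquiv_naturality_right_symm, h1]

theorem exists_hom_of_isIso_adjoint
    (h : IsIso (((Scheme.Modules.pullbackPushforwardAdjunction φ).homEquiv _ _).symm j))
    {N' : X.Modules} (j' : M ⟶ (Scheme.Modules.pushforward φ).obj N') :
    ∃ g : N ⟶ N', ∀ (V : Y.Opens) (m : Γ(M, V)),
      g.app _ (onSections j V m) = onSections j' V m := by
  let adj := Scheme.Modules.pullbackPushforwardAdjunction φ
  refine ⟨inv ((adj.homEquiv _ _).symm j) ≫ (adj.homEquiv _ _).symm j', fun V m => ?_⟩
  have h1 : j ≫ (Scheme.Modules.pushforward φ).map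
      (inv ((adj.homEquiv _ _).symm j) ≫ (adj.homEquiv _ _).symm j') = j' := by
    apply (adj.homEquiv _ _).symm.injective
    rw [adj.homEquiv_naturality_right_symm, IsIso.hom_inv_id_assoc]
  exact congr(onSections $h1 V m)

set_option maxHeartbeats 1000000 in
/-- If `N` is the pullback of `M`, a basis of `φ_* 𝒪_X` is also one of `φ_* N` over `M`. -/
theorem LocalBasis.modBasis_of_isIso_adjoint (hφ : IsHomeomorph φ)
    (h : IsIso (((Scheme.Modules.pullbackPushforwardAdjunction φ).homEquiv _ _).symm j))
    {V₀ : Y.Opens} {I : Type} [Fintype I] {b : I → Γ(X, φ ⁻¹ᵁ V₀)} (hb : LocalBasis φ V₀ b) :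
    ModBasis φ j V₀ b := by
  classical
  -- `N` is compared with the coordinate model `D'` of the tensor product. The universal property
  -- gives `u : N ⟶ D'`, induced by `m ↦ 1 ⊗ m`; the basis gives `v` from `D'` to `D''`, the part of
  -- `N` over the chart; and `u ≫ v` is the restriction `r`. Since `1` need not belong to `b`, the
  -- coordinates of `1 ⊗ m` are the coefficients of `1` times `m`.
  let D' := hb.tensorData hφ M
  let D'' := cutData N (φ ⁻¹ᵁ V₀)
  let im : X.Opens → Y.Opens := fun W => imageOpen hφ W ⊓ V₀
  have hle : ∀ W, im W ≤ V₀ := fun W => inf_le_right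
  have him : ∀ W, φ ⁻¹ᵁ im W ≤ W := fun W =>
    (preimage_le inf_le_left).trans (preimage_imageOpen hφ W).le
  have hmono : ∀ {W W' : X.Opens}, W' ≤ W → im W' ≤ im W := fun h =>
    inf_le_inf_right _ (imageOpen_mono hφ h)
  have himV : ∀ V : Y.Opens, im (φ ⁻¹ᵁ V) ≤ V := fun V =>
    inf_le_left.trans (imageOpen_preimage hφ V).le
  have hcut : ∀ W : X.Opens, W ⊓ φ ⁻¹ᵁ V₀ ≤ φ ⁻¹ᵁ im W := fun W x hx => ⟨⟨x, hx.1, rfl⟩, hx.2⟩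
  have hact : ∀ W (a : Γ(X, W)) (n : D'.obj W) k, (a • n) k =
      ∑ i, hb.coef (hle W) (resO (him W) a * resO (preimage_le (hle W)) (b i)) k •
        (n i : Γ(M, im W)) := fun W a n k => rfl
  -- the canonical map from `M`
  obtain ⟨j', hj'⟩ : ∃ j' : M ⟶ (Scheme.Modules.pushforward φ).obj D'.toModules,
      ∀ (V : Y.Opens) (m : Γ(M, V)), onSections j' V m = D'.toSection
        (fun k => hb.coef (hle (φ ⁻¹ᵁ V)) 1 k • resM M (himV V) m) := by
    refine exists_hom_of_sections (N := M) (N' := (Scheme.Modules.pushforward φ).obj D'.toModules)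
      (fun V => AddMonoidHom.mk' (fun m => D'.toSection
        (fun k => hb.coef (hle (φ ⁻¹ᵁ V)) 1 k • resM M (himV V) m)) fun m m' => ?_) ?_ ?_
    · refine congrArg D'.toSection (funext fun k => ?_)
      change hb.coef (hle (φ ⁻¹ᵁ V)) 1 k • resM M (himV V) (m + m') =
        hb.coef (hle (φ ⁻¹ᵁ V)) 1 k • resM M (himV V) m +
          hb.coef (hle (φ ⁻¹ᵁ V)) 1 k • resM M (himV V) m'
      rw [map_add, smul_add]
    · intro V V' h' m
      refine (D'.resM_toSection (preimage_le h') _).trans (congrArg D'.toSection (funext fun k => ?_))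
      change resM M (hmono (preimage_le h')) (hb.coef (hle (φ ⁻¹ᵁ V)) 1 k • resM M (himV V) m) =
        hb.coef (hle (φ ⁻¹ᵁ V')) 1 k • resM M (himV V') (resM M h' m)
      rw [resM_smul, resM_resM, resM_resM, hb.resO_coef, map_one]
    · intro V c m
      refine Eq.trans ?_ (D'.smul_toSection (((φ.app V).hom c)) _).symm
      refine congrArg D'.toSection (funext fun k => ?_)
      refine Eq.trans ?_ (hact (φ ⁻¹ᵁ V) ((φ.app V).hom c) _ k).symm
      have e1 : ∀ i, hb.coef (hle (φ ⁻¹ᵁ V)) (resO (him _) ((φ.app V).hom c) *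
          resO (preimage_le (hle (φ ⁻¹ᵁ V))) (b i)) k =
          (Pi.single i 1 : I → Γ(Y, im (φ ⁻¹ᵁ V))) k * resO (himV V) c := fun i => by
        rw [mul_comm, resO_app φ (himV V), hb.coef_mul, hb.coef_basis]
      rw [Finset.sum_eq_single k]
      · rw [e1, Pi.single_eq_same, one_mul, resM_smul, smul_comm]
      · intro i _ hi
        rw [e1, Pi.single_eq_of_ne hi.symm, zero_mul, zero_smul]
      · simp
  obtain ⟨u, hu⟩ := exists_hom_of_isIso_adjoint h j'
  -- the map given by the basis
  let comb : ∀ W : X.Opens, (I → Γ(M, im W)) → Γ(N, φ ⁻¹ᵁ im W) := fun W n =>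
    ∑ i, resO (preimage_le (hle W)) (b i) • onSections j (im W) (n i)
  obtain ⟨v, hv⟩ : ∃ v : D'.toModules ⟶ D''.toModules, ∀ W (n : D'.obj W),
      v.app W (D'.toSection n) = D''.toSection (resM N (hcut W) (comb W n)) := by
    refine exists_hom_of_sections (N := D'.toModules) (N' := D''.toModules)
      (fun W => AddMonoidHom.mk' (fun n => D''.toSection
        (resM N (hcut W) (comb W (D'.toSection.symm n)))) fun n n' => ?_) ?_ ?_
    · change resM N (hcut W) (∑ i, resO (preimage_le (hle W)) (b i) •
        onSections j (im W) ((D'.toSection.symm n i : Γ(M, im W)) + D'.toSection.symm n' i)) = _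
      simp only [map_add, smul_add, Finset.sum_add_distrib]
      rfl
    · intro W W' h' n
      change resM N (inf_le_inf_right _ h') (resM N (hcut W) (comb W n)) =
        resM N (hcut W') (∑ i, resO (preimage_le (hle W')) (b i) •
          onSections j (im W') (resM M (hmono h') (n i)))
      have e1 : (∑ i, resO (preimage_le (hle W')) (b i) •
          onSections j (im W') (resM M (hmono h') (n i))) =
          resM N (preimage_le (hmono h')) (comb W n) := by
        simp only [comb, map_sum, resM_smul, resO_resO, resM_onSections j (hmono h')]
      rw [e1, resM_resM, resM_resM]
    · intro W a n
      change resM N (hcut W) (∑ k, resO (preimage_le (hle W)) (b k) •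
        onSections j (im W) (∑ i, hb.coef (hle W) (resO (him W) a *
          resO (preimage_le (hle W)) (b i)) k • (n i : Γ(M, im W)))) =
        resO (inf_le_left : W ⊓ φ ⁻¹ᵁ V₀ ≤ W) a • resM N (hcut W) (comb W n)
      have e1 : (∑ k, resO (preimage_le (hle W)) (b k) •
          onSections j (im W) (∑ i, hb.coef (hle W) (resO (him W) a *
            resO (preimage_le (hle W)) (b i)) k • (n i : Γ(M, im W)))) =
          resO (him W) a • comb W n := by
        simp only [comb, map_sum, onSections_smul, Finset.smul_sum, smul_smul]
        rw [Finset.sum_comm]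
        refine Finset.sum_congr rfl fun i _ => ?_
        rw [← Finset.sum_smul, hb.sum_coef]
      rw [e1, resM_smul, resO_resO]
  obtain ⟨r, hr⟩ : ∃ r : N ⟶ D''.toModules, ∀ W (e : Γ(N, W)),
      r.app W e = D''.toSection (resM N (inf_le_left : W ⊓ φ ⁻¹ᵁ V₀ ≤ W) e) :=
    exists_hom_of_sections (N := N) (N' := D''.toModules)
      (fun W => D''.toSection.toAddMonoidHom.comp (resM N (inf_le_left : W ⊓ φ ⁻¹ᵁ V₀ ≤ W))) (fun V W h' e => (resM_resM _ _ _ _).trans (resM_resM _ _ _ _).symm)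
      fun W a e => resM_smul _ _ _ _
  have huv : u ≫ v = r := by
    refine hom_ext_of_isIso_adjoint h fun V m => ?_
    change v.app _ (u.app _ (onSections j V m)) = _
    refine (congrArg _ ((hu V m).trans (hj' V m))).trans
      ((hv _ _).trans (Eq.trans ?_ (hr _ _).symm))
    refine congrArg D''.toSection ?_
    have e1 : comb (φ ⁻¹ᵁ V) (fun k => hb.coef (hle (φ ⁻¹ᵁ V)) 1 k • resM M (himV V) m) =
        resM N (preimage_le (himV V)) (onSections j V m) := by
      simp only [comb, onSections_smul, smul_smul]
      rw [← Finset.sum_smul, hb.sum_coef, one_smul, resM_onSections j (himV V)]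
    rw [e1, resM_resM]
  intro V hV
  have hVim : V ≤ im (φ ⁻¹ᵁ V) := le_inf (imageOpen_preimage hφ V).ge hV
  constructor
  · intro m m' hmm
    -- The map `u` recovers the coordinates of a combination, which proves injectivity. Surjectivity
    -- comes from `u ≫ v = r`: the coordinates of `u e` give a combination equal to `e`.
    have key : ∀ m : I → Γ(M, V), u.app _ (∑ i, resO (preimage_le hV) (b i) • onSections j V (m i)) =
        D'.toSection (fun k => resM M (himV V) (m k)) := by
      intro m
      have e1 : ∀ i, u.app _ (resO (preimage_le hV) (b i) • onSections j V (m i)) =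
          D'.toSection (Pi.single i (resM M (himV V) (m i))) := by
        intro i
        rw [Scheme.Modules.Hom.app_smul]
        refine (congrArg _ ((hu V _).trans (hj' V _))).trans ((D'.smul_toSection _ _).trans ?_)
        refine congrArg D'.toSection (funext fun k => ?_)
        refine (hact _ _ _ k).trans ?_
        simp only [smul_smul]
        rw [← Finset.sum_smul, ← hb.coef_mul_mul, mul_one, resO_resO, hb.coef_basis]
        by_cases hk : k = i
        · subst hk
          rw [Pi.single_eq_same, Pi.single_eq_same, one_smul]
        · rw [Pi.single_eq_of_ne hk, Pi.single_eq_of_ne hk, zero_smul]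
      rw [map_sum, Finset.sum_congr rfl fun i _ => e1 i]
      refine (map_sum D'.toSection (fun i => (Pi.single i (resM M (himV V) (m i)) :
        I → Γ(M, im (φ ⁻¹ᵁ V)))) Finset.univ).symm.trans ?_
      exact congrArg D'.toSection (Finset.univ_sum_single _)
    have h1 := D'.toSection.injective ((key m).symm.trans (congr(u.app _ $hmm).trans (key m')))
    funext k
    have h2 := congr(resM M hVim $(congr_fun h1 k))
    rwa [resM_resM, resM_resM, resM_self, resM_self] at h2
  · intro e
    obtain ⟨n, hn⟩ := D'.toSection.surjective (u.app _ e)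
    have h1 : v.app _ (u.app _ e) = r.app _ e := congr(Scheme.Modules.Hom.app $huv _ e)
    rw [← hn, hv, hr] at h1
    have h2 := D''.toSection.injective h1
    refine ⟨fun k => resM M hVim (n k), ?_⟩
    have h3 := congr(resM N (le_inf le_rfl (preimage_le hV)) $h2)
    rw [resM_resM, resM_resM, resM_self] at h3
    rw [← h3]
    simp only [comb, map_sum, resM_smul, resO_resO, resM_onSections j hVim]

end Adjoint

end BasisOfAdjoint

end KatzGieseker

end



noncomputable section

namespace KatzGieseker

/-! ### Operators of small order and powers of functions -/

section SmallOrder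

variable {X S Y : Scheme.{u}}

/-- Compatibility with restriction. -/
def OpFamily.IsNatural {U : X.Opens} (D : OpFamily X U) : Prop :=
  ∀ (V W : {V : X.Opens // V ≤ U}) (h : W.1 ≤ V.1) (a : Γ(X, V.1)),
    resO h (D V a) = D W (resO h a)

theorem commutator_mul {R : Type*} [Ring R] (d a b : R) :
    d * (a * b) - a * b * d = (d * a - a * d) * b + a * (d * b - b * d) := by
  noncomm_ring

theorem commutator_add {R : Type*} [Ring R] (d a b : R) :
    d * (a + b) - (a + b) * d = (d * a - a * d) + (d * b - b * d) := by
  noncomm_ring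

theorem commutator_neg {R : Type*} [Ring R] (d a : R) :
    d * -a - -a * d = -(d * a - a * d) := by
  noncomm_ring

/-- Let `L` and `M` be left and right multiplication by `a`. They commute, so `M^{p^i} = L^{p^i} +
(M - L)^{p^i}` modulo `p`, and `M - L` is the commutator with `a`. -/
theorem mul_pow_prime_pow_eq {R : Type*} [Ring R] {p : ℕ} (hp : p.Prime)
    (h0 : ∀ d : R, p • d = 0) (a d : R) (i : ℕ) :
    d * a ^ p ^ i = a ^ p ^ i * d + (fun d => d * a - a * d)^[p ^ i] d := by
  let L : Module.End ℤ R := LinearMap.mulLeft ℤ a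
  let M : Module.End ℤ R := LinearMap.mulRight ℤ a
  have hLM : Commute L M := LinearMap.commute_mulLeft_right (R := ℤ) a a
  have hc : Commute L (M - L) := hLM.sub_right (Commute.refl L)
  obtain ⟨r, hr⟩ := hc.exists_add_pow_prime_pow_eq hp i
  have h1 := congr($hr d)
  rw [add_sub_cancel, LinearMap.add_apply, LinearMap.add_apply,
    LinearMap.pow_mulLeft, LinearMap.pow_mulRight, LinearMap.mulLeft_apply,
    LinearMap.mulRight_apply, Module.End.pow_apply] at h1
  rw [h1, mul_assoc, mul_assoc, ← nsmul_eq_mul]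
  exact (congrArg _ (h0 _)).trans (add_zero _)

theorem iterate_commutator_eq_zero_of_le {R : Type*} [Ring R] {a d : R} {m n : ℕ} (hmn : m ≤ n)
    (h : (fun d => d * a - a * d)^[m] d = 0) : (fun d => d * a - a * d)^[n] d = 0 := by
  obtain ⟨l, rfl⟩ := Nat.exists_eq_add_of_le' hmn
  rw [Function.iterate_add_apply, h]
  exact Function.iterate_fixed (by simp) l

theorem IsOrderLE.iterate_commutator {V : X.Opens} (a : Γ(X, V)) :
    ∀ {m : ℕ} {D : OpFamily X V}, IsOrderLE m V D →
      (fun D => D * scalarOp a - scalarOp a * D)^[m + 1] D = 0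
  | 0, _, ⟨b, hb⟩ => by
    rw [hb]
    exact scalarOp_comm b a
  | m + 1, D, hD => by
    rw [Function.iterate_succ_apply]
    exact iterate_commutator a (hD V le_rfl a)

theorem nsmul_opFamily_eq_zero {p : ℕ} (h0 : ∀ V : X.Opens, (p : Γ(X, V)) = 0) {V : X.Opens}
    (D : OpFamily X V) : p • D = 0 := by
  funext W
  ext b
  change p • (D W b) = 0
  rw [nsmul_eq_mul, h0, zero_mul]

theorem scalarOp_pow {V : X.Opens} (a : Γ(X, V)) (n : ℕ) : scalarOp (a ^ n) = scalarOp a ^ n := by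
  induction n with
  | zero => rw [pow_zero, pow_zero, scalarOp_one]
  | succ n ih => rw [pow_succ, pow_succ, scalarOp_mul, ih]

/-- An operator of order `m` is annihilated by `m + 1 ≤ p^i` successive commutators with `a`, and
the `p^i`-fold one is the commutator with `a^{p^i}`. -/
theorem IsOrderLE.commute_pow {p : ℕ} (hp : p.Prime) (h0 : ∀ V : X.Opens, (p : Γ(X, V)) = 0)
    {m i : ℕ} (hm : m < p ^ i) {V : X.Opens} {D : OpFamily X V} (hD : IsOrderLE m V D)
    (a : Γ(X, V)) : Commute D (scalarOp (a ^ p ^ i)) := by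
  rw [scalarOp_pow]
  refine (mul_pow_prime_pow_eq hp (nsmul_opFamily_eq_zero h0) _ _ i).trans ?_
  rw [iterate_commutator_eq_zero_of_le hm (hD.iterate_commutator a), add_zero]

variable {k : Type u} [Field k] (p : ℕ) [hp : Fact p.Prime] [CharP k p]
  (s : S ⟶ Spec (.of k)) (f : X ⟶ S)

theorem apply_mul_of_mem_frobSubring (s : S ⟶ Spec (.of k)) {m i : ℕ} (hm : m < p ^ i) {V : X.Opens} {D : OpFamily X V}
    (hD : D ∈ endSections f V) (hm' : IsOrderLE m V D) {W : X.Opens} (hW : W ≤ V) {a : Γ(X, W)}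
    (ha : a ∈ frobSubring p f i W) (b : Γ(X, W)) : D ⟨W, hW⟩ (a * b) = a * D ⟨W, hW⟩ b := by
  induction ha using Subring.closure_induction generalizing b with
  | mem a ha =>
    obtain (⟨T, h, t, rfl⟩ | ⟨a, rfl⟩) := ha
    · exact hD.2 ⟨W, hW⟩ T h t b
    · have h1 := (hm'.res hW).commute_pow hp.out (natCast_eq_zero_of_over p (f ≫ s)) hm a
      have h2 := congr($h1.eq ⟨W, le_rfl⟩ b)
      change D ⟨W, hW⟩ (resO le_rfl (a ^ p ^ i) * b) = resO le_rfl (a ^ p ^ i) * D ⟨W, hW⟩ b at h2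
      rwa [resO_self] at h2
  | zero => rw [zero_mul, map_zero, zero_mul]
  | one => rw [one_mul, one_mul]
  | add a a' _ _ h h' => rw [add_mul, map_add, h, h', add_mul]
  | mul a a' _ _ h h' => rw [mul_assoc, h, h', mul_assoc]
  | neg a _ h => rw [neg_mul, map_neg, h, neg_mul]

/-- Operators of order less than `p ^ i` are linear over the functions on `X^{(i)}`. -/
theorem apply_frobIter_mul [Smooth f] {m i : ℕ} (hm : m < p ^ i) {U : X.Opens} {D : OpFamily X U}
    (hD : D ∈ endSections f U) (hm' : IsOrderLE m U D) {V : (twist p s f i).Opens}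
    (hV : frobIter p s f i ⁻¹ᵁ V ≤ U) (c : Γ(twist p s f i, V)) (b : Γ(X, frobIter p s f i ⁻¹ᵁ V)) :
    D ⟨_, hV⟩ (((frobIter p s f i).app V).hom c * b) =
      ((frobIter p s f i).app V).hom c * D ⟨_, hV⟩ b := by
  refine sectionO_ext _ _ fun x hx => ?_
  obtain ⟨W, hW, hxW, hm''⟩ := exists_mem_frobSubring p s f i V c x hx
  refine ⟨W, hW, hxW, ?_⟩
  rw [hD.1 ⟨_, hV⟩ ⟨W, hW.trans hV⟩ hW, map_mul (resO hW), map_mul (resO hW),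
    hD.1 ⟨_, hV⟩ ⟨W, hW.trans hV⟩ hW]
  exact apply_mul_of_mem_frobSubring p f s hm hD hm' _ hm'' _

end SmallOrder

/-! ### Operators on a chart -/

section ChartOps

variable {X S Y : Scheme.{u}} {φ : X ⟶ Y}

/-- An operator on `X` from additive maps indexed by the open subsets of a homeomorphic scheme. -/
def extendOp (hφ : IsHomeomorph φ) {V₀ : Y.Opens}
    (T : ∀ V : Y.Opens, V ≤ V₀ → AddMonoid.End Γ(X, φ ⁻¹ᵁ V)) : OpFamily X (φ ⁻¹ᵁ V₀) := fun W =>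
  have h : imageOpen hφ W.1 ≤ V₀ := (imageOpen_mono hφ W.2).trans (imageOpen_preimage hφ V₀).le
  ((resO (preimage_imageOpen hφ W.1).ge).toAddMonoidHom.comp (T (imageOpen hφ W.1) h)).comp
    (resO (preimage_imageOpen hφ W.1).le).toAddMonoidHom

theorem extendOp_apply (hφ : IsHomeomorph φ) {V₀ : Y.Opens}
    {T : ∀ V : Y.Opens, V ≤ V₀ → AddMonoid.End Γ(X, φ ⁻¹ᵁ V)}
    (hT : ∀ (V V' : Y.Opens) (h : V ≤ V₀) (h' : V' ≤ V) (a : Γ(X, φ ⁻¹ᵁ V)),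
      resO (preimage_le h') (T V h a) = T V' (h'.trans h) (resO (preimage_le h') a))
    {V : Y.Opens} (h : V ≤ V₀) (h' : φ ⁻¹ᵁ V ≤ φ ⁻¹ᵁ V₀) (a : Γ(X, φ ⁻¹ᵁ V)) :
    extendOp hφ T ⟨φ ⁻¹ᵁ V, h'⟩ a = T V h a := by
  have e := imageOpen_preimage hφ V
  change resO _ (T (imageOpen hφ (φ ⁻¹ᵁ V)) _ (resO _ a)) = _
  rw [hT _ V (e.le.trans h) e.ge, resO_resO, resO_self]

theorem OpFamily.natural_of_preimage (hφ : IsHomeomorph φ) {V₀ : Y.Opens}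
    {D : OpFamily X (φ ⁻¹ᵁ V₀)}
    (hD : ∀ (V V' : Y.Opens) (h : V ≤ V₀) (h' : V' ≤ V) (a : Γ(X, φ ⁻¹ᵁ V)),
      resO (preimage_le h') (D ⟨φ ⁻¹ᵁ V, preimage_le h⟩ a) =
        D ⟨φ ⁻¹ᵁ V', preimage_le (h'.trans h)⟩ (resO (preimage_le h') a)) : D.IsNatural := by
  rintro ⟨V, hV⟩ ⟨W, hW⟩ h a
  obtain ⟨V, rfl⟩ := exists_preimage_eq hφ V
  obtain ⟨W, rfl⟩ := exists_preimage_eq hφ W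
  exact hD V W (le_of_preimage_le hφ hV) (le_of_preimage_le hφ h) a

theorem extendOp_natural (hφ : IsHomeomorph φ) {V₀ : Y.Opens}
    {T : ∀ V : Y.Opens, V ≤ V₀ → AddMonoid.End Γ(X, φ ⁻¹ᵁ V)}
    (hT : ∀ (V V' : Y.Opens) (h : V ≤ V₀) (h' : V' ≤ V) (a : Γ(X, φ ⁻¹ᵁ V)),
      resO (preimage_le h') (T V h a) = T V' (h'.trans h) (resO (preimage_le h') a)) :
    (extendOp hφ T).IsNatural := by
  refine OpFamily.natural_of_preimage hφ fun V V' h h' a => ?_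
  rw [extendOp_apply hφ hT h, extendOp_apply hφ hT (h'.trans h), hT V V' h h']

namespace LocalBasis

variable {V₀ : Y.Opens} {I : Type} [Fintype I] {b : I → Γ(X, φ ⁻¹ᵁ V₀)} (hb : LocalBasis φ V₀ b)
include hb

theorem op_ext (hφ : IsHomeomorph φ) {D D' : OpFamily X (φ ⁻¹ᵁ V₀)} 
    (h : ∀ (V : Y.Opens) (h : V ≤ V₀) (i : I) (c : Γ(Y, V)),
      D ⟨φ ⁻¹ᵁ V, preimage_le h⟩ (resO (preimage_le h) (b i) * (φ.app V).hom c) =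
        D' ⟨φ ⁻¹ᵁ V, preimage_le h⟩ (resO (preimage_le h) (b i) * (φ.app V).hom c)) : D = D' := by
  funext ⟨W, hW⟩
  ext a
  obtain ⟨V, rfl⟩ := exists_preimage_eq hφ W
  rw [← hb.sum_coef (le_of_preimage_le hφ hW) a, map_sum, map_sum]
  exact Finset.sum_congr rfl fun i _ => h V (le_of_preimage_le hφ hW) i _

/-- The operator `∑ bᵢ φ(cᵢ) ↦ ∑ tᵢ φ(δ cᵢ)`. -/
def op (hφ : IsHomeomorph φ) (δ : OpFamily Y V₀) (t : I → Γ(X, φ ⁻¹ᵁ V₀)) :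
    OpFamily X (φ ⁻¹ᵁ V₀) :=
  extendOp hφ fun V h => AddMonoidHom.mk'
    (fun a => ∑ i, resO (preimage_le h) (t i) * (φ.app V).hom (δ ⟨V, h⟩ (hb.coef h a i)))
    fun a a' => by simp only [map_add, Pi.add_apply, mul_add, Finset.sum_add_distrib]

variable (hφ : IsHomeomorph φ) {δ : OpFamily Y V₀} (hδ : δ.IsNatural) (t : I → Γ(X, φ ⁻¹ᵁ V₀))
include hδ

theorem op_aux (V V' : Y.Opens) (h : V ≤ V₀) (h' : V' ≤ V) (a : Γ(X, φ ⁻¹ᵁ V)) :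
    resO (preimage_le h') (∑ i, resO (preimage_le h) (t i) *
      (φ.app V).hom (δ ⟨V, h⟩ (hb.coef h a i))) =
    ∑ i, resO (preimage_le (h'.trans h)) (t i) * (φ.app V').hom
      (δ ⟨V', h'.trans h⟩ (hb.coef (h'.trans h) (resO (preimage_le h') a) i)) := by
  rw [map_sum]
  refine Finset.sum_congr rfl fun i _ => ?_
  rw [map_mul, resO_resO, resO_app φ h', hδ ⟨V, h⟩ ⟨V', h'.trans h⟩ h', hb.resO_coef h h']

theorem op_natural : (hb.op hφ δ t).IsNatural :=
  extendOp_natural hφ (hb.op_aux hδ t)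

theorem op_apply {V : Y.Opens} (h : V ≤ V₀) (i : I) (c : Γ(Y, V)) :
    hb.op hφ δ t ⟨φ ⁻¹ᵁ V, preimage_le h⟩ (resO (preimage_le h) (b i) * (φ.app V).hom c) =
      resO (preimage_le h) (t i) * (φ.app V).hom (δ ⟨V, h⟩ c) := by
  classical
  refine (extendOp_apply hφ (hb.op_aux hδ t) h _ _).trans ?_
  change ∑ l, resO (preimage_le h) (t l) * (φ.app V).hom (δ ⟨V, h⟩
    (hb.coef h (resO (preimage_le h) (b i) * (φ.app V).hom c) l)) = _
  rw [Finset.sum_eq_single i]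
  · rw [hb.coef_mul, hb.coef_basis, Pi.single_eq_same, one_mul]
  · intro l _ hl
    rw [hb.coef_mul, hb.coef_basis, Pi.single_eq_of_ne hl, zero_mul, map_zero, map_zero, mul_zero]
  · simp

end LocalBasis

end ChartOps

end KatzGieseker

end



noncomputable section

namespace KatzGieseker

/-! ### Monomial bases -/

section Mono

variable {R : Type*} [CommRing R] {q d : ℕ}

/-- Monomials with exponents less than `q`. -/
def mono (x : Fin d → R) (α : Fin d → Fin q) : R := ∏ j, x j ^ (α j : ℕ)

theorem mono_update (x : Fin d → R) (α : Fin d → Fin q) (k : Fin d) (r : Fin q) :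
    mono x (Function.update α k r) = x k ^ (r : ℕ) * ∏ j ∈ Finset.univ.erase k, x j ^ (α j : ℕ) := by
  rw [mono, ← Finset.mul_prod_erase _ _ (Finset.mem_univ k), Function.update_self]
  congr 1
  refine Finset.prod_congr rfl fun j hj => ?_
  rw [Function.update_of_ne (Finset.ne_of_mem_erase hj)]

theorem mul_mono_of_lt (x : Fin d → R) (α : Fin d → Fin q) (k : Fin d) (h : (α k : ℕ) + 1 < q) :
    x k * mono x α = mono x (Function.update α k ⟨α k + 1, h⟩) := by
  conv_lhs => rw [← Function.update_eq_self k α]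
  rw [mono_update, mono_update, ← mul_assoc, ← pow_succ']

theorem mul_mono_of_eq [NeZero q] (x : Fin d → R) (α : Fin d → Fin q) (k : Fin d)
    (h : (α k : ℕ) + 1 = q) :
    x k * mono x α = mono x (Function.update α k 0) * x k ^ q := by
  conv_lhs => rw [← Function.update_eq_self k α]
  rw [mono_update, mono_update, ← mul_assoc, ← pow_succ', h, Fin.val_zero, pow_zero, one_mul,
    mul_comm]

theorem mono_zero [NeZero q] (x : Fin d → R) : mono x (0 : Fin d → Fin q) = 1 :=
  Finset.prod_eq_one fun j _ => by rw [Pi.zero_apply, Fin.val_zero, pow_zero]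

theorem map_mono {R' : Type*} [CommRing R'] (ρ : R →+* R') (x : Fin d → R) (α : Fin d → Fin q) :
    ρ (mono x α) = mono (fun j => ρ (x j)) α := by
  simp only [mono, map_prod, map_pow]

end Mono

section MonoBasis

variable {X S Y : Scheme.{u}}

/-- The monomials in `x` with exponents less than `q` form a basis of `φ_* 𝒪_X` over `V₀`, and the
`q`-th powers of the `x j` come from the functions `z j` on `Y`. -/
structure MonoBasis (φ : X ⟶ Y) (V₀ : Y.Opens) (q : ℕ) {d : ℕ} (x : Fin d → Γ(X, φ ⁻¹ᵁ V₀))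
    (z : Fin d → Γ(Y, V₀)) : Prop where
  homeo : IsHomeomorph φ
  basis : LocalBasis φ V₀ (mono (q := q) x)
  app_eq j : (φ.app V₀).hom (z j) = x j ^ q

variable {φ : X ⟶ Y} {V₀ : Y.Opens} {q d : ℕ} {x : Fin d → Γ(X, φ ⁻¹ᵁ V₀)} {z : Fin d → Γ(Y, V₀)}

theorem LocalBasis.restrict {I : Type} [Fintype I] {b : I → Γ(X, φ ⁻¹ᵁ V₀)}
    (hb : LocalBasis φ V₀ b) {V : Y.Opens} (h : V ≤ V₀) :
    LocalBasis φ V fun i => resO (preimage_le h) (b i) := by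
  intro W hW
  simpa only [resO_resO] using hb W (hW.trans h)

theorem MonoBasis.restrict (hb : MonoBasis φ V₀ q x z) {V : Y.Opens} (h : V ≤ V₀) :
    MonoBasis φ V q (fun j => resO (preimage_le h) (x j)) (fun j => resO h (z j)) where
  homeo := hb.homeo
  basis := by
    have := hb.basis.restrict h
    simpa only [map_mono] using this
  app_eq j := by rw [← resO_app φ h (preimage_le h), hb.app_eq, map_pow]

theorem mem_endSections_of_preimage (hφ : IsHomeomorph φ) {D : OpFamily X (φ ⁻¹ᵁ V₀)}
    (hD : D.IsNatural)
    (h : ∀ (V : Y.Opens) (h : V ≤ V₀) (c : Γ(Y, V)) (a : Γ(X, φ ⁻¹ᵁ V)),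
      D ⟨φ ⁻¹ᵁ V, preimage_le h⟩ ((φ.app V).hom c * a) =
        (φ.app V).hom c * D ⟨φ ⁻¹ᵁ V, preimage_le h⟩ a) : D ∈ endSections φ (φ ⁻¹ᵁ V₀) := by
  refine ⟨hD, ?_⟩
  rintro ⟨W, hW⟩ T hT c a
  obtain ⟨V, rfl⟩ := exists_preimage_eq hφ W
  have hVT : V ≤ T := le_of_preimage_le hφ hT
  have e : (φ.appLE T (φ ⁻¹ᵁ V) hT).hom c = (φ.app V).hom (resO hVT c) :=
    resO_app φ hVT hT c
  have := h V (le_of_preimage_le hφ hW) (resO hVT c) a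
  rw [← e] at this
  exact this

theorem apply_app_mul {U : X.Opens} {D : OpFamily X U} (hD : D ∈ endSections φ U) {V : Y.Opens}
    (h : φ ⁻¹ᵁ V ≤ U) (c : Γ(Y, V)) (a : Γ(X, φ ⁻¹ᵁ V)) :
    D ⟨φ ⁻¹ᵁ V, h⟩ ((φ.app V).hom c * a) = (φ.app V).hom c * D ⟨φ ⁻¹ᵁ V, h⟩ a := by
  have := hD.2 ⟨φ ⁻¹ᵁ V, h⟩ V le_rfl c a
  rwa [Scheme.Hom.appLE_eq_app] at this

theorem commute_scalarOp_app {V : Y.Opens} {D : OpFamily X (φ ⁻¹ᵁ V)}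
    (hD : D ∈ endSections φ (φ ⁻¹ᵁ V)) (c : Γ(Y, V)) :
    Commute D (scalarOp ((φ.app V).hom c)) := by
  funext W
  ext a
  have := hD.2 W V W.2 c a
  exact this

theorem endSections_le_of_comp {g : Y ⟶ S} {f : X ⟶ S} (hfg : φ ≫ g = f) (U : X.Opens) :
    endSections φ U ≤ endSections f U := by
  subst hfg
  refine fun D hD => ⟨hD.1, fun V T h t a => ?_⟩
  have e := Scheme.Hom.appLE_comp_appLE φ g T (g ⁻¹ᵁ T) V.1 le_rfl h
  have := hD.2 V (g ⁻¹ᵁ T) h ((g.appLE T _ le_rfl).hom t) a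
  rw [← e]
  exact this

namespace MonoBasis

variable (hb : MonoBasis φ V₀ q x z)
include hb

theorem eq_top (K : Subring Γ(X, φ ⁻¹ᵁ V₀)) (hc : ∀ c, (φ.app V₀).hom c ∈ K) (hx : ∀ j, x j ∈ K) :
    K = ⊤ := by
  refine eq_top_iff.2 fun a _ => ?_
  rw [← hb.basis.sum_coef le_rfl a]
  refine sum_mem fun α _ => mul_mem ?_ (hc _)
  rw [resO_self]
  exact prod_mem fun j _ => pow_mem (hx j) _

/-- The functions whose commutator with `D` has order at most `m` form a subring, since `[D, ab] =
[D, a] b + a [D, b]` and multiplication by functions does not raise the order. Functions from `Y`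
and the coordinates generate all functions. -/
theorem isOrderLE_succ {D : OpFamily X (φ ⁻¹ᵁ V₀)} {m : ℕ}
    (hc : ∀ (V : Y.Opens) (h : V ≤ V₀) (c : Γ(Y, V)), IsOrderLE m (φ ⁻¹ᵁ V)
      (D.res (preimage_le h) * scalarOp ((φ.app V).hom c) -
        scalarOp ((φ.app V).hom c) * D.res (preimage_le h)))
    (hx : ∀ j, IsOrderLE m (φ ⁻¹ᵁ V₀) (D * scalarOp (x j) - scalarOp (x j) * D)) :
    IsOrderLE (m + 1) (φ ⁻¹ᵁ V₀) D := by
  intro W hW a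
  obtain ⟨V, rfl⟩ := exists_preimage_eq hb.homeo W
  have hV := le_of_preimage_le hb.homeo hW
  let K : Subring Γ(X, φ ⁻¹ᵁ V) :=
    { carrier := {a | IsOrderLE m (φ ⁻¹ᵁ V) (D.res hW * scalarOp a - scalarOp a * D.res hW)}
      mul_mem' := fun {a b} ha hb => by
        change IsOrderLE m (φ ⁻¹ᵁ V) (D.res hW * scalarOp (a * b) - scalarOp (a * b) * D.res hW)
        rw [scalarOp_mul, commutator_mul]
        exact (IsOrderLE.mul_aux m (add_zero m) ha ⟨b, rfl⟩).add
          (IsOrderLE.mul_aux m (zero_add m) ⟨a, rfl⟩ hb)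
      one_mem' := by
        change IsOrderLE m (φ ⁻¹ᵁ V) (D.res hW * scalarOp 1 - scalarOp 1 * D.res hW)
        rw [scalarOp_one, mul_one, one_mul, sub_self]
        exact IsOrderLE.zero _ _
      add_mem' := fun {a b} ha hb => by
        change IsOrderLE m (φ ⁻¹ᵁ V) (D.res hW * scalarOp (a + b) - scalarOp (a + b) * D.res hW)
        rw [scalarOp_add, commutator_add]
        exact ha.add hb
      zero_mem' := by
        change IsOrderLE m (φ ⁻¹ᵁ V) (D.res hW * scalarOp 0 - scalarOp 0 * D.res hW)
        rw [scalarOp_zero, mul_zero, zero_mul, sub_self]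
        exact IsOrderLE.zero _ _
      neg_mem' := fun {a} ha => by
        change IsOrderLE m (φ ⁻¹ᵁ V) (D.res hW * scalarOp (-a) - scalarOp (-a) * D.res hW)
        rw [scalarOp_neg, commutator_neg]
        exact ha.neg }
  have hK : K = ⊤ := (hb.restrict hV).eq_top K (hc V hV) fun j => by
    have := (hx j).res hW
    rw [map_sub, map_mul, map_mul, res_scalarOp] at this
    exact this
  exact (hK ▸ Subring.mem_top a : a ∈ K)

/-- The functions over which `D` is linear form a subring that contains the functions from `Y` and
the coordinates, hence every function. So `D` is multiplication by `D(1)`. -/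
theorem isOrderLE_zero {D : OpFamily X (φ ⁻¹ᵁ V₀)} (hD : D ∈ endSections φ (φ ⁻¹ᵁ V₀))
    (hx : ∀ j, Commute D (scalarOp (x j))) : IsOrderLE 0 (φ ⁻¹ᵁ V₀) D := by
  refine ⟨D ⟨_, le_rfl⟩ 1, ?_⟩
  funext ⟨W, hW⟩
  ext a
  obtain ⟨V, rfl⟩ := exists_preimage_eq hb.homeo W
  have hV := le_of_preimage_le hb.homeo hW
  let K : Subring Γ(X, φ ⁻¹ᵁ V) :=
    { carrier := {a | ∀ b, D ⟨_, hW⟩ (a * b) = a * D ⟨_, hW⟩ b}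
      mul_mem' := fun {a b} ha hb c => by rw [mul_assoc, ha, hb, mul_assoc]
      one_mem' := fun c => by rw [one_mul, one_mul]
      add_mem' := fun {a b} ha hb c => by rw [add_mul, map_add, ha, hb, add_mul]
      zero_mem' := fun c => by rw [zero_mul, map_zero, zero_mul]
      neg_mem' := fun {a} ha c => by rw [neg_mul, map_neg, ha, neg_mul] }
  have hK : K = ⊤ := (hb.restrict hV).eq_top K (fun c b => apply_app_mul hD hW c b)
    fun j b => congr($((hx j).eq) ⟨_, hW⟩ b)
  have h1 : a ∈ K := hK ▸ Subring.mem_top a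
  change D _ a = resO hW _ * a
  rw [hD.1 ⟨_, le_rfl⟩ ⟨_, hW⟩ hW, map_one, mul_comm, ← h1 1, mul_one]

/-- Only the commutator with `x_j` can be nonzero among those with generators. It is again linear
over `Y` and commutes with the other coordinates, which allows induction on the number of
commutators needed. -/
theorem isOrderLE_of_iterate (j : Fin d) : ∀ {m : ℕ} {D : OpFamily X (φ ⁻¹ᵁ V₀)},
    D ∈ endSections φ (φ ⁻¹ᵁ V₀) → (∀ k ≠ j, Commute D (scalarOp (x k))) →
    (fun D => D * scalarOp (x j) - scalarOp (x j) * D)^[m + 1] D = 0 → IsOrderLE m (φ ⁻¹ᵁ V₀) D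
  | 0, D, hD, hk, hj => by
    refine hb.isOrderLE_zero hD fun k => ?_
    by_cases h : k = j
    · subst h
      exact sub_eq_zero.1 hj
    · exact hk k h
  | m + 1, D, hD, hk, hj => by
    refine hb.isOrderLE_succ (fun V h c => ?_) fun k => ?_
    · rw [(commute_scalarOp_app (res_mem_endSections φ (preimage_le h) hD) c).eq, sub_self]
      exact IsOrderLE.zero _ _
    · by_cases h : k = j
      · subst h
        refine isOrderLE_of_iterate k (sub_mem (mul_mem hD (scalarOp_mem_endSections φ _))
          (mul_mem (scalarOp_mem_endSections φ _) hD)) (fun l hl => ?_) ?_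
        · have hkl : Commute (scalarOp (x k)) (scalarOp (x l)) := sub_eq_zero.1 (scalarOp_comm _ _)
          exact ((hk l hl).mul_left hkl).sub_left (hkl.mul_left (hk l hl))
        · rwa [Function.iterate_succ_apply] at hj
      · rw [(hk k h).eq, sub_self]
        exact IsOrderLE.zero _ _

/-- The `q`-fold commutator with `x_j` is the commutator with `x_j^q`, because `q` is a power of
`p`. It vanishes since `x_j^q` comes from `Y` and `D` is linear over `Y`. -/
theorem isOrderLE_of_commute {p i : ℕ} (hp : p.Prime) (h0 : ∀ V : X.Opens, (p : Γ(X, V)) = 0)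
    (hq : q = p ^ i) (j : Fin d) {D : OpFamily X (φ ⁻¹ᵁ V₀)}
    (hD : D ∈ endSections φ (φ ⁻¹ᵁ V₀)) (hk : ∀ k ≠ j, Commute D (scalarOp (x k))) :
    IsOrderLE (q - 1) (φ ⁻¹ᵁ V₀) D := by
  refine hb.isOrderLE_of_iterate j hD hk ?_
  have h1 := mul_pow_prime_pow_eq hp (nsmul_opFamily_eq_zero h0) (scalarOp (x j)) D i
  have h2 := commute_scalarOp_app hD (z j)
  rw [hb.app_eq, scalarOp_pow, hq] at h2
  rw [h2.eq] at h1
  have h3 : q - 1 + 1 = p ^ i := by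
    have := pow_pos hp.pos i
    omega
  rw [h3]
  exact left_eq_add.1 h1

end MonoBasis

end MonoBasis

end KatzGieseker

end



noncomputable section

namespace KatzGieseker

/-! ### Operators given by monomials -/

section MonoOps

/-- The predecessor, with `0 ↦ 0`. -/
def predFin {q : ℕ} (r : Fin q) : Fin q := ⟨r - 1, lt_of_le_of_lt (Nat.sub_le _ _) r.is_lt⟩

/-- The factor `α k` makes the truncated predecessor harmless: for exponent `0` both sides vanish.
-/
theorem natCast_mul_mono_pred {R : Type*} [CommRing R] {q d : ℕ} (x : Fin d → R)
    (α : Fin d → Fin q) (k : Fin d) :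
    ((α k : ℕ) : R) * (x k * mono x (Function.update α k (predFin (α k)))) =
      (α k : ℕ) * mono x α := by
  conv_rhs => rw [← Function.update_eq_self k α]
  rw [mono_update, mono_update]
  by_cases h : (α k : ℕ) = 0
  · rw [Function.update_self, h, Nat.cast_zero, zero_mul, zero_mul]
  · have : (α k : ℕ) = (predFin (α k) : ℕ) + 1 := (Nat.sub_add_cancel (Nat.pos_of_ne_zero h)).symm
    rw [← mul_assoc (x k), ← pow_succ', ← this, Function.update_self]

variable {X S Y : Scheme.{u}} {φ : X ⟶ Y} {V₀ : Y.Opens} {q d : ℕ}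
  {x : Fin d → Γ(X, φ ⁻¹ᵁ V₀)} {z : Fin d → Γ(Y, V₀)}

theorem one_isNatural : (1 : OpFamily Y V₀).IsNatural := fun _ _ _ _ => rfl

theorem LocalBasis.op_one_mem {I : Type} [Fintype I] {b : I → Γ(X, φ ⁻¹ᵁ V₀)}
    (hb : LocalBasis φ V₀ b) (hφ : IsHomeomorph φ) (t : I → Γ(X, φ ⁻¹ᵁ V₀)) :
    hb.op hφ 1 t ∈ endSections φ (φ ⁻¹ᵁ V₀) := by
  refine mem_endSections_of_preimage hφ (hb.op_natural hφ one_isNatural t) fun V h c a => ?_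
  rw [← hb.sum_coef h a, Finset.mul_sum, map_sum, map_sum, Finset.mul_sum]
  refine Finset.sum_congr rfl fun i _ => ?_
  rw [mul_left_comm, ← map_mul, hb.op_apply hφ one_isNatural t h,
    hb.op_apply hφ one_isNatural t h, mul_left_comm, ← map_mul]
  rfl

namespace MonoBasis

variable (hb : MonoBasis φ V₀ q x z)
include hb

/-- The effect of multiplication by a coordinate on monomials. -/
theorem op_mul_apply [NeZero q] {δ : OpFamily Y V₀} (hδ : δ.IsNatural) (t : (Fin d → Fin q) → Γ(X, φ ⁻¹ᵁ V₀))
    (k : Fin d) {V : Y.Opens} (h : V ≤ V₀) (β : Fin d → Fin q) (c : Γ(Y, V)) :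
    hb.basis.op hb.homeo δ t ⟨φ ⁻¹ᵁ V, preimage_le h⟩
      (resO (preimage_le h) (x k) * (resO (preimage_le h) (mono x β) * (φ.app V).hom c)) =
    if hk : (β k : ℕ) + 1 < q then
      resO (preimage_le h) (t (Function.update β k ⟨β k + 1, hk⟩)) * (φ.app V).hom (δ ⟨V, h⟩ c)
    else resO (preimage_le h) (t (Function.update β k 0)) *
      (φ.app V).hom (δ ⟨V, h⟩ (resO h (z k) * c)) := by
  rw [← mul_assoc, ← map_mul (resO (preimage_le h))]
  split_ifs with hk
  · rw [mul_mono_of_lt x β k hk, hb.basis.op_apply hb.homeo hδ _ h]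
  · have hk' : (β k : ℕ) + 1 = q := le_antisymm (β k).is_lt (not_lt.1 hk)
    rw [mul_mono_of_eq x β k hk', map_mul (resO (preimage_le h)), ← hb.app_eq,
      resO_app φ h (preimage_le h), mul_assoc, ← map_mul (φ.app V).hom,
      hb.basis.op_apply hb.homeo hδ _ h]

/-- The operator on monomials that selects the exponents `β` which agree with `α` on `J`, and
replaces the exponents in `J` by zero. -/
def proj [NeZero q] (J : Finset (Fin d)) (α : Fin d → Fin q) : OpFamily X (φ ⁻¹ᵁ V₀) :=
  hb.basis.op hb.homeo 1 fun β => if ∀ j ∈ J, β j = α j then mono x (J.piecewise 0 β) else 0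

variable [NeZero q]

theorem proj_apply (J : Finset (Fin d)) (α β : Fin d → Fin q) {V : Y.Opens} (h : V ≤ V₀)
    (c : Γ(Y, V)) : hb.proj J α ⟨φ ⁻¹ᵁ V, preimage_le h⟩
      (resO (preimage_le h) (mono x β) * (φ.app V).hom c) =
      if ∀ j ∈ J, β j = α j then
        resO (preimage_le h) (mono x (J.piecewise 0 β)) * (φ.app V).hom c else 0 := by
  rw [proj, hb.basis.op_apply hb.homeo one_isNatural _ h]
  split_ifs
  · rfl
  · rw [map_zero, zero_mul]

theorem proj_mem (J : Finset (Fin d)) (α : Fin d → Fin q) :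
    hb.proj J α ∈ endSections φ (φ ⁻¹ᵁ V₀) :=
  hb.basis.op_one_mem hb.homeo _

/-- This factors the projection to a single coefficient into projections in one variable. The order
of the product is not bounded by `q - 1`, but that of each factor is, and this suffices for the
action on `E`. -/
theorem proj_insert {J : Finset (Fin d)} {k : Fin d} (hk : k ∉ J) (α : Fin d → Fin q) :
    hb.proj (insert k J) α = hb.proj {k} α * hb.proj J α := by
  refine hb.basis.op_ext hb.homeo fun V h β c => ?_
  change _ = hb.proj {k} α ⟨φ ⁻¹ᵁ V, preimage_le h⟩ (hb.proj J α ⟨φ ⁻¹ᵁ V, preimage_le h⟩ _)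
  rw [hb.proj_apply _ _ _ h, hb.proj_apply _ _ _ h]
  by_cases h1 : ∀ j ∈ J, β j = α j
  · rw [if_pos h1, hb.proj_apply _ _ _ h]
    have h2 : (∀ j ∈ insert k J, β j = α j) ↔ β k = α k := by
      rw [Finset.forall_mem_insert]
      exact and_iff_left h1
    simp only [h2, Finset.mem_singleton, forall_eq, Finset.piecewise_eq_of_notMem _ _ _ hk]
    have e : (insert k J).piecewise (0 : Fin d → Fin q) β =
        ({k} : Finset (Fin d)).piecewise 0 (J.piecewise 0 β) := by
      funext j
      by_cases hj : j = k
      · subst hj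
        simp
      · by_cases hJ : j ∈ J <;> simp [Finset.piecewise, hj, hJ]
    simp only [e]
  · rw [if_neg h1, map_zero, if_neg fun h2 => h1 fun j hj => h2 j (Finset.mem_insert_of_mem hj)]

theorem proj_univ_apply (α β : Fin d → Fin q) {V : Y.Opens} (h : V ≤ V₀)
    (c : Γ(Y, V)) : hb.proj Finset.univ α ⟨φ ⁻¹ᵁ V, preimage_le h⟩
      (resO (preimage_le h) (mono x β) * (φ.app V).hom c) =
      if β = α then (φ.app V).hom c else 0 := by
  have h1 : (∀ j ∈ Finset.univ, β j = α j) ↔ β = α := by simp [funext_iff]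
  rw [hb.proj_apply _ _ _ h]
  simp only [h1, Finset.piecewise_univ, mono_zero, map_one, one_mul]

theorem proj_univ_eq_coef (α : Fin d → Fin q) {V : Y.Opens} (h : V ≤ V₀)
    (a : Γ(X, φ ⁻¹ᵁ V)) : hb.proj Finset.univ α ⟨φ ⁻¹ᵁ V, preimage_le h⟩ a =
      (φ.app V).hom (hb.basis.coef h a α) := by
  conv_lhs => rw [← hb.basis.sum_coef h a, map_sum]
  rw [Finset.sum_congr rfl fun β _ => hb.proj_univ_apply α β h _,
    Finset.sum_ite_eq' Finset.univ α, if_pos (Finset.mem_univ _)]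

/-- Multiplication by `x_k` raises the `k`-th exponent, or resets it to `0` and produces `x_k^q`,
which comes from `Y`. The projection inspects and changes only the `j`-th exponent. -/
theorem proj_singleton_commute (j : Fin d) (α : Fin d → Fin q) {k : Fin d} (hk : k ≠ j) :
    Commute (hb.proj {j} α) (scalarOp (x k)) := by
  refine hb.basis.op_ext hb.homeo fun V h β c => ?_
  change hb.proj {j} α ⟨φ ⁻¹ᵁ V, preimage_le h⟩ (resO (preimage_le h) (x k) * _) =
    resO (preimage_le h) (x k) * hb.proj {j} α ⟨φ ⁻¹ᵁ V, preimage_le h⟩ _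
  rw [hb.proj_apply _ _ _ h]
  refine (hb.op_mul_apply one_isNatural _ k h β c).trans ?_
  have hk' : k ∉ ({j} : Finset (Fin d)) := by simpa using hk
  simp only [Finset.mem_singleton, forall_eq, Function.update_of_ne hk.symm]
  by_cases h1 : β j = α j
  · simp only [h1, if_true]
    have e : ∀ r : Fin q, ({j} : Finset (Fin d)).piecewise 0 (Function.update β k r) =
        Function.update (({j} : Finset (Fin d)).piecewise 0 β) k r := fun r => by
      rw [Finset.update_piecewise_of_notMem _ _ _ hk']
    have e' : ({j} : Finset (Fin d)).piecewise 0 β k = β k :=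
      Finset.piecewise_eq_of_notMem _ _ _ hk'
    split_ifs with h2
    · rw [e, ← mul_assoc, ← map_mul, mul_mono_of_lt x _ k (by rw [e']; exact h2)]
      simp only [e']
      rfl
    · have h2' : (β k : ℕ) + 1 = q := le_antisymm (β k).is_lt (not_lt.1 h2)
      rw [e, ← mul_assoc, ← map_mul, mul_mono_of_eq x _ k (by rw [e']; exact h2'),
        map_mul (resO (preimage_le h)), ← hb.app_eq, resO_app φ h (preimage_le h), mul_assoc,
        ← map_mul (φ.app V).hom]
      rfl
  · simp [h1]

theorem proj_singleton_order {p i : ℕ} (hp : p.Prime) (h0 : ∀ V : X.Opens, (p : Γ(X, V)) = 0)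
    (hq : q = p ^ i) (j : Fin d) (α : Fin d → Fin q) :
    IsOrderLE (q - 1) (φ ⁻¹ᵁ V₀) (hb.proj {j} α) :=
  hb.isOrderLE_of_commute hp h0 hq j (hb.proj_mem _ _) fun _ hk =>
    hb.proj_singleton_commute j α hk

theorem proj_empty (α : Fin d → Fin q) : hb.proj ∅ α = 1 := by
  refine hb.basis.op_ext hb.homeo fun V h β c => ?_
  rw [hb.proj_apply _ _ _ h, if_pos (by simp), Finset.piecewise_empty]
  rfl

theorem proj_mem_subring (K : Subring (OpFamily X (φ ⁻¹ᵁ V₀))) (α : Fin d → Fin q)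
    (hK : ∀ j, hb.proj {j} α ∈ K) (J : Finset (Fin d)) : hb.proj J α ∈ K := by
  induction J using Finset.induction_on with
  | empty =>
    rw [proj_empty]
    exact one_mem K
  | insert k J hk ih =>
    rw [hb.proj_insert hk]
    exact mul_mem (hK k) ih

/-! ### Lifting derivations, and partial derivatives -/

variable {g : Y ⟶ S} {f : X ⟶ S} (hfg : φ ≫ g = f)

/-- The operator `∑ x^α φ(c_α) ↦ ∑ x^α φ(δ c_α)`. -/
def lift (δ : OpFamily Y V₀) : OpFamily X (φ ⁻¹ᵁ V₀) :=
  hb.basis.op hb.homeo δ (mono x)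

omit [NeZero q] in
theorem lift_apply {δ : OpFamily Y V₀} (hδ : δ.IsNatural) (α : Fin d → Fin q) {V : Y.Opens}
    (h : V ≤ V₀) (c : Γ(Y, V)) : hb.lift δ ⟨φ ⁻¹ᵁ V, preimage_le h⟩
      (resO (preimage_le h) (mono x α) * (φ.app V).hom c) =
      resO (preimage_le h) (mono x α) * (φ.app V).hom (δ ⟨V, h⟩ c) :=
  hb.basis.op_apply hb.homeo hδ _ h α c

theorem lift_apply_app {δ : OpFamily Y V₀} (hδ : δ.IsNatural) {V : Y.Opens}
    (h : V ≤ V₀) (c : Γ(Y, V)) : hb.lift δ ⟨φ ⁻¹ᵁ V, preimage_le h⟩ ((φ.app V).hom c) =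
      (φ.app V).hom (δ ⟨V, h⟩ c) := by
  have := hb.lift_apply hδ 0 h c
  rwa [mono_zero, map_one, one_mul, one_mul] at this

include hfg in
omit [NeZero q] in
theorem lift_mem {δ : OpFamily Y V₀} (hδ : δ ∈ endSections g V₀) :
    hb.lift δ ∈ endSections f (φ ⁻¹ᵁ V₀) := by
  refine ⟨hb.basis.op_natural hb.homeo hδ.1 _, ?_⟩
  subst hfg
  rintro ⟨W, hW⟩ T h t a
  obtain ⟨V, rfl⟩ := exists_preimage_eq hb.homeo W
  have hV := le_of_preimage_le hb.homeo hW
  have hT : V ≤ g ⁻¹ᵁ T := le_of_preimage_le hb.homeo h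
  have e : ((φ ≫ g).appLE T (φ ⁻¹ᵁ V) h).hom t = (φ.app V).hom ((g.appLE T V hT).hom t) := by
    rw [← Scheme.Hom.appLE_comp_appLE φ g T V (φ ⁻¹ᵁ V) hT le_rfl, Scheme.Hom.appLE_eq_app]
    rfl
  change hb.lift δ ⟨φ ⁻¹ᵁ V, preimage_le hV⟩ _ = _ * hb.lift δ ⟨φ ⁻¹ᵁ V, preimage_le hV⟩ a
  rw [e, ← hb.basis.sum_coef hV a, Finset.mul_sum, map_sum, map_sum, Finset.mul_sum]
  refine Finset.sum_congr rfl fun i _ => ?_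
  rw [mul_left_comm, ← map_mul, hb.lift_apply hδ.1 _ hV, hb.lift_apply hδ.1 _ hV,
    hδ.2 ⟨V, hV⟩ T hT,
    map_mul, mul_left_comm]

/-- The commutator of the lift with a function `c` from `Y` is multiplication by `δ c`, of order
`0`. The commutator with `x_k` vanishes on monomials unless the exponent of `x_k` passes from `q -
1` to `0`, and then the Leibniz rule leaves the term `δ(x_k^q)`. It is therefore a function times
the projection to exponent `q - 1` in `x_k`, of order at most `q - 1`. -/
theorem lift_order {p i : ℕ} (hp : p.Prime) (h0 : ∀ V : X.Opens, (p : Γ(X, V)) = 0)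
    (hq : q = p ^ i) (δ : derivations g V₀) : IsOrderLE q (φ ⁻¹ᵁ V₀) (hb.lift δ.1) := by
  have hδ : δ.1.IsNatural := δ.2.1.1
  have hq1 : q - 1 + 1 = q := Nat.sub_add_cancel (Nat.pos_of_ne_zero (NeZero.ne q))
  suffices h : IsOrderLE (q - 1 + 1) (φ ⁻¹ᵁ V₀) (hb.lift δ.1) from h.mono hq1.le
  refine hb.isOrderLE_succ (fun V h c => ?_) fun k => ?_
  · refine IsOrderLE.mono (Nat.zero_le _) ⟨(φ.app V).hom (δ.1 ⟨V, h⟩ c), ?_⟩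
    refine (hb.restrict h).basis.op_ext hb.homeo fun W hW α r => ?_
    have e1 : resO (preimage_le hW) (mono (fun j => resO (preimage_le h) (x j)) α) =
        resO (preimage_le (hW.trans h)) (mono x α) := by
      rw [← map_mono, resO_resO]
    rw [e1]
    change hb.lift δ.1 ⟨φ ⁻¹ᵁ W, preimage_le (hW.trans h)⟩ (resO (preimage_le hW) _ * _) -
      resO (preimage_le hW) _ * hb.lift δ.1 ⟨φ ⁻¹ᵁ W, preimage_le (hW.trans h)⟩ _ =
      resO (preimage_le hW) _ * _
    rw [resO_app φ hW, resO_app φ hW, mul_left_comm, ← map_mul, hb.lift_apply hδ _ (hW.trans h),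
      hb.lift_apply hδ _ (hW.trans h), δ.2.2, hδ ⟨V, h⟩ ⟨W, hW.trans h⟩ hW]
    simp only [map_add, map_mul]
    ring
  · have e : hb.lift δ.1 * scalarOp (x k) - scalarOp (x k) * hb.lift δ.1 =
        scalarOp ((φ.app V₀).hom (δ.1 ⟨V₀, le_rfl⟩ (z k))) *
          hb.proj {k} (fun _ => (⟨q - 1, by omega⟩ : Fin q)) := by
      refine hb.basis.op_ext hb.homeo fun V h α c => ?_
      change hb.lift δ.1 ⟨φ ⁻¹ᵁ V, preimage_le h⟩ (resO (preimage_le h) (x k) * _) -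
        resO (preimage_le h) (x k) * hb.lift δ.1 ⟨φ ⁻¹ᵁ V, preimage_le h⟩ _ =
        resO (preimage_le h) _ * hb.proj {k} _ ⟨φ ⁻¹ᵁ V, preimage_le h⟩ _
      rw [hb.proj_apply _ _ _ h, hb.lift_apply hδ _ h]
      refine (congrArg (· - _) (hb.op_mul_apply hδ _ k h α c)).trans ?_
      have hiff : (∀ j ∈ ({k} : Finset (Fin d)), α j = (⟨q - 1, by omega⟩ : Fin q)) ↔
          (α k : ℕ) = q - 1 := by
        simp only [Finset.mem_singleton, forall_eq]
        exact Fin.ext_iff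
      simp only [hiff]
      split_ifs with h1 h2 h2
      · omega
      · rw [← mul_mono_of_lt x α k h1, map_mul, mul_assoc, sub_self, mul_zero]
      · have h1' : (α k : ℕ) + 1 = q := by omega
        have e2 : ({k} : Finset (Fin d)).piecewise 0 α = Function.update α k 0 :=
          Finset.piecewise_singleton _ _ _
        rw [← mul_assoc, ← map_mul (resO _), mul_mono_of_eq x α k h1', e2, map_mul (resO _),
          ← hb.app_eq, resO_app φ h (preimage_le h), resO_app φ h (preimage_le h), δ.2.2,
          hδ ⟨V₀, le_rfl⟩ ⟨V, h⟩ h]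
        simp only [map_add, map_mul]
        ring
      · have := (α k).is_lt
        omega
    rw [e]
    exact IsOrderLE.mul_aux _ (zero_add _) ⟨_, rfl⟩ (hb.proj_singleton_order hp h0 hq _ _)

/-- The partial derivative with respect to the coordinate `x k`. -/
def partialOp (k : Fin d) : OpFamily X (φ ⁻¹ᵁ V₀) :=
  hb.basis.op hb.homeo 1 fun β =>
    (((β k : ℕ) : Γ(X, φ ⁻¹ᵁ V₀)) * mono x (Function.update β k (predFin (β k))))

omit [NeZero q] in
theorem partialOp_mem (k : Fin d) : hb.partialOp k ∈ endSections φ (φ ⁻¹ᵁ V₀) :=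
  hb.basis.op_one_mem hb.homeo _

omit [NeZero q] in
theorem partialOp_apply (k : Fin d) (β : Fin d → Fin q) {V : Y.Opens} (h : V ≤ V₀) (c : Γ(Y, V)) :
    hb.partialOp k ⟨φ ⁻¹ᵁ V, preimage_le h⟩
      (resO (preimage_le h) (mono x β) * (φ.app V).hom c) =
      ((β k : ℕ) : Γ(X, φ ⁻¹ᵁ V)) *
        resO (preimage_le h) (mono x (Function.update β k (predFin (β k)))) * (φ.app V).hom c := by
  refine (hb.basis.op_apply hb.homeo one_isNatural _ h β c).trans ?_
  rw [map_mul (resO (preimage_le h)), map_natCast (resO (preimage_le h))]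
  rfl

theorem partialOp_commutator (h0 : ∀ V : X.Opens, (q : Γ(X, V)) = 0) (k l : Fin d) :
    hb.partialOp k * scalarOp (x l) - scalarOp (x l) * hb.partialOp k =
      if l = k then 1 else 0 := by
  refine hb.basis.op_ext hb.homeo fun V h β c => ?_
  change hb.partialOp k ⟨φ ⁻¹ᵁ V, preimage_le h⟩ (resO (preimage_le h) (x l) * _) -
    resO (preimage_le h) (x l) * hb.partialOp k ⟨φ ⁻¹ᵁ V, preimage_le h⟩ _ = _
  rw [hb.partialOp_apply _ _ h]
  refine (congrArg (· - _) (hb.op_mul_apply one_isNatural _ l h β c)).trans ?_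
  by_cases hl : l = k
  · subst hl
    have e := congr(resO (preimage_le h) $(natCast_mul_mono_pred x β l))
    rw [map_mul (resO _), map_mul (resO _), map_mul (resO _), map_natCast (resO _)] at e
    have e1 : resO (preimage_le h) (x l) * (((β l : ℕ) : Γ(X, φ ⁻¹ᵁ V)) * resO (preimage_le h)
        (mono x (Function.update β l (predFin (β l)))) * (φ.app V).hom c) =
        ((β l : ℕ) : Γ(X, φ ⁻¹ᵁ V)) * resO (preimage_le h) (mono x β) * (φ.app V).hom c := by
      rw [← e]
      ring
    refine (congrArg (_ - ·) e1).trans ?_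
    rw [if_pos rfl]
    change _ = resO (preimage_le h) (mono x β) * (φ.app V).hom c
    split_ifs with h1
    · have e2 : Function.update (Function.update β l ⟨β l + 1, h1⟩) l
          (predFin (Function.update β l ⟨β l + 1, h1⟩ l)) = β := by
        rw [Function.update_idem, Function.update_self]
        exact Function.update_eq_self l β
      rw [e2, Function.update_self, map_mul (resO _), map_natCast (resO _)]
      change _ * (φ.app V).hom c - _ = _
      push_cast
      ring
    · have h1' : (β l : ℕ) + 1 = q := le_antisymm (β l).is_lt (not_lt.1 h1)
      -- At the top exponent `q - 1`, multiplication by `x_l` gives a constant times `x_l^q`, whose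
      -- derivative is zero; the remaining term has coefficient `-(q - 1) = 1` because `q = 0`.
      have h2 : ((β l : ℕ) : Γ(X, φ ⁻¹ᵁ V)) = -1 := by
        rw [eq_neg_iff_add_eq_zero, ← h0 (φ ⁻¹ᵁ V)]
        exact_mod_cast congrArg (Nat.cast (R := Γ(X, φ ⁻¹ᵁ V))) h1'
      rw [Function.update_self, Fin.val_zero, Nat.cast_zero, zero_mul, map_zero, zero_mul, h2]
      ring
  · rw [if_neg hl]
    change _ = (0 : Γ(X, φ ⁻¹ᵁ V))
    rw [sub_eq_zero]
    set γ := Function.update β k (predFin (β k))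
    have hγ : γ l = β l := Function.update_of_ne hl _ _
    have e : ∀ r : Fin q, Function.update (Function.update β l r) k
        (predFin (Function.update β l r k)) = Function.update γ l r := fun r => by
      rw [Function.update_of_ne (Ne.symm hl), Function.update_comm hl]
    have e' : ∀ r : Fin q, Function.update β l r k = β k := fun r =>
      Function.update_of_ne (Ne.symm hl) _ _
    have e1 : resO (preimage_le h) (x l) * (((β k : ℕ) : Γ(X, φ ⁻¹ᵁ V)) *
        resO (preimage_le h) (mono x γ) * (φ.app V).hom c) = ((β k : ℕ) : Γ(X, φ ⁻¹ᵁ V)) *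
          (resO (preimage_le h) (x l * mono x γ) * (φ.app V).hom c) := by
      rw [map_mul (resO _)]
      ring
    refine Eq.trans ?_ e1.symm
    split_ifs with h1
    · rw [e, e', map_mul (resO _), map_natCast (resO _), mul_mono_of_lt x γ l (by rw [hγ]; exact h1),
        mul_assoc]
      simp only [hγ]
      rfl
    · have h1' : (β l : ℕ) + 1 = q := le_antisymm (β l).is_lt (not_lt.1 h1)
      rw [e, e', map_mul (resO _), map_natCast (resO _), mul_mono_of_eq x γ l (by rw [hγ]; exact h1'),
        map_mul (resO _), ← hb.app_eq, resO_app φ h (preimage_le h), mul_assoc, mul_assoc,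
        ← map_mul (φ.app V).hom]
      rfl

theorem partialOp_one (k : Fin d) {V : Y.Opens} (h : V ≤ V₀) :
    hb.partialOp k ⟨φ ⁻¹ᵁ V, preimage_le h⟩ 1 = 0 := by
  have := hb.partialOp_apply k 0 h 1
  rwa [mono_zero, map_one, map_one, one_mul, Pi.zero_apply, Fin.val_zero, Nat.cast_zero, zero_mul,
    zero_mul] at this

/-- Commutators with generators are functions, so the operator has order at most `1`; an operator of
order at most `1` that kills `1` is a derivation. -/
theorem partialOp_leibniz (h0 : ∀ V : X.Opens, (q : Γ(X, V)) = 0) (k : Fin d)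
    (W : {W : X.Opens // W ≤ φ ⁻¹ᵁ V₀}) (a b : Γ(X, W.1)) :
    hb.partialOp k W (a * b) = a * hb.partialOp k W b + hb.partialOp k W a * b := by
  have h1 : IsOrderLE 1 (φ ⁻¹ᵁ V₀) (hb.partialOp k) := by
    refine hb.isOrderLE_succ (fun V h c => ?_) fun l => ?_
    · rw [(commute_scalarOp_app (res_mem_endSections φ (preimage_le h) (hb.partialOp_mem k)) c).eq,
        sub_self]
      exact IsOrderLE.zero _ _
    · rw [hb.partialOp_commutator h0]
      split_ifs
      · exact ⟨1, scalarOp_one.symm⟩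
      · exact IsOrderLE.zero _ _
  obtain ⟨u, hu⟩ := h1 W.1 W.2 a
  have h2 : ∀ b : Γ(X, W.1), hb.partialOp k W (a * b) - a * hb.partialOp k W b = u * b := fun b => by
    have := congr($hu ⟨W.1, le_rfl⟩ b)
    change hb.partialOp k W (resO le_rfl a * b) - resO le_rfl a * hb.partialOp k W b =
      resO le_rfl u * b at this
    rwa [resO_self, resO_self] at this
  have h3 : hb.partialOp k W 1 = 0 := by
    obtain ⟨W, hW⟩ := W
    obtain ⟨V, rfl⟩ := exists_preimage_eq hb.homeo W
    exact hb.partialOp_one k (le_of_preimage_le hb.homeo hW)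
  have h4 := h2 1
  rw [mul_one, h3, mul_zero, sub_zero, mul_one] at h4
  rw [h4, ← h2]
  ring

end MonoBasis

end MonoOps

end KatzGieseker

end



noncomputable section

namespace KatzGieseker

/-! ### Consequences of a basis containing `1` -/

section ModBasis

variable {X Y : Scheme.{u}} {φ : X ⟶ Y} {N : X.Modules} {M : Y.Modules}
  {j : M ⟶ (Scheme.Modules.pushforward φ).obj N} {V₀ : Y.Opens} {I : Type} [Fintype I]
  {b : I → Γ(X, φ ⁻¹ᵁ V₀)}

theorem ModBasis.eq_of_sum_eq [DecidableEq I] (hb : ModBasis φ j V₀ b) (i₀ : I) (hi₀ : b i₀ = 1)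
    {V : Y.Opens} (h : V ≤ V₀) (m : I → Γ(M, V)) (m' : Γ(M, V))
    (hm : ∑ i, resO (preimage_le h) (b i) • onSections j V (m i) = onSections j V m') :
    m = Pi.single i₀ m' := by
  refine (hb V h).1 (hm.trans ?_)
  refine Eq.symm ((Finset.sum_eq_single i₀ (fun i _ hi => ?_) (by simp)).trans ?_)
  · rw [Pi.single_eq_of_ne hi, map_zero, smul_zero]
  · rw [Pi.single_eq_same, hi₀, map_one, one_smul]

theorem ModBasis.injective [DecidableEq I] (hb : ModBasis φ j V₀ b) (i₀ : I) (hi₀ : b i₀ = 1)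
    {V : Y.Opens} (h : V ≤ V₀) : Function.Injective (onSections j V) := by
  refine (injective_iff_map_eq_zero _).2 fun m hm => ?_
  have h1 := hb.eq_of_sum_eq i₀ hi₀ h (fun _ => 0) m (by simp [hm])
  have h2 := congr_fun h1 i₀
  rwa [Pi.single_eq_same, eq_comm] at h2

/-- Since `b i₀ = 1`, taking the coordinate at `i₀` is a retraction of `φ_* N` onto `M`, compatible
with restriction. It turns fractions in `N` into fractions in `M`. -/
theorem ModBasis.isLocalizingOn [DecidableEq I] (hb : ModBasis φ j V₀ b) (i₀ : I) (hi₀ : b i₀ = 1)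
    (hN : IsLocalizingOn N (φ ⁻¹ᵁ V₀)) : IsLocalizingOn M V₀ := by
  intro c
  have hc : φ ⁻¹ᵁ Y.basicOpen c = X.basicOpen ((φ.app V₀).hom c) := Scheme.preimage_basicOpen φ c
  have hle := Y.basicOpen_le c
  obtain ⟨h1, h2⟩ := hN ((φ.app V₀).hom c)
  refine ⟨fun e => ?_, fun e he => ?_⟩
  · obtain ⟨n, e₀, he₀⟩ := h1 (resM N hc.ge (onSections j _ e))
    obtain ⟨m, hm⟩ := (hb V₀ le_rfl).2 e₀
    refine ⟨n, m i₀, ?_⟩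
    have h3 := congr(resM N hc.le $he₀)
    rw [resM_resM, resM_smul, resM_resM, resM_self, map_pow, resO_resO, ← hm] at h3
    have h4 := hb.eq_of_sum_eq i₀ hi₀ hle (fun i => resM M hle (m i)) (resO hle c ^ n • e) (by
      rw [onSections_smul, map_pow, ← resO_app φ hle (preimage_le hle), ← h3]
      simp only [map_sum, resM_smul, resO_resO, resM_onSections j hle])
    have h5 := congr_fun h4 i₀
    rwa [Pi.single_eq_same] at h5
  · obtain ⟨n, hn⟩ := h2 (onSections j V₀ e) (by
      have h3 : resM N (preimage_le hle) (onSections j V₀ e) = 0 := by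
        rw [resM_onSections j hle, he, map_zero]
      have h4 := congr(resM N hc.ge $h3)
      rwa [resM_resM, map_zero] at h4)
    refine ⟨n, hb.injective i₀ hi₀ le_rfl ?_⟩
    rw [onSections_smul, map_pow, hn, map_zero]

end ModBasis

/-! ### Sections killed by operators of small order -/

section Killed

theorem OpFamily.IsNatural.apply_one_eq_zero {X : Scheme.{u}} {V W : X.Opens} {D : OpFamily X V}
    (hD : D.IsNatural) (h1 : D ⟨V, le_rfl⟩ 1 = 0) (h : W ≤ V) : D ⟨W, h⟩ 1 = 0 := by
  have h2 := hD ⟨V, le_rfl⟩ ⟨W, h⟩ h 1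
  rwa [h1, map_zero, map_one (resO h), eq_comm] at h2

theorem endSum_apply {A I : Type*} [AddCommGroup A] (s : Finset I) (F : I → AddMonoid.End A) (a : A) :
    (∑ i ∈ s, F i) a = ∑ i ∈ s, F i a :=
  AddMonoidHom.finsetSum_apply F s a

variable {X S : Scheme.{u}} {f : X ⟶ S} {E : X.Modules} (nab : Stratification f E) {N : ℕ}

namespace Stratification

theorem res_mem_killed {U V : X.Opens} (h : V ≤ U) {e : Γ(E, U)} (he : e ∈ nab.killed N U) :
    resM E h e ∈ nab.killed N V := fun W hW D hD h1 => by
  rw [resM_resM]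
  exact he W (hW.trans h) D hD h1

theorem mem_killed_of_local {U : X.Opens} {e : Γ(E, U)}
    (h : ∀ x ∈ U, ∃ (V : X.Opens) (h : V ≤ U), x ∈ V ∧ resM E h e ∈ nab.killed N V) :
    e ∈ nab.killed N U := by
  intro V hV D ⟨m, hm, hD⟩ h1
  refine sectionM_ext E _ _ fun x hx => ?_
  obtain ⟨W, hW, hxW, he⟩ := h x (hV hx)
  refine ⟨W ⊓ V, inf_le_right, ⟨hxW, hx⟩, ?_⟩
  rw [nab.nabla_res, resM_resM, map_zero]
  have h2 := he (W ⊓ V) inf_le_left (diffOps.res f inf_le_right D) ⟨m, hm, hD.res inf_le_right⟩ ?_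
  · rwa [resM_resM] at h2
  · exact OpFamily.IsNatural.apply_one_eq_zero D.2.1.1 h1 inf_le_right

theorem killed_mono {N N' : ℕ} (h : N ≤ N') (U : X.Opens) : nab.killed N' U ≤ nab.killed N U :=
  fun _ he V hV D ⟨m, hm, hD⟩ h1 => he V hV D ⟨m, hm.trans_le h, hD⟩ h1

/-- The operator `D ∘ b - D(b)` has order at most that of `D` and kills `1`, so it kills `e`. -/
theorem nabla_smul_of_mem_killed {U : X.Opens} (D : diffOps f U) {m : ℕ} (hm : m < N)
    (hD : IsOrderLE m U D.1) (b : Γ(X, U)) {e : Γ(E, U)} (he : e ∈ nab.killed N U) :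
    nab.nabla U D (b • e) = D.1 ⟨U, le_rfl⟩ b • e := by
  have h1 := he U le_rfl (D * diffOps.scalar f b - diffOps.scalar f (D.1 ⟨U, le_rfl⟩ b))
    ⟨m, hm, ?_⟩ ?_
  · rw [resM_self, map_sub, map_mul] at h1
    replace h1 := sub_eq_zero.1 ((AddMonoidHom.sub_apply _ _ _).symm.trans h1)
    refine Eq.trans ?_ (h1.trans (nab.nabla_scalar _ _))
    exact congrArg _ (nab.nabla_scalar b e).symm
  · change IsOrderLE m U (D.1 * scalarOp b - scalarOp (D.1 ⟨U, le_rfl⟩ b))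
    rw [sub_eq_add_neg, ← scalarOp_neg]
    exact (IsOrderLE.mul_aux m (add_zero m) hD ⟨b, rfl⟩).add
      (IsOrderLE.mono (Nat.zero_le m) ⟨_, rfl⟩)
  · change D.1 ⟨U, le_rfl⟩ (resO le_rfl b * 1) - resO le_rfl (D.1 ⟨U, le_rfl⟩ b) * 1 = 0
    rw [resO_self, resO_self, mul_one, mul_one, sub_self]

theorem smul_mem_killed {U : X.Opens} {a : Γ(X, U)} {e : Γ(E, U)} (he : e ∈ nab.killed N U)
    (ha : ∀ (V : X.Opens) (h : V ≤ U) (D : diffOps f V) (m : ℕ), m < N → IsOrderLE m V D.1 →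
      D.1 ⟨V, le_rfl⟩ (resO h a * 1) = resO h a * D.1 ⟨V, le_rfl⟩ 1) :
    a • e ∈ nab.killed N U := by
  intro V hV D ⟨m, hm, hD⟩ h1
  rw [resM_smul, nab.nabla_smul_of_mem_killed D hm hD _ (nab.res_mem_killed hV he)]
  have h2 := ha V hV D m hm hD
  rw [mul_one, h1, mul_zero] at h2
  rw [h2, zero_smul]

theorem isSubsheafOverBase_killed : IsSubsheafOverBase f E (nab.killed N) where
  res h _ he := nab.res_mem_killed h he
  local' _ h := nab.mem_killed_of_local h
  smul {U} T h t e he := nab.smul_mem_killed he fun V hV D m hm hD => by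
    have h1 := D.2.1.2 ⟨V, le_rfl⟩ T (hV.trans h) t 1
    have h2 : resO hV ((f.appLE T U h).hom t) = (f.appLE T V (hV.trans h)).hom t :=
      congr($(Scheme.Hom.appLE_map f h (homOfLE hV).op).hom t)
    rw [h2]
    exact h1

/-- The operators that act on multiples of killed sections through the coefficient. -/
def coefOps (N : ℕ) (U : X.Opens) : Subring (OpFamily X U) where
  carrier := {D | ∃ hD : D ∈ diffOps f U, ∀ (V : X.Opens) (h : V ≤ U) (b : Γ(X, V)),
    ∀ e ∈ nab.killed N V, nab.nabla V (diffOps.res f h ⟨D, hD⟩) (b • e) = D ⟨V, h⟩ b • e}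
  mul_mem' := by
    rintro D D' ⟨hD, h⟩ ⟨hD', h'⟩
    refine ⟨mul_mem hD hD', fun V hV b e he => ?_⟩
    have e1 : diffOps.res f hV ⟨D * D', mul_mem hD hD'⟩ =
      diffOps.res f hV ⟨D, hD⟩ * diffOps.res f hV ⟨D', hD'⟩ := rfl
    rw [e1, map_mul]
    change nab.nabla V _ (nab.nabla V _ (b • e)) = D ⟨V, hV⟩ (D' ⟨V, hV⟩ b) • e
    rw [h' V hV b e he, h V hV _ e he]
  one_mem' := ⟨one_mem _, fun V hV b e he => by
    have e1 : diffOps.res f hV (⟨1, one_mem _⟩ : diffOps f U) = 1 := rfl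
    rw [e1, map_one]
    rfl⟩
  add_mem' := by
    rintro D D' ⟨hD, h⟩ ⟨hD', h'⟩
    refine ⟨add_mem hD hD', fun V hV b e he => ?_⟩
    have e1 : diffOps.res f hV ⟨D + D', add_mem hD hD'⟩ =
      diffOps.res f hV ⟨D, hD⟩ + diffOps.res f hV ⟨D', hD'⟩ := rfl
    rw [e1, map_add]
    change nab.nabla V _ (b • e) + nab.nabla V _ (b • e) = (D ⟨V, hV⟩ b + D' ⟨V, hV⟩ b) • e
    rw [h' V hV b e he, h V hV _ e he, add_smul]
  zero_mem' := ⟨zero_mem _, fun V hV b e he => by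
    have e1 : diffOps.res f hV (⟨0, zero_mem _⟩ : diffOps f U) = 0 := rfl
    rw [e1, map_zero]
    exact (zero_smul _ _).symm⟩
  neg_mem' := by
    rintro D ⟨hD, h⟩
    refine ⟨neg_mem hD, fun V hV b e he => ?_⟩
    have e1 : diffOps.res f hV ⟨-D, neg_mem hD⟩ = -diffOps.res f hV ⟨D, hD⟩ := rfl
    rw [e1, map_neg]
    change -nab.nabla V _ (b • e) = (-D ⟨V, hV⟩ b) • e
    rw [h V hV b e he, neg_smul]

theorem mem_coefOps {U : X.Opens} {D : OpFamily X U} (hD : D ∈ endSections f U) {m : ℕ}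
    (hm : m < N) (hD' : IsOrderLE m U D) : D ∈ nab.coefOps N U :=
  have hD'' : D ∈ diffOps f U := ⟨hD, fun _ hx => ⟨U, le_rfl, hx, m, hD'⟩⟩
  ⟨hD'', fun _ hV b _ he =>
    nab.nabla_smul_of_mem_killed (diffOps.res f hV ⟨D, hD''⟩) hm (hD'.res hV) b he⟩

end Stratification

end Killed

/-! ### Schemes over which operators of small order are linear -/

section Level

variable {X S Y : Scheme.{u}}

/-- The properties of `φ : X ⟶ X^{(i)}` used below: operators of order less than `p ^ i` are
linear along `φ`, and there are local coordinates. -/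
structure IsLevel (f : X ⟶ S) (φ : X ⟶ Y) (g : Y ⟶ S) (p i : ℕ) : Prop where
  homeo : IsHomeomorph φ
  comp : φ ≫ g = f
  char (V : X.Opens) : (p : Γ(X, V)) = 0
  linear {U : X.Opens} {D : OpFamily X U} {m : ℕ} :
    D ∈ endSections f U → IsOrderLE m U D → m < p ^ i → D ∈ endSections φ U
  chart (y : Y) : ∃ V₀ : Y.Opens, y ∈ V₀ ∧ IsAffineOpen V₀ ∧ IsAffineOpen (φ ⁻¹ᵁ V₀) ∧
    ∃ (d : ℕ) (x : Fin d → Γ(X, φ ⁻¹ᵁ V₀)) (z : Fin d → Γ(Y, V₀)), MonoBasis φ V₀ (p ^ i) x z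

variable {f : X ⟶ S} {φ : X ⟶ Y} {g : Y ⟶ S} {p i : ℕ} [hp : Fact p.Prime]

/-- The full projection may have order `p^i` or more, but it is a product of operators of smaller
order, and acting through the coefficient is preserved by products. -/
theorem MonoBasis.proj_mem_coefOps (lv : IsLevel f φ g p i) {E : X.Modules}
    (nab : Stratification f E) {V₀ : Y.Opens} {d : ℕ} {x : Fin d → Γ(X, φ ⁻¹ᵁ V₀)}
    {z : Fin d → Γ(Y, V₀)} (hb : MonoBasis φ V₀ (p ^ i) x z) (α : Fin d → Fin (p ^ i)) :
    hb.proj Finset.univ α ∈ nab.coefOps (p ^ i) (φ ⁻¹ᵁ V₀) :=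
  hb.proj_mem_subring _ α (fun k => nab.mem_coefOps
    (endSections_le_of_comp lv.comp _ (hb.proj_mem _ _))
    (Nat.sub_lt (pow_pos hp.out.pos i) one_pos) (hb.proj_singleton_order hp.out lv.char rfl k α)) _

namespace IsLevel

variable (lv : IsLevel f φ g p i) {E : X.Modules} (nab : Stratification f E)

include lv in
omit hp in
theorem app_smul_mem_killed {V : Y.Opens} (c : Γ(Y, V)) {e : Γ(E, φ ⁻¹ᵁ V)}
    (he : e ∈ nab.killed (p ^ i) (φ ⁻¹ᵁ V)) :
    (φ.app V).hom c • e ∈ nab.killed (p ^ i) (φ ⁻¹ᵁ V) :=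
  nab.smul_mem_killed he fun W hW D _ hm hD =>
    (lv.linear D.2.1 hD hm).2 ⟨W, le_rfl⟩ V hW c 1

/-- The killed sections as a sheaf of modules along `φ`. -/
def killedData : ModData Y where
  obj V := nab.killed (p ^ i) (φ ⁻¹ᵁ V)
  module V :=
    { smul := fun c e => ⟨(φ.app V).hom c • e.1, lv.app_smul_mem_killed nab c e.2⟩
      one_smul := fun e => Subtype.ext (by
        change (φ.app V).hom 1 • e.1 = e.1
        rw [map_one, one_smul])
      mul_smul := fun a b e => Subtype.ext (by
        change (φ.app V).hom (a * b) • e.1 = (φ.app V).hom a • (φ.app V).hom b • e.1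
        rw [map_mul, mul_smul])
      smul_zero := fun a => Subtype.ext (smul_zero ((φ.app V).hom a))
      smul_add := fun a e e' => Subtype.ext (smul_add ((φ.app V).hom a) e.1 e'.1)
      add_smul := fun a b e => Subtype.ext (by
        change (φ.app V).hom (a + b) • e.1 = (φ.app V).hom a • e.1 + (φ.app V).hom b • e.1
        rw [map_add, add_smul])
      zero_smul := fun e => Subtype.ext (by
        change (φ.app V).hom 0 • e.1 = 0
        rw [map_zero, zero_smul]) }
  res {V V'} h := AddMonoidHom.mk' (fun e => ⟨resM E (preimage_le h) e.1,
    nab.res_mem_killed (preimage_le h) e.2⟩) fun e e' => Subtype.ext (map_add _ _ _)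
  res_self V e := Subtype.ext (resM_self _ _ _)
  res_res h h' e := Subtype.ext (resM_resM _ _ _ _)
  res_smul {V V'} h a e := Subtype.ext (by
    change resM E (preimage_le h) ((φ.app V).hom a • e.1) =
      (φ.app V').hom (resO h a) • resM E (preimage_le h) e.1
    rw [resM_smul, resO_app φ h])
  ext {V} e e' he := Subtype.ext (sectionM_ext E _ _ fun x hx => by
    obtain ⟨V', h, hxV', hee⟩ := he (φ x) hx
    exact ⟨φ ⁻¹ᵁ V', preimage_le h, hxV', congrArg Subtype.val hee⟩)
  glue {ι} V e he := by
    obtain ⟨s, hs⟩ := exists_glueM E (fun i => φ ⁻¹ᵁ V i) (fun i => (e i).1) fun i j =>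
      congrArg Subtype.val (he i j)
    have hle : φ ⁻¹ᵁ iSup V ≤ iSup fun i => φ ⁻¹ᵁ V i := fun x hx => by
      obtain ⟨i, hi⟩ := Opens.mem_iSup.1 hx
      exact Opens.mem_iSup.2 ⟨i, hi⟩
    refine ⟨⟨resM E hle s, nab.mem_killed_of_local fun x hx => ?_⟩, fun i => Subtype.ext ?_⟩
    · obtain ⟨i, hi⟩ := Opens.mem_iSup.1 hx
      refine ⟨φ ⁻¹ᵁ V i, preimage_le (le_iSup V i), hi, ?_⟩
      rw [resM_resM]
      exact (hs i).symm ▸ (e i).2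
    · exact (resM_resM _ _ _ _).trans (hs i)

/-- The sheaf of modules of killed sections. -/
def killedM : Y.Modules := (lv.killedData nab).toModules

omit hp in
theorem exists_killedHom : ∃ ι : lv.killedM nab ⟶ (Scheme.Modules.pushforward φ).obj E,
    ∀ (V : Y.Opens) (e : nab.killed (p ^ i) (φ ⁻¹ᵁ V)),
      onSections ι V ((lv.killedData nab).toSection e) = e.1 :=
  exists_hom_of_sections (N := lv.killedM nab) (N' := (Scheme.Modules.pushforward φ).obj E)
    (fun V => (nab.killed (p ^ i) (φ ⁻¹ᵁ V)).subtype) (fun _ _ _ _ => rfl) fun _ _ _ => rfl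

/-- The inclusion of the sheaf of killed sections. -/
def killedHom : lv.killedM nab ⟶ (Scheme.Modules.pushforward φ).obj E :=
  (lv.exists_killedHom nab).choose

omit hp in
theorem killedHom_injective (V : Y.Opens) : Function.Injective (onSections (lv.killedHom nab) V) := by
  intro m m' h
  obtain ⟨e, rfl⟩ := (lv.killedData nab).toSection.surjective m
  obtain ⟨e', rfl⟩ := (lv.killedData nab).toSection.surjective m'
  have h1 := (lv.exists_killedHom nab).choose_spec
  exact congrArg _ (Subtype.ext ((h1 V e).symm.trans (h.trans (h1 V e'))))

omit hp in
theorem range_killedHom (V : Y.Opens) :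
    Set.range (onSections (lv.killedHom nab) V) = nab.killed (p ^ i) (φ ⁻¹ᵁ V) := by
  have h1 := (lv.exists_killedHom nab).choose_spec
  ext e
  constructor
  · rintro ⟨m, rfl⟩
    obtain ⟨e', rfl⟩ := (lv.killedData nab).toSection.surjective m
    exact (h1 V e').symm ▸ e'.2
  · exact fun he => ⟨_, h1 V ⟨e, he⟩⟩

omit hp in
theorem killedHom_mem {V : Y.Opens} (m : Γ(lv.killedM nab, V)) :
    onSections (lv.killedHom nab) V m ∈ nab.killed (p ^ i) (φ ⁻¹ᵁ V) := by
  have h : onSections (lv.killedHom nab) V m ∈ Set.range (onSections (lv.killedHom nab) V) := ⟨m, rfl⟩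
  rwa [range_killedHom] at h

omit hp in
theorem exists_killedHom_eq {V : Y.Opens} {e : Γ(E, φ ⁻¹ᵁ V)}
    (he : e ∈ nab.killed (p ^ i) (φ ⁻¹ᵁ V)) : ∃ m, onSections (lv.killedHom nab) V m = e := by
  have h : e ∈ Set.range (onSections (lv.killedHom nab) V) := by
    rw [range_killedHom]
    exact he
  exact h

omit hp in
theorem identifies_killedHom : Identifies φ (nab.killed (p ^ i)) (lv.killedHom nab) :=
  fun V => ⟨lv.killedHom_injective nab V, lv.range_killedHom nab V⟩

/-- Locally, sections of `E` are unique combinations of monomials and killed sections. -/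
theorem modBasis_killedHom {V₀ : Y.Opens} {d : ℕ} {x : Fin d → Γ(X, φ ⁻¹ᵁ V₀)}
    {z : Fin d → Γ(Y, V₀)} (hb : MonoBasis φ V₀ (p ^ i) x z) :
    ModBasis φ (lv.killedHom nab) V₀ (mono (q := p ^ i) x) := by
  classical
  intro V h
  have hR : ∀ α, hb.proj Finset.univ α ∈ diffOps f (φ ⁻¹ᵁ V₀) := fun α =>
    (hb.proj_mem_coefOps lv nab α).choose
  have hR' : ∀ α (b : Γ(X, φ ⁻¹ᵁ V)), ∀ e ∈ nab.killed (p ^ i) (φ ⁻¹ᵁ V),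
      nab.nabla _ (diffOps.res f (preimage_le h) ⟨_, hR α⟩) (b • e) =
        hb.proj Finset.univ α ⟨φ ⁻¹ᵁ V, preimage_le h⟩ b • e := fun α b e he =>
    (hb.proj_mem_coefOps lv nab α).choose_spec _ (preimage_le h) b e he
  have hcoef : ∀ (α β : Fin d → Fin (p ^ i)), hb.proj Finset.univ α ⟨φ ⁻¹ᵁ V, preimage_le h⟩
      (resO (preimage_le h) (mono x β)) = if β = α then 1 else 0 := fun α β => by
    have := hb.proj_univ_apply α β h 1
    rwa [map_one, mul_one] at this
  constructor
  · intro m m' hmm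
    -- On a combination of killed sections, the operator `R_α` extracts the coefficient of `x^α`.
    have key : ∀ (m : (Fin d → Fin (p ^ i)) → Γ(lv.killedM nab, V)) α,
        nab.nabla _ (diffOps.res f (preimage_le h) ⟨_, hR α⟩)
          (∑ β, resO (preimage_le h) (mono x β) • onSections (lv.killedHom nab) V (m β)) =
        onSections (lv.killedHom nab) V (m α) := by
      intro m α
      rw [map_sum]
      refine (Finset.sum_eq_single α (fun β _ hβ => ?_) (by simp)).trans ?_
      · rw [hR' _ _ _ (lv.killedHom_mem nab _), hcoef, if_neg hβ, zero_smul]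
      · rw [hR' _ _ _ (lv.killedHom_mem nab _), hcoef, if_pos rfl, one_smul]
    funext α
    exact lv.killedHom_injective nab V ((key m α).symm.trans ((congrArg _ hmm).trans (key m' α)))
  · intro e
    have hmem : ∀ α, nab.nabla _ (diffOps.res f (preimage_le h) ⟨_, hR α⟩) e ∈
        nab.killed (p ^ i) (φ ⁻¹ᵁ V) := by
      intro α W hW D ⟨m, hm, hD⟩ h1
      rw [nab.nabla_res]
      change (nab.nabla W D * nab.nabla W (diffOps.res f hW (diffOps.res f (preimage_le h)
        ⟨_, hR α⟩))) (resM E hW e) = 0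
      -- The values of `R_α` on functions come from `Y`. As `D` is linear over `Y` and kills `1`, it
      -- kills all of them.
      have hzero : D * diffOps.res f hW (diffOps.res f (preimage_le h) ⟨_, hR α⟩) = 0 := by
        obtain ⟨V', rfl⟩ := exists_preimage_eq lv.homeo W
        have hlin := lv.linear D.2.1 hD hm
        refine Subtype.ext (funext fun W' => ?_)
        obtain ⟨W', hW'⟩ := W'
        obtain ⟨V'', rfl⟩ := exists_preimage_eq lv.homeo W'
        ext a
        have hV'' : V'' ≤ V₀ := le_of_preimage_le lv.homeo (hW'.trans (hW.trans (preimage_le h)))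
        change D.1 ⟨_, hW'⟩ (hb.proj Finset.univ α ⟨φ ⁻¹ᵁ V'', preimage_le hV''⟩ a) = 0
        have h2 := apply_app_mul hlin hW' (hb.basis.coef hV'' a α) 1
        rw [mul_one, OpFamily.IsNatural.apply_one_eq_zero D.2.1.1 h1 hW', mul_zero] at h2
        rw [hb.proj_univ_eq_coef]
        exact h2
      rw [← map_mul, hzero, map_zero]
      rfl
    choose m hm using fun α => lv.exists_killedHom_eq nab (hmem α)
    refine ⟨m, ?_⟩
    simp only [hm]
    -- The expansion of functions in the monomial basis is the operator identity `∑ x^α R_α = 1`;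
    -- its image under `∇` is the expansion of `e`.
    have hone : (∑ α, diffOps.scalar f (resO (preimage_le h) (mono x α)) *
        diffOps.res f (preimage_le h) ⟨_, hR α⟩) = (1 : diffOps f (φ ⁻¹ᵁ V)) := by
      refine Subtype.ext ?_
      rw [AddSubmonoidClass.coe_finsetSum]
      funext W
      obtain ⟨W, hW⟩ := W
      obtain ⟨V', rfl⟩ := exists_preimage_eq lv.homeo W
      have hV' : V' ≤ V := le_of_preimage_le lv.homeo hW
      ext a
      rw [Finset.sum_apply, endSum_apply]
      refine Eq.trans (Finset.sum_congr rfl fun α _ => ?_) (hb.basis.sum_coef (hV'.trans h) a)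
      change resO hW (resO (preimage_le h) (mono x α)) *
        hb.proj Finset.univ α ⟨φ ⁻¹ᵁ V', preimage_le (hV'.trans h)⟩ a = _
      rw [resO_resO, hb.proj_univ_eq_coef]
    have h1 := congr(nab.nabla _ $hone e)
    rw [map_sum, map_one, endSum_apply] at h1
    refine Eq.trans (Finset.sum_congr rfl fun α _ => ?_) h1
    rw [map_mul]
    exact (nab.nabla_scalar _ _).symm

theorem isQuasicoherent_killedM [E.IsQuasicoherent] : (lv.killedM nab).IsQuasicoherent := by
  classical
  refine isQuasicoherent_of_isLocalizingOn _ fun y => ?_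
  obtain ⟨V₀, hy, hV₀, hU, d, x, z, hb⟩ := lv.chart y
  exact ⟨V₀, hy, hV₀, (lv.modBasis_killedHom nab hb).isLocalizingOn 0 (mono_zero x)
    (IsAffineOpen.isLocalizingOn hU E)⟩

end IsLevel

end Level

end KatzGieseker

end



noncomputable section

namespace KatzGieseker

/-! ### Actions of operators on sheaves of modules -/

section Act

variable {X Y : Scheme.{u}}

/-- Families of additive endomorphisms of the sections of a sheaf of modules. -/
abbrev EndFam (N : X.Modules) (U : X.Opens) : Type u :=
  ∀ W : {W : X.Opens // W ≤ U}, AddMonoid.End Γ(N, W.1)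

/-- Multiplication by a function. -/
def EndFam.scalar (N : X.Modules) {U : X.Opens} (a : Γ(X, U)) : EndFam N U :=
  fun W => smulEnd N (resO W.2 a)

/-- The family `L` is compatible with restriction, and acts on multiples of sections in `P` through
the action of `D` on the coefficient. -/
structure IsAct {N : X.Modules} (P : ∀ W : X.Opens, Set Γ(N, W)) {U : X.Opens}
    (D : OpFamily X U) (L : EndFam N U) : Prop where
  natural (V W : {V : X.Opens // V ≤ U}) (h : W.1 ≤ V.1) (e : Γ(N, V.1)) :
    resM N h (L V e) = L W (resM N h e)
  smul (W : {W : X.Opens // W ≤ U}) (a : Γ(X, W.1)) (e : Γ(N, W.1)) (he : e ∈ P W.1) :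
    L W (a • e) = D W a • e

/-- Actions are determined by the operator. -/
def ActUnique {N : X.Modules} (P : ∀ W : X.Opens, Set Γ(N, W)) : Prop :=
  ∀ (U : X.Opens) (D : OpFamily X U) (L L' : EndFam N U), IsAct P D L → IsAct P D L' → L = L'

namespace IsAct

variable {N : X.Modules} {P : ∀ W : X.Opens, Set Γ(N, W)} {U : X.Opens} {D D' : OpFamily X U}
  {L L' : EndFam N U}

theorem add (h : IsAct P D L) (h' : IsAct P D' L') : IsAct P (D + D') (L + L') where
  natural V W hW e := by
    change resM N hW (L V e + L' V e) = L W _ + L' W _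
    rw [map_add, h.natural V W hW, h'.natural V W hW]
  smul W a e he := by
    change L W _ + L' W _ = (D W a + D' W a) • e
    rw [h.smul W a e he, h'.smul W a e he, add_smul]

theorem neg (h : IsAct P D L) : IsAct P (-D) (-L) where
  natural V W hW e := by
    change resM N hW (-L V e) = -L W _
    rw [map_neg, h.natural V W hW]
  smul W a e he := by
    change -L W _ = (-D W a) • e
    rw [h.smul W a e he, neg_smul]

theorem sub (h : IsAct P D L) (h' : IsAct P D' L') : IsAct P (D - D') (L - L') := by
  rw [sub_eq_add_neg, sub_eq_add_neg]
  exact h.add h'.neg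

theorem mul (h : IsAct P D L) (h' : IsAct P D' L') : IsAct P (D * D') (L * L') where
  natural V W hW e := by
    change resM N hW (L V (L' V e)) = L W (L' W _)
    rw [h.natural V W hW, h'.natural V W hW]
  smul W a e he := by
    change L W (L' W _) = D W (D' W a) • e
    rw [h'.smul W a e he, h.smul W _ e he]

theorem one : IsAct P (1 : OpFamily X U) (1 : EndFam N U) where
  natural _ _ _ _ := rfl
  smul _ _ _ _ := rfl

theorem zero : IsAct P (0 : OpFamily X U) (0 : EndFam N U) where
  natural _ _ _ _ := map_zero _
  smul _ _ _ _ := (zero_smul _ _).symm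

theorem pow (h : IsAct P D L) (n : ℕ) : IsAct P (D ^ n) (L ^ n) := by
  induction n with
  | zero =>
    rw [pow_zero, pow_zero]
    exact one
  | succ n ih =>
    rw [pow_succ, pow_succ]
    exact ih.mul h

theorem scalar (a : Γ(X, U)) : IsAct P (scalarOp a) (EndFam.scalar N a) where
  natural V W hW e := by
    change resM N hW (resO V.2 a • e) = resO W.2 a • resM N hW e
    rw [resM_smul, resO_resO]
  smul W b e he := (mul_smul _ _ _).symm

theorem res (h : IsAct P D L) {V : X.Opens} (hV : V ≤ U) :
    IsAct P (D.res hV) (fun W => L ⟨W.1, W.2.trans hV⟩) where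
  natural A B hAB e := h.natural ⟨A.1, A.2.trans hV⟩ ⟨B.1, B.2.trans hV⟩ hAB e
  smul A a e he := h.smul ⟨A.1, A.2.trans hV⟩ a e he

theorem mono {P' : ∀ W : X.Opens, Set Γ(N, W)} (hP : ∀ W, P' W ⊆ P W) (h : IsAct P D L) :
    IsAct P' D L where
  natural := h.natural
  smul W a e he := h.smul W a e (hP W.1 he)

end IsAct

/-- The sections of `N` that come from `M`. -/
def rangeSet {φ : X ⟶ Y} {N : X.Modules} {M : Y.Modules}
    (j : M ⟶ (Scheme.Modules.pushforward φ).obj N) (W : X.Opens) : Set Γ(N, W) :=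
  {e | ∃ (V : Y.Opens) (h : φ ⁻¹ᵁ V = W) (m : Γ(M, V)), e = resM N h.ge (onSections j V m)}

variable {φ : X ⟶ Y} {N : X.Modules} {M : Y.Modules}
    {j : M ⟶ (Scheme.Modules.pushforward φ).obj N}

theorem onSections_mem_rangeSet {V : Y.Opens} (m : Γ(M, V)) :
    onSections j V m ∈ rangeSet j (φ ⁻¹ᵁ V) :=
  ⟨V, rfl, m, (resM_self _ _ _).symm⟩

theorem IsLocallyTensor.actUnique (hφ : IsHomeomorph φ) (hj : IsLocallyTensor φ j) :
    ActUnique (rangeSet j) := fun _ _ L L' h h' =>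
  hj.modFam_ext (N' := N) (L := L) (L' := L') hφ h.natural h'.natural fun _ hV a m =>
    (h.smul ⟨_, hV⟩ a _ (onSections_mem_rangeSet m)).trans
      (h'.smul ⟨_, hV⟩ a _ (onSections_mem_rangeSet m)).symm

/-- The action is `D ⊗ 1`, which is well defined on the tensor product because `D` is linear over
`Y`. -/
theorem IsLocallyTensor.exists_isAct (hφ : IsHomeomorph φ) (hj : IsLocallyTensor φ j)
    {U : X.Opens} {D : OpFamily X U} (hD : D ∈ endSections φ U) :
    ∃ L : EndFam N U, IsAct (rangeSet j) D L := by
  obtain ⟨L, hL, hL'⟩ := hj.exists_extension hφ (N' := N) (U := U)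
    { map := fun V h => AddMonoidHom.mk' (fun a => AddMonoidHom.mk' (fun m =>
        D ⟨φ ⁻¹ᵁ V, h⟩ a • onSections j V m) fun m m' => by rw [map_add, smul_add])
          fun a a' => by
            ext m
            change D ⟨φ ⁻¹ᵁ V, h⟩ (a + a') • onSections j V m =
              D ⟨φ ⁻¹ᵁ V, h⟩ a • onSections j V m + D ⟨φ ⁻¹ᵁ V, h⟩ a' • onSections j V m
            rw [map_add, add_smul]
      map_res := fun {V V'} h h' a m => by
        change resM N (preimage_le h') (D ⟨φ ⁻¹ᵁ V, h⟩ a • onSections j V m) =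
          D ⟨φ ⁻¹ᵁ V', (preimage_le h').trans h⟩ (resO (preimage_le h') a) •
            onSections j V' (resM M h' m)
        rw [resM_smul, resM_onSections j h', hD.1 ⟨φ ⁻¹ᵁ V, h⟩
          ⟨φ ⁻¹ᵁ V', (preimage_le h').trans h⟩ (preimage_le h')]
      balanced := fun {V} h c a m => by
        change D ⟨φ ⁻¹ᵁ V, h⟩ (a * (φ.app V).hom c) • onSections j V m =
          D ⟨φ ⁻¹ᵁ V, h⟩ a • onSections j V (c • m)
        rw [mul_comm, apply_app_mul hD, onSections_smul, smul_smul, mul_comm] }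
  refine ⟨L, hL, ?_⟩
  rintro ⟨W, hW⟩ a e ⟨V, hVW, m, rfl⟩
  change φ ⁻¹ᵁ V = W at hVW
  subst hVW
  rw [resM_self]
  exact hL' V hW a m

/-- The action of an operator, if there is one. -/
def actOf {N : X.Modules} (P : ∀ W : X.Opens, Set Γ(N, W)) {U : X.Opens} (D : OpFamily X U) :
    EndFam N U :=
  open Classical in if h : ∃ L, IsAct P D L then h.choose else 0

theorem isAct_actOf {N : X.Modules} {P : ∀ W : X.Opens, Set Γ(N, W)} {U : X.Opens}
    {D : OpFamily X U} (h : ∃ L, IsAct P D L) : IsAct P D (actOf P D) := by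
  rw [actOf, dif_pos h]
  exact h.choose_spec

end Act

/-! ### The connection -/

section Connection

variable {X S : Scheme.{u}} {g : X ⟶ S} {N : X.Modules} {P : ∀ W : X.Opens, Set Γ(N, W)}

/-- The connection for which the sections in `P` are horizontal. -/
def connectionOf (hP : ActUnique P)
    (hex : ∀ (U : X.Opens) (D : derivations g U), ∃ L, IsAct P D.1 L) : Connection g N where
  nabla U := AddMonoidHom.mk' (fun D => actOf P D.1 ⟨U, le_rfl⟩) fun D D' =>
    congr_fun (hP U _ _ _ (isAct_actOf (hex U (D + D')))
      ((isAct_actOf (hex U D)).add (isAct_actOf (hex U D')))) ⟨U, le_rfl⟩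
  nabla_res {U V} h D m := by
    have h1 := isAct_actOf (hex U D)
    have h2 := hP V _ _ _ (h1.res h) (isAct_actOf (hex V (derivations.res g h D)))
    exact (h1.natural ⟨U, le_rfl⟩ ⟨V, h⟩ h m).trans congr($h2 ⟨V, le_rfl⟩ _)
  nabla_smul {U} c D m := by
    have h1 := hP U _ _ _ (isAct_actOf (hex U (derivations.smul g c D)))
      ((IsAct.scalar c).mul (isAct_actOf (hex U D)))
    refine congr($h1 ⟨U, le_rfl⟩ m).trans ?_
    change resO le_rfl c • actOf P D.1 ⟨U, le_rfl⟩ m = _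
    rw [resO_self]
    rfl
  leibniz {U} D a m := by
    -- The Leibniz rule is the operator identity `D ∘ a = a ∘ D + D(a)`, transported to `N` by
    -- uniqueness of actions.
    have h0 : D.1 * scalarOp a = scalarOp a * D.1 + scalarOp (D.1 ⟨U, le_rfl⟩ a) := by
      funext W
      ext b
      change D.1 W (resO W.2 a * b) = resO W.2 a * D.1 W b + resO W.2 (D.1 ⟨U, le_rfl⟩ a) * b
      rw [D.2.2, D.2.1.1 ⟨U, le_rfl⟩ W W.2]
    have h1 := isAct_actOf (hex U D)
    have h2 := h1.mul (IsAct.scalar (N := N) a)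
    rw [h0] at h2
    have h3 := hP U _ _ _ h2 (((IsAct.scalar a).mul h1).add (IsAct.scalar (D.1 ⟨U, le_rfl⟩ a)))
    have h4 := congr($h3 ⟨U, le_rfl⟩ m)
    change actOf P D.1 ⟨U, le_rfl⟩ (resO le_rfl a • m) =
      resO le_rfl a • actOf P D.1 ⟨U, le_rfl⟩ m + resO le_rfl (D.1 ⟨U, le_rfl⟩ a) • m at h4
    rwa [resO_self, resO_self] at h4

variable (hP : ActUnique P) (hex : ∀ (U : X.Opens) (D : derivations g U), ∃ L, IsAct P D.1 L)

/-- Both sides are actions of the same operator, and the operator determines its action. -/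
theorem connectionOf_integrable : (connectionOf hP hex).IsIntegrable := by
  intro U D D' B hB
  have h1 := isAct_actOf (hex U B)
  have h2 := isAct_actOf (hex U D)
  have h3 := isAct_actOf (hex U D')
  have h4 := (h2.mul h3).sub (h3.mul h2)
  rw [← hB] at h4
  exact congr_fun (hP U _ _ _ h1 h4) ⟨U, le_rfl⟩

/-- The `p`-th power of the action of `D` is an action of `D ^ p`, so uniqueness applies again. -/
theorem connectionOf_pCurvatureZero (p : ℕ) : (connectionOf hP hex).PCurvatureZero p := by
  intro U D B hB
  have h2 := (isAct_actOf (hex U D)).pow p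
  rw [← hB] at h2
  exact congr_fun (hP U _ _ _ (isAct_actOf (hex U B)) h2) ⟨U, le_rfl⟩

theorem connectionOf_smul {U : X.Opens} (D : derivations g U) (a : Γ(X, U)) {e : Γ(N, U)}
    (he : e ∈ P U) : (connectionOf hP hex).nabla U D (a • e) = D.1 ⟨U, le_rfl⟩ a • e :=
  (isAct_actOf (hex U D)).smul ⟨U, le_rfl⟩ a e he

end Connection

end KatzGieseker

end



noncomputable section

namespace KatzGieseker

/-! ### Two consecutive levels -/

section Step

variable {X Y Z S : Scheme.{u}}

/-- The properties of `φ : X ⟶ X^{(i)}` and `ψ : X^{(i)} ⟶ X^{(i+1)}` used below. -/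
structure IsStep (φ : X ⟶ Y) (ψ : Y ⟶ Z) (g : Y ⟶ S) (g' : Z ⟶ S) (p i : ℕ) : Prop where
  homeo : IsHomeomorph ψ
  comp : ψ ≫ g' = g
  char (V : Y.Opens) : (p : Γ(Y, V)) = 0
  chart (z : Z) : ∃ V₀ : Z.Opens, z ∈ V₀ ∧ ∃ (d : ℕ) (x : Fin d → Γ(X, φ ⁻¹ᵁ ψ ⁻¹ᵁ V₀))
    (y : Fin d → Γ(Y, ψ ⁻¹ᵁ V₀)) (w : Fin d → Γ(Z, V₀)), MonoBasis φ (ψ ⁻¹ᵁ V₀) (p ^ i) x y ∧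
      MonoBasis ψ V₀ p y w ∧ MonoBasis (φ ≫ ψ) V₀ (p ^ (i + 1)) x w

theorem mono_digits {R R' : Type*} [CommRing R] [CommRing R'] (ρ : R' →+* R) {p i d : ℕ}
    {x : Fin d → R} {y : Fin d → R'} (h : ∀ j, ρ (y j) = x j ^ p ^ i)
    (α : Fin d → Fin (p ^ (i + 1))) :
    mono x α = mono x (digitsEquiv p d i α).1 * ρ (mono y (digitsEquiv p d i α).2) := by
  rw [map_mono]
  simp only [mono, h]
  rw [← Finset.prod_mul_distrib]
  refine Finset.prod_congr rfl fun j _ => ?_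
  rw [digitsEquiv_apply p d i α j, pow_add, pow_mul]

theorem LocalBasis.app_injective {φ : X ⟶ Y} {V₀ : Y.Opens} {I : Type} [Fintype I] [DecidableEq I]
    {b : I → Γ(X, φ ⁻¹ᵁ V₀)} (hb : LocalBasis φ V₀ b) (i₀ : I) (hi₀ : b i₀ = 1) {V : Y.Opens}
    (h : V ≤ V₀) : Function.Injective (φ.app V).hom := by
  have h1 : ∀ c : Γ(Y, V), hb.coef h ((φ.app V).hom c) i₀ = c := fun c => by
    have h2 := hb.coef_mul h (resO (preimage_le h) (b i₀)) c i₀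
    rwa [hb.coef_basis, Pi.single_eq_same, hi₀, map_one, one_mul, one_mul] at h2
  intro c c' hcc
  rw [← h1 c, ← h1 c', hcc]

namespace IsStep

variable {f : X ⟶ S} {φ : X ⟶ Y} {ψ : Y ⟶ Z} {g : Y ⟶ S} {g' : Z ⟶ S} {p i : ℕ}
  [hp : Fact p.Prime] (st : IsStep φ ψ g g' p i) (lv : IsLevel f φ g p i)
  (lv' : IsLevel f (φ ≫ ψ) g' p (i + 1))

include lv lv' in
/-- Derivations of `X^{(i)}` are linear over `X^{(i+1)}`. -/
theorem derivation_mem {U : Y.Opens} (δ : derivations g U) : δ.1 ∈ endSections ψ U := by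
  classical
  refine ⟨δ.2.1.1, ?_⟩
  rintro ⟨W, hW⟩ T hT c a
  refine sectionO_ext _ _ fun y hy => ?_
  obtain ⟨V₀, hyV₀, -, -, d, x, z, hb⟩ := lv.chart y
  let V := V₀ ⊓ W
  have hV₀ : V ≤ V₀ := inf_le_left
  have hVW : V ≤ W := inf_le_right
  refine ⟨V, hVW, ⟨hyV₀, hy⟩, ?_⟩
  have hb' := hb.restrict hV₀
  let δ' := derivations.res g (hVW.trans hW) δ
  -- A local lift of `δ` to `X` has order at most `p^i < p^{i+1}`, hence is linear over `X^{(i+1)}`.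
  -- Linearity of `δ` follows, since functions on `X^{(i)}` inject into functions on `X`.
  have hD := lv'.linear (hb'.lift_mem lv.comp δ'.2.1) (hb'.lift_order hp.out lv.char rfl δ')
    (Nat.pow_lt_pow_right hp.out.one_lt (Nat.lt_succ_self i))
  refine hb'.basis.app_injective 0 (mono_zero _) le_rfl ?_
  rw [δ.2.1.1 ⟨W, hW⟩ ⟨V, hVW.trans hW⟩ hVW, map_mul (resO hVW), map_mul (resO hVW),
    δ.2.1.1 ⟨W, hW⟩ ⟨V, hVW.trans hW⟩ hVW, map_mul (φ.app V).hom]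
  have h1 : ∀ r : Γ(Y, V), (φ.app V).hom (δ.1 ⟨V, hVW.trans hW⟩ r) =
      hb'.lift δ'.1 ⟨φ ⁻¹ᵁ V, le_rfl⟩ ((φ.app V).hom r) := fun r =>
    (hb'.lift_apply_app δ'.2.1.1 le_rfl r).symm
  have h2 : (φ.app V).hom (resO hVW ((ψ.appLE T W hT).hom c)) =
      ((φ ≫ ψ).appLE T (φ ⁻¹ᵁ V) (preimage_le (hVW.trans hT))).hom c := by
    have e1 : resO hVW ((ψ.appLE T W hT).hom c) = (ψ.appLE T V (hVW.trans hT)).hom c :=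
      congr($(Scheme.Hom.appLE_map ψ hT (homOfLE hVW).op).hom c)
    rw [e1, ← Scheme.Hom.appLE_comp_appLE φ ψ T V (φ ⁻¹ᵁ V) (hVW.trans hT) le_rfl,
      Scheme.Hom.appLE_eq_app]
    rfl
  rw [h1, h1, map_mul (φ.app V).hom, h2]
  exact hD.2 ⟨φ ⁻¹ᵁ V, le_rfl⟩ T (preimage_le (hVW.trans hT)) c _

variable {E : X.Modules} (nab : Stratification f E)

theorem exists_stepHom : ∃ j : lv'.killedM nab ⟶ (Scheme.Modules.pushforward ψ).obj (lv.killedM nab),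
    compOn (lv.killedHom nab) j = lv'.killedHom nab := by
  have hex : ∀ (V : Z.Opens) (m : Γ(lv'.killedM nab, V)), ∃ m' : Γ(lv.killedM nab, ψ ⁻¹ᵁ V),
      onSections (lv.killedHom nab) (ψ ⁻¹ᵁ V) m' = onSections (lv'.killedHom nab) V m :=
    fun V m => lv.exists_killedHom_eq nab (nab.killed_mono
      (Nat.pow_le_pow_right hp.out.pos (Nat.le_succ i)) _ (lv'.killedHom_mem nab m))
  choose G hG using hex
  have hinj := fun V : Z.Opens => lv.killedHom_injective nab (ψ ⁻¹ᵁ V)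
  obtain ⟨j, hj⟩ := exists_hom_of_sections (N := lv'.killedM nab)
    (N' := (Scheme.Modules.pushforward ψ).obj (lv.killedM nab))
    (fun V => AddMonoidHom.mk' (G V) fun m m' => hinj V (by
      refine (hG V _).trans (Eq.trans ?_ (map_add (onSections (lv.killedHom nab) _) _ _).symm)
      rw [hG, hG, map_add]
      rfl))
    (fun V W h m => hinj W (by
      refine (resM_onSections (lv.killedHom nab) (preimage_le h)
        (preimage_le (preimage_le h)) (G V m)).symm.trans ?_
      change _ = onSections (lv.killedHom nab) (ψ ⁻¹ᵁ W) (G W (resM (lv'.killedM nab) h m))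
      rw [hG, hG]
      exact resM_onSections (lv'.killedHom nab) h (preimage_le h) m))
    (fun W a m => hinj W (by
      refine (hG W _).trans (Eq.trans ?_
        (onSections_smul (lv.killedHom nab) ((ψ.app W).hom a) (G W m)).symm)
      rw [hG, onSections_smul, Scheme.Hom.comp_app]
      rfl))
  refine ⟨j, ?_⟩
  ext V m
  refine Eq.trans ?_ (hG V m)
  exact congrArg (onSections (lv.killedHom nab) (ψ ⁻¹ᵁ V)) (hj V m)

/-- The inclusion of the sections killed at the next level. -/
def stepHom : lv'.killedM nab ⟶ (Scheme.Modules.pushforward ψ).obj (lv.killedM nab) :=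
  (exists_stepHom lv lv' nab).choose

theorem compOn_stepHom : compOn (lv.killedHom nab) (stepHom lv lv' nab) = lv'.killedHom nab :=
  (exists_stepHom lv lv' nab).choose_spec

theorem onSections_stepHom {V : Z.Opens} (m : Γ(lv'.killedM nab, V)) :
    onSections (lv.killedHom nab) (ψ ⁻¹ᵁ V) (onSections (stepHom lv lv' nab) V m) =
      onSections (lv'.killedHom nab) V m :=
  congr(onSections $(compOn_stepHom lv lv' nab) V m)

theorem stepHom_mem {V : Z.Opens} (m : Γ(lv'.killedM nab, V)) :
    onSections (lv.killedHom nab) (ψ ⁻¹ᵁ V) (onSections (stepHom lv lv' nab) V m) ∈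
      nab.killed (p ^ (i + 1)) (φ ⁻¹ᵁ ψ ⁻¹ᵁ V) :=
  (onSections_stepHom lv lv' nab m).symm ▸ lv'.killedHom_mem nab m

/-- In base `p`, a monomial with exponents below `p^{i+1}` is one with exponents below `p^i` times
one in the coordinates of `X^{(i)}` with exponents below `p`. Cancelling the basis of `E` over
`E^{(i)}` leaves the latter. -/
theorem modBasis_stepHom {V₀ : Z.Opens} {d : ℕ} {x : Fin d → Γ(X, φ ⁻¹ᵁ ψ ⁻¹ᵁ V₀)}
    {y : Fin d → Γ(Y, ψ ⁻¹ᵁ V₀)} {w : Fin d → Γ(Z, V₀)}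
    (hx : MonoBasis φ (ψ ⁻¹ᵁ V₀) (p ^ i) x y)
    (hx' : MonoBasis (φ ≫ ψ) V₀ (p ^ (i + 1)) x w) :
    ModBasis ψ (stepHom lv lv' nab) V₀ (mono (q := p) y) := by
  classical
  refine ModBasis.of_comp (le_refl (ψ ⁻¹ᵁ V₀)) 0 (mono_zero (q := p ^ i) x)
    (lv.modBasis_killedHom nab hx) ?_
  rw [compOn_stepHom]
  have h1 := (lv'.modBasis_killedHom nab hx').reindex (digitsEquiv p d i).symm
  refine (congrArg (ModBasis (φ ≫ ψ) (lv'.killedHom nab) V₀) (funext fun α => ?_)).mpr h1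
  obtain ⟨β, rfl⟩ := (digitsEquiv p d i).surjective α
  rw [resO_self, Function.comp_apply, Equiv.symm_apply_apply]
  exact (mono_digits (φ.app (ψ ⁻¹ᵁ V₀)).hom hx.app_eq β).symm

include st in
theorem isLocallyTensor_stepHom : IsLocallyTensor ψ (stepHom lv lv' nab) := by
  intro z
  obtain ⟨V₀, hz, d, x, y, w, hx, hy, hx'⟩ := st.chart z
  exact ⟨V₀, _, inferInstance, mono (q := p) y, hz, hy.basis, modBasis_stepHom lv lv' nab hx hx'⟩

/-- The connection on the sheaf of killed sections. -/
def connection : Connection g (lv.killedM nab) :=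
  connectionOf ((st.isLocallyTensor_stepHom lv lv' nab).actUnique st.homeo)
    fun _ δ => (st.isLocallyTensor_stepHom lv lv' nab).exists_isAct st.homeo
      (derivation_mem lv lv' δ)

theorem connection_smul {V : Z.Opens} (δ : derivations g (ψ ⁻¹ᵁ V)) (a : Γ(Y, ψ ⁻¹ᵁ V))
    (m : Γ(lv'.killedM nab, V)) :
    (st.connection lv lv' nab).nabla _ δ (a • onSections (stepHom lv lv' nab) V m) =
      δ.1 ⟨_, le_rfl⟩ a • onSections (stepHom lv lv' nab) V m :=
  connectionOf_smul _ _ δ a (onSections_mem_rangeSet m)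

/-- Both sides are local and additive, so they may be compared on `a • m'` with `m'` in `E^{(i+1)}`.
Since `p^i < p^{i+1}`, the operator `P` acts there through the coefficient, where it agrees with
`δ`. -/
theorem induces_connection :
    nab.Induces (p ^ i) φ g (lv.killedHom nab) (st.connection lv lv' nab) := by
  intro V δ P hP hPδ m
  have hlt : p ^ i < p ^ (i + 1) := Nat.pow_lt_pow_right hp.out.one_lt (Nat.lt_succ_self i)
  have key := (st.isLocallyTensor_stepHom lv lv' nab).induction st.homeo (U := V)
    (fun W h e => onSections (lv.killedHom nab) W ((st.connection lv lv' nab).nabla W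
      (derivations.res g h δ) e) =
        nab.nabla _ (diffOps.res f (preimage_le h) P) (onSections (lv.killedHom nab) W e))
    ?_ ?_ ?_ V le_rfl m
  · exact key
  · intro W h e H
    refine sectionM_ext E _ _ fun x hx => ?_
    obtain ⟨W', h', hxW', H'⟩ := H (φ x) hx
    refine ⟨φ ⁻¹ᵁ W', preimage_le h', hxW', ?_⟩
    rw [resM_onSections _ h', (st.connection lv lv' nab).nabla_res h', nab.nabla_res,
      resM_onSections _ h']
    exact H'
  · intro W h e e' H H'
    rw [map_add, map_add, map_add, map_add, H, H']
  · intro V' h a m'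
    rw [connection_smul, onSections_smul, onSections_smul,
      nab.nabla_smul_of_mem_killed _ hlt (hP.res (preimage_le h)) _ (stepHom_mem lv lv' nab m')]
    exact congrArg (· • onSections (lv.killedHom nab) _ (onSections (stepHom lv lv' nab) V' m'))
      (hPδ _ h a).symm

/-- Locally, every derivation of `X^{(i)}` lifts to an operator of order at most `p^i`, and the lift
prescribes the value of an induced connection. -/
theorem connection_unique (c : Connection g (lv.killedM nab))
    (hc : nab.Induces (p ^ i) φ g (lv.killedHom nab) c) : c = st.connection lv lv' nab := by
  refine Connection.ext (funext fun U => ?_)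
  ext δ m
  refine sectionM_ext _ _ _ fun y hy => ?_
  obtain ⟨V₀, hyV₀, -, -, d, x, z, hb⟩ := lv.chart y
  let V := V₀ ⊓ U
  have hVU : V ≤ U := inf_le_right
  refine ⟨V, hVU, ⟨hyV₀, hy⟩, ?_⟩
  rw [c.nabla_res hVU, (st.connection lv lv' nab).nabla_res hVU]
  have hb' := hb.restrict (inf_le_left : V ≤ V₀)
  let δ' := derivations.res g hVU δ
  have hord := hb'.lift_order hp.out lv.char rfl δ'
  let D : diffOps f (φ ⁻¹ᵁ V) := ⟨hb'.lift δ'.1, hb'.lift_mem lv.comp δ'.2.1, fun x hx =>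
    ⟨_, le_rfl, hx, _, hord⟩⟩
  have hD : ∀ (W : Y.Opens) (h : W ≤ V) (r : Γ(Y, W)), D.1 ⟨φ ⁻¹ᵁ W, preimage_le h⟩
      ((φ.app W).hom r) = (φ.app W).hom (δ'.1 ⟨W, h⟩ r) := fun W h r =>
    hb'.lift_apply_app δ'.2.1.1 h r
  refine lv.killedHom_injective nab V ?_
  rw [hc V δ' D hord hD, st.induces_connection lv lv' nab V δ' D hord hD]

theorem range_stepHom_subset (V : Z.Opens) : Set.range (onSections (stepHom lv lv' nab) V) ⊆
    (st.connection lv lv' nab).ker (ψ ⁻¹ᵁ V) := by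
  rintro _ ⟨m, rfl⟩ W hW δ
  obtain ⟨V', rfl⟩ := exists_preimage_eq st.homeo W
  have h := le_of_preimage_le st.homeo hW
  rw [resM_onSections _ h]
  have h1 := st.connection_smul lv lv' nab δ 1 (resM _ h m)
  have h2 : δ.1 ⟨_, le_rfl⟩ 1 = 0 := by
    have := δ.2.2 ⟨_, le_rfl⟩ 1 1
    rw [mul_one, one_mul, mul_one] at this
    exact left_eq_add.1 this
  rwa [one_smul, h2, zero_smul] at h1

/-- The partial derivatives as derivations of `X^{(i)}`. -/
def partialDer {V₀ : Z.Opens} {d : ℕ} {y : Fin d → Γ(Y, ψ ⁻¹ᵁ V₀)} {w : Fin d → Γ(Z, V₀)}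
    (hy : MonoBasis ψ V₀ p y w) (k : Fin d) : derivations g (ψ ⁻¹ᵁ V₀) :=
  ⟨hy.partialOp k, endSections_le_of_comp st.comp _ (hy.partialOp_mem k),
    hy.partialOp_leibniz st.char k⟩

omit hp in
theorem eq_zero_of_natCast_smul (hp : p.Prime) (st : IsStep φ ψ g g' p i) {M : Y.Modules}
    {V : Y.Opens} {m : Γ(M, V)} {n : ℕ} (h0 : n ≠ 0) (hn : n < p) (h : (n : Γ(Y, V)) • m = 0) : m = 0 := by
  have hc : IsCoprime (n : ℤ) (p : ℤ) := by
    rw [Nat.isCoprime_iff_coprime]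
    exact (hp.coprime_iff_not_dvd.2 (Nat.not_dvd_of_pos_of_lt (Nat.pos_of_ne_zero h0) hn)).symm
  obtain ⟨a, b, hab⟩ := hc
  have h1 : (a : Γ(Y, V)) * n + b * p = 1 := by exact_mod_cast congrArg (Int.cast (R := Γ(Y, V))) hab
  rw [← one_smul Γ(Y, V) m, ← h1, st.char, mul_zero, add_zero, mul_smul, h, smul_zero]

/-- Expand a horizontal section locally as `∑ y^β n_β` with `n_β` in `E^{(i+1)}`. Applying `y_k ∂_k`
gives `β_k n_β = 0` by uniqueness of coordinates, so `n_β = 0` as soon as some `β_k ≠ 0`, and only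
the term at `β = 0` survives. -/
theorem range_stepHom (V : Z.Opens) : Set.range (onSections (stepHom lv lv' nab) V) =
    (st.connection lv lv' nab).ker (ψ ⁻¹ᵁ V) := by
  classical
  refine (st.range_stepHom_subset lv lv' nab V).antisymm fun m hm => ?_
  suffices h : onSections (lv.killedHom nab) (ψ ⁻¹ᵁ V) m ∈
      nab.killed (p ^ (i + 1)) ((φ ≫ ψ) ⁻¹ᵁ V) by
    obtain ⟨m', hm'⟩ := lv'.exists_killedHom_eq nab h
    refine ⟨m', lv.killedHom_injective nab _ ?_⟩
    rw [onSections_stepHom]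
    exact hm'
  refine nab.mem_killed_of_local fun x hx => ?_
  obtain ⟨V₀, hz, d, x, y, w, hx', hy, hxy⟩ := st.chart (ψ (φ x))
  let V' := V₀ ⊓ V
  have hV' : V' ≤ V := inf_le_right
  have hV₀ : V' ≤ V₀ := inf_le_left
  refine ⟨φ ⁻¹ᵁ ψ ⁻¹ᵁ V', preimage_le (preimage_le hV'), ⟨hz, hx⟩, ?_⟩
  have hmb := modBasis_stepHom lv lv' nab hx' hxy
  obtain ⟨n, hn⟩ := (hmb V' hV₀).2 (resM _ (preimage_le hV') m)
  have hzero : ∀ (β : Fin d → Fin p) (k : Fin d), β k ≠ 0 →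
      onSections (stepHom lv lv' nab) V' (n β) = 0 := by
    intro β k hβ
    -- The derivation `y_k ∂_k`, unlike `∂_k`, is diagonal in the monomials: `y^β` has eigenvalue
    -- `β_k`.
    let δ : derivations g (ψ ⁻¹ᵁ V') := derivations.res g (preimage_le hV₀)
      (derivations.smul g (y k) (st.partialDer hy k))
    have hδ : ∀ β : Fin d → Fin p, δ.1 ⟨_, le_rfl⟩ (resO (preimage_le hV₀) (mono y β)) =
        resO (preimage_le hV₀) (mono y β) * (ψ.app V').hom (((β k : ℕ) : Γ(Z, V'))) := by
      intro β
      have h1 := hy.partialOp_apply k β hV₀ 1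
      rw [map_one, mul_one, mul_one] at h1
      change resO (preimage_le hV₀) (y k) * hy.partialOp k ⟨ψ ⁻¹ᵁ V', preimage_le hV₀⟩ _ = _
      have h2 := congr(resO (preimage_le hV₀) $(natCast_mul_mono_pred y β k))
      simp only [map_mul, map_natCast] at h2
      rw [h1, map_natCast, mul_comm _ ((β k : ℕ) : Γ(Y, ψ ⁻¹ᵁ V')), ← h2]
      ring
    have h1 := hm (ψ ⁻¹ᵁ V') (preimage_le hV') δ
    rw [← hn, map_sum] at h1
    have h2 := (hmb V' hV₀).1 (a₁ := fun β => ((β k : ℕ) : Γ(Z, V')) • n β) (a₂ := 0) (by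
      refine Eq.trans (Finset.sum_congr rfl fun β _ => ?_) (h1.trans ?_)
      · rw [connection_smul, onSections_smul, smul_smul, hδ]
      · simp)
    have h3 := congr(onSections (stepHom lv lv' nab) V' $(congr_fun h2 β))
    rw [onSections_smul, Pi.zero_apply, map_zero, map_natCast] at h3
    exact eq_zero_of_natCast_smul hp.out st (fun h => hβ (Fin.ext h)) (β k).is_lt h3
  have hsum : resM _ (preimage_le hV') m = onSections (stepHom lv lv' nab) V' (n 0) := by
    rw [← hn]
    refine (Finset.sum_eq_single 0 (fun β _ hβ => ?_) (by simp)).trans ?_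
    · obtain ⟨k, hk⟩ := Function.ne_iff.1 hβ
      rw [hzero β k hk, smul_zero]
    · rw [mono_zero, map_one, one_smul]
  have h1 := resM_onSections (lv.killedHom nab) (preimage_le (φ := ψ) hV')
    (preimage_le (preimage_le hV')) m
  rw [hsum] at h1
  exact (congrArg (· ∈ nab.killed (p ^ (i + 1)) (φ ⁻¹ᵁ ψ ⁻¹ᵁ V')) h1).mpr
    (stepHom_mem lv lv' nab (n 0))

end IsStep

end Step

end KatzGieseker

end



noncomputable section

namespace KatzGieseker

/-! ### Stratifications from horizontal sections -/

section Construct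

variable {X S : Scheme.{u}} {f : X ⟶ S} {E : X.Modules} {P : ℕ → ∀ W : X.Opens, Set Γ(E, W)}

/-- A family that locally is an action with respect to one of the sets `P i`. -/
structure IsLocalAct (P : ℕ → ∀ W : X.Opens, Set Γ(E, W)) {U : X.Opens} (D : OpFamily X U)
    (L : EndFam E U) : Prop where
  natural (V W : {V : X.Opens // V ≤ U}) (h : W.1 ≤ V.1) (e : Γ(E, V.1)) :
    resM E h (L V e) = L W (resM E h e)
  exists_isAct (x : X) (hx : x ∈ U) : ∃ (V : X.Opens) (h : V ≤ U), x ∈ V ∧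
    ∃ i, IsAct (P i) (D.res h) (fun W => L ⟨W.1, W.2.trans h⟩)

variable (hmono : ∀ i W, P (i + 1) W ⊆ P i W)
include hmono

theorem IsAct.mono_of_le {U : X.Opens} {D : OpFamily X U} {L : EndFam E U} {i i' : ℕ}
    (h : i ≤ i') (hL : IsAct (P i) D L) : IsAct (P i') D L :=
  hL.mono fun W => antitone_nat_of_succ_le (f := fun i => P i W) (fun i => hmono i W) h

theorem IsLocalAct.exists_isAct₂ {U : X.Opens} {D D' : OpFamily X U} {L L' : EndFam E U}
    (hL : IsLocalAct P D L) (hL' : IsLocalAct P D' L') (x : X) (hx : x ∈ U) :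
    ∃ (V : X.Opens) (h : V ≤ U), x ∈ V ∧ ∃ i, IsAct (P i) (D.res h) (fun W => L ⟨W.1, W.2.trans h⟩) ∧
      IsAct (P i) (D'.res h) (fun W => L' ⟨W.1, W.2.trans h⟩) := by
  obtain ⟨V, h, hxV, i, hi⟩ := hL.exists_isAct x hx
  obtain ⟨V', h', hxV', i', hi'⟩ := hL'.exists_isAct x hx
  exact ⟨V ⊓ V', inf_le_left.trans h, ⟨hxV, hxV'⟩, max i i',
    (hi.res inf_le_left).mono_of_le hmono (le_max_left _ _),
    (hi'.res inf_le_right).mono_of_le hmono (le_max_right _ _)⟩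

theorem IsLocalAct.add {U : X.Opens} {D D' : OpFamily X U} {L L' : EndFam E U}
    (hL : IsLocalAct P D L) (hL' : IsLocalAct P D' L') : IsLocalAct P (D + D') (L + L') where
  natural V W h e := by
    change resM E h (L V e + L' V e) = L W _ + L' W _
    rw [map_add, hL.natural V W h, hL'.natural V W h]
  exists_isAct x hx := by
    obtain ⟨V, h, hxV, i, hi, hi'⟩ := hL.exists_isAct₂ hmono hL' x hx
    exact ⟨V, h, hxV, i, hi.add hi'⟩

theorem IsLocalAct.mul {U : X.Opens} {D D' : OpFamily X U} {L L' : EndFam E U}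
    (hL : IsLocalAct P D L) (hL' : IsLocalAct P D' L') : IsLocalAct P (D * D') (L * L') where
  natural V W h e := by
    change resM E h (L V (L' V e)) = L W (L' W _)
    rw [hL.natural V W h, hL'.natural V W h]
  exists_isAct x hx := by
    obtain ⟨V, h, hxV, i, hi, hi'⟩ := hL.exists_isAct₂ hmono hL' x hx
    exact ⟨V, h, hxV, i, hi.mul hi'⟩

omit hmono in
theorem IsAct.isLocalAct {U : X.Opens} {D : OpFamily X U} {L : EndFam E U} {i : ℕ}
    (h : IsAct (P i) D L) : IsLocalAct P D L where
  natural := h.natural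
  exists_isAct _ hx := ⟨U, le_rfl, hx, i, h⟩

omit hmono in
theorem IsLocalAct.res {U V : X.Opens} {D : OpFamily X U} {L : EndFam E U} (hL : IsLocalAct P D L)
    (hV : V ≤ U) : IsLocalAct P (D.res hV) (fun W => L ⟨W.1, W.2.trans hV⟩) where
  natural A B hAB e := hL.natural ⟨A.1, A.2.trans hV⟩ ⟨B.1, B.2.trans hV⟩ hAB e
  exists_isAct x hx := by
    obtain ⟨W, hW, hxW, i, hi⟩ := hL.exists_isAct x (hV hx)
    exact ⟨W ⊓ V, inf_le_right, ⟨hxW, hx⟩, i, hi.res inf_le_left⟩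

variable (huniq : ∀ i, ActUnique (P i))
include huniq

/-- Two families may be actions at different levels. Both are actions at the larger level, where
there are fewer horizontal sections but still enough to determine the action. -/
theorem IsLocalAct.unique {U : X.Opens} {D : OpFamily X U} {L L' : EndFam E U}
    (hL : IsLocalAct P D L) (hL' : IsLocalAct P D L') : L = L' := by
  funext W
  ext e
  refine sectionM_ext E _ _ fun x hx => ?_
  obtain ⟨V, h, hxV, i, hi, hi'⟩ := hL.exists_isAct₂ hmono hL' x (W.2 hx)
  refine ⟨V ⊓ W.1, inf_le_right, ⟨hxV, hx⟩, ?_⟩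
  have h1 := huniq i V _ _ _ hi hi'
  rw [hL.natural W ⟨V ⊓ W.1, inf_le_left.trans h⟩ inf_le_right,
    hL'.natural W ⟨V ⊓ W.1, inf_le_left.trans h⟩ inf_le_right]
  exact congr($h1 ⟨V ⊓ W.1, inf_le_left⟩ _)

variable {p : ℕ} (hp : 1 < p)
  (hex : ∀ (i : ℕ) (U : X.Opens) (D : OpFamily X U) (m : ℕ), D ∈ endSections f U →
    IsOrderLE m U D → m < p ^ i → ∃ L, IsAct (P i) D L)
include hp hex

theorem exists_isLocalAct {U : X.Opens} (D : diffOps f U) : ∃ L, IsLocalAct P D.1 L := by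
  have hloc : ∀ x ∈ U, ∃ (V : X.Opens) (h : V ≤ U), x ∈ V ∧
      ∃ L i, IsAct (P i) (D.1.res h) L := fun x hx => by
    obtain ⟨V, h, hxV, m, hm⟩ := D.2.2 x hx
    -- An operator of order at most `m` acts at level `m`, because `m < p^m`.
    obtain ⟨L', hact⟩ := hex m V _ m (res_mem_endSections f h D.2.1) hm (Nat.lt_pow_self hp)
    exact ⟨V, h, hxV, L', m, hact⟩
  obtain ⟨L, hL, hL'⟩ := ModFam.exists_glue (N := E) (N' := E) U
    (fun W h L => ∃ i, IsAct (P i) (D.1.res h) L)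
    (fun W W' h h' L ⟨i, hi⟩ => ⟨i, hi.res h'⟩)
    (fun W h L ⟨i, hi⟩ => hi.natural)
    (fun W h L L' ⟨i, hi⟩ ⟨i', hi'⟩ => huniq (max i i') W _ _ _
      (hi.mono_of_le hmono (le_max_left _ _)) (hi'.mono_of_le hmono (le_max_right _ _)))
    hloc
  refine ⟨L, hL, fun x hx => ?_⟩
  obtain ⟨V, h, hxV, L', i, hact⟩ := hloc x hx
  refine ⟨V, h, hxV, i, ?_⟩
  rw [← hL' V h L' ⟨i, hact⟩] at hact
  exact hact

/-- The stratification for which the sections in `P i` are killed by operators of order less than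
`p ^ i`. -/
def stratificationOf : Stratification f E :=
  have spec : ∀ {U : X.Opens} (D : diffOps f U),
      IsLocalAct P D.1 (exists_isLocalAct hmono huniq hp hex D).choose := fun D =>
    (exists_isLocalAct hmono huniq hp hex D).choose_spec
  { nabla := fun U =>
      { toFun := fun D => (exists_isLocalAct hmono huniq hp hex D).choose ⟨U, le_rfl⟩
        map_one' := congr_fun ((spec 1).unique hmono huniq
          (IsAct.isLocalAct (i := 0) IsAct.one)) ⟨U, le_rfl⟩
        map_zero' := congr_fun ((spec 0).unique hmono huniq
          (IsAct.isLocalAct (i := 0) IsAct.zero)) ⟨U, le_rfl⟩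
        map_mul' := fun D D' => congr_fun ((spec (D * D')).unique hmono huniq
          ((spec D).mul hmono (spec D'))) ⟨U, le_rfl⟩
        map_add' := fun D D' => congr_fun ((spec (D + D')).unique hmono huniq
          ((spec D).add hmono (spec D'))) ⟨U, le_rfl⟩ }
    nabla_res := fun {U V} h D e => by
      have h1 := ((spec D).res h).unique hmono huniq (spec (diffOps.res f h D))
      exact ((spec D).natural ⟨U, le_rfl⟩ ⟨V, h⟩ h e).trans congr($h1 ⟨V, le_rfl⟩ _)
    nabla_scalar := fun {U} a e => by
      have h1 := (spec (diffOps.scalar f a)).unique hmono huniq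
        (IsAct.isLocalAct (i := 0) (IsAct.scalar a))
      refine congr($h1 ⟨U, le_rfl⟩ e).trans ?_
      change resO le_rfl a • e = _
      rw [resO_self] }

theorem stratificationOf_smul {i : ℕ} {U : X.Opens} (D : diffOps f U) {m : ℕ}
    (hD : IsOrderLE m U D.1) (hm : m < p ^ i) (b : Γ(X, U)) {e : Γ(E, U)} (he : e ∈ P i U) :
    (stratificationOf hmono huniq hp hex).nabla U D (b • e) = D.1 ⟨U, le_rfl⟩ b • e := by
  obtain ⟨L, hL⟩ := hex i U D.1 m D.2.1 hD hm
  have h1 := (exists_isLocalAct hmono huniq hp hex D).choose_spec.unique hmono huniq hL.isLocalAct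
  exact congr($h1 ⟨U, le_rfl⟩ _).trans (hL.smul ⟨U, le_rfl⟩ b e he)

omit hex in
theorem stratification_unique {nab nab' : Stratification f E}
    (h : ∀ i U, P (i + 1) U ⊆ nab.killed (p ^ (i + 1)) U)
    (h' : ∀ i U, P (i + 1) U ⊆ nab'.killed (p ^ (i + 1)) U) : nab = nab' := by
  have key : ∀ nab : Stratification f E, (∀ i U, P (i + 1) U ⊆ nab.killed (p ^ (i + 1)) U) →
      ∀ (U : X.Opens) (D : diffOps f U),
        IsLocalAct P D.1 (fun W => nab.nabla W.1 (diffOps.res f W.2 D)) := by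
    intro nab h U D
    refine ⟨fun V W hVW e => nab.nabla_res hVW _ e, fun x hx => ?_⟩
    obtain ⟨V, hV, hxV, m, hm⟩ := D.2.2 x hx
    -- Level `m + 1` is used instead of `m` because the hypotheses concern positive levels only; `m
    -- < p^{m+1}` still holds.
    refine ⟨V, hV, hxV, m + 1, fun A B hAB e => nab.nabla_res hAB _ e, fun W a e he => ?_⟩
    exact nab.nabla_smul_of_mem_killed (diffOps.res f (W.2.trans hV) D)
      ((Nat.lt_succ_self m).trans (Nat.lt_pow_self hp)) (hm.res W.2) a (h m W.1 he)
  refine Stratification.ext (funext fun U => RingHom.ext fun D => ?_)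
  exact congr_fun ((key nab h U D).unique hmono huniq (key nab' h' U D)) ⟨U, le_rfl⟩

end Construct

/-! ### Identification of the killed sections -/

section Identify

variable {X Y S : Scheme.{u}} {f : X ⟶ S} {φ : X ⟶ Y} {g : Y ⟶ S} {p i : ℕ} [hp : Fact p.Prime]
  {E : X.Modules} {M : Y.Modules} {κ : M ⟶ (Scheme.Modules.pushforward φ).obj E}

/-- There are local coordinates whose monomials give bases along `κ`. -/
def HasCharts (κ : M ⟶ (Scheme.Modules.pushforward φ).obj E) (q : ℕ) : Prop :=
  ∀ y : Y, ∃ V₀ : Y.Opens, y ∈ V₀ ∧ ∃ (d : ℕ) (x : Fin d → Γ(X, φ ⁻¹ᵁ V₀)) (z : Fin d → Γ(Y, V₀)),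
    MonoBasis φ V₀ q x z ∧ ModBasis φ κ V₀ (mono (q := q) x)

theorem HasCharts.isLocallyTensor {q : ℕ} (h : HasCharts κ q) : IsLocallyTensor φ κ := fun y => by
  obtain ⟨V₀, hy, d, x, z, hb, hb'⟩ := h y
  exact ⟨V₀, _, inferInstance, _, hy, hb.basis, hb'⟩

theorem HasCharts.injective {q : ℕ} [NeZero q] (h : HasCharts κ q) (V : Y.Opens) :
    Function.Injective (onSections κ V) := by
  intro m m' hmm
  refine sectionM_ext M _ _ fun y hy => ?_
  obtain ⟨V₀, hyV₀, d, x, z, hb, hb'⟩ := h y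
  have hV : V₀ ⊓ V ≤ V := inf_le_right
  refine ⟨V₀ ⊓ V, hV, ⟨hyV₀, hy⟩, hb'.injective 0 (mono_zero x) inf_le_left ?_⟩
  rw [← resM_onSections κ hV (preimage_le hV), ← resM_onSections κ hV (preimage_le hV), hmm]

/-- Given `e` in `E^{(i)}`, expand it locally in monomials with coefficients from `M`. These
coefficients lie in `E^{(i)}`, so this is also the expansion of `e` over `E^{(i)}`, which has the
single term `1 · e`. Hence `e` is the coefficient at `1`, and the local preimages glue by
injectivity. -/
theorem HasCharts.identifies (hκ : HasCharts κ (p ^ i)) (lv : IsLevel f φ g p i)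
    (nab : Stratification f E)
    (hle : ∀ (V : Y.Opens) (m : Γ(M, V)), onSections κ V m ∈ nab.killed (p ^ i) (φ ⁻¹ᵁ V)) :
    Identifies φ (nab.killed (p ^ i)) κ := by
  classical
  refine fun V => ⟨hκ.injective V, Set.Subset.antisymm ?_ fun e he => ?_⟩
  · rintro _ ⟨m, rfl⟩
    exact hle V m
  · have hloc : ∀ y ∈ V, ∃ (W : Y.Opens) (h : W ≤ V), y ∈ W ∧
        ∃ m, onSections κ W m = resM E (preimage_le h) e := by
      intro y hy
      obtain ⟨V₀, hyV₀, d, x, z, hb, hb'⟩ := hκ y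
      have hV : V₀ ⊓ V ≤ V := inf_le_right
      have hV₀ : V₀ ⊓ V ≤ V₀ := inf_le_left
      obtain ⟨n, hn⟩ := (hb' (V₀ ⊓ V) hV₀).2 (resM E (preimage_le hV) e)
      refine ⟨V₀ ⊓ V, hV, ⟨hyV₀, hy⟩, n 0, ?_⟩
      obtain ⟨e', he'⟩ := lv.exists_killedHom_eq nab (nab.res_mem_killed (preimage_le hV) he)
      choose n' hn' using fun α => lv.exists_killedHom_eq nab (hle _ (n α))
      have h1 := (lv.modBasis_killedHom nab hb).eq_of_sum_eq 0 (mono_zero x) hV₀ n' e' (by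
        rw [he', ← hn]
        simp only [hn'])
      rw [← hn', h1, Pi.single_eq_same, he']
    obtain ⟨m, hm⟩ := exists_sectionM M V
      (fun W h m => onSections κ W m = resM E (preimage_le h) e)
      (fun W W' h h' m hm => by rw [← resM_onSections κ h' (preimage_le h'), hm, resM_resM])
      (fun W h m m' hm hm' => hκ.injective W (hm.trans hm'.symm)) hloc
    refine ⟨m, sectionM_ext E _ _ fun x hx => ?_⟩
    obtain ⟨W, h, hxW, hW⟩ := hm (φ x) hx
    exact ⟨φ ⁻¹ᵁ W, preimage_le h, hxW, (resM_onSections κ h (preimage_le h) m).trans hW⟩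

omit hp in
theorem onSections_mem_killed (hφ : IsHomeomorph φ) (nab : Stratification f E) {N : ℕ}
    (h : ∀ (U : X.Opens) (D : diffOps f U) (m : ℕ), IsOrderLE m U D.1 → m < N → ∀ (b : Γ(X, U)),
      ∀ e ∈ rangeSet κ U, nab.nabla U D (b • e) = D.1 ⟨U, le_rfl⟩ b • e)
    (V : Y.Opens) (m : Γ(M, V)) : onSections κ V m ∈ nab.killed N (φ ⁻¹ᵁ V) := by
  rintro W hW D ⟨n, hn, hD⟩ h1
  obtain ⟨V', rfl⟩ := exists_preimage_eq hφ W
  have hV' := le_of_preimage_le hφ hW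
  rw [resM_onSections κ hV' hW]
  have h2 := h _ D n hD hn 1 _ (onSections_mem_rangeSet (j := κ) (resM M hV' m))
  rwa [one_smul, h1, zero_smul] at h2

omit hp in
theorem Identifies.rangeSet_subset {P : ∀ U : X.Opens, AddSubgroup Γ(E, U)}
    (h : Identifies φ P κ) (U : X.Opens) : rangeSet κ U ⊆ P U := by
  rintro _ ⟨V, rfl, m, rfl⟩
  rw [resM_self, ← (h V).2]
  exact ⟨m, rfl⟩

end Identify

end KatzGieseker

end



noncomputable section

namespace KatzGieseker

/-! ### Frobenius twists of a smooth scheme -/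

section Concrete

variable {k : Type u} [Field k] (p : ℕ) [hp : Fact p.Prime] [CharP k p]
  {S X : Scheme.{u}} (s : S ⟶ Spec (.of k)) (f : X ⟶ S)

/-- The restrictions of the coordinates of `X` as functions on the preimage of a chart of
`X^{(i)}`. -/
abbrev iterCoord (i : ℕ) {U : X.Opens} {d : ℕ} (x : Fin d → Γ(X, U)) :
    Fin d → Γ(X, frobIter p s f i ⁻¹ᵁ twistProj p s f i ⁻¹ᵁ U) :=
  fun j => resO (frobIter_preimage_twistProj p s f i U).le (x j)

/-- The restrictions of the coordinates of `X^{(i)}` as functions on the preimage of a chart of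
`X^{(i+1)}`. -/
abbrev frobCoord (i : ℕ) {U : X.Opens} {d : ℕ} (x : Fin d → Γ(X, U)) :
    Fin d → Γ(twist p s f i, frob p s f i ⁻¹ᵁ twistProj p s f (i + 1) ⁻¹ᵁ U) :=
  fun j => resO (frob_preimage_twistProj p s f i U).le (coord p s f i x j)

theorem IsChart.monoBasis_frobIter {U : X.Opens} {d : ℕ} {x : Fin d → Γ(X, U)}
    (hx : IsChart f U x) (i : ℕ) : MonoBasis (frobIter p s f i) (twistProj p s f i ⁻¹ᵁ U) (p ^ i)
      (iterCoord p s f i x) (KatzGieseker.coord p s f i x) where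
  homeo := isHomeomorph_frobIter p s f i
  basis := hx.localBasis_frobIter p s f i
  app_eq j := frobIter_app_twistProj p s f i U _ (x j)

theorem IsChart.monoBasis_frob {U : X.Opens} {d : ℕ} {x : Fin d → Γ(X, U)}
    (hx : IsChart f U x) (i : ℕ) : MonoBasis (frob p s f i) (twistProj p s f (i + 1) ⁻¹ᵁ U) p
      (frobCoord p s f i x) (KatzGieseker.coord p s f (i + 1) x) where
  homeo := isHomeomorph_frob p s f i
  basis := hx.localBasis_frob p s f i
  app_eq j := by
    have h1 : KatzGieseker.coord p s f (i + 1) x j =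
        ((twistStep p s f i).app _).hom (KatzGieseker.coord p s f i x j) :=
      congr($(Scheme.Hom.comp_app (twistStep p s f i) (twistProj p s f i) U).hom (x j))
    rw [h1]
    exact frob_app_twistStep p s f i (twistProj p s f i ⁻¹ᵁ U) (frob_preimage_twistProj p s f i U).le
      (KatzGieseker.coord p s f i x j)

theorem exists_isChart_twistProj [Smooth f] (i : ℕ) (y : twist p s f i) :
    ∃ (U : X.Opens) (d : ℕ) (x : Fin d → Γ(X, U)), y ∈ twistProj p s f i ⁻¹ᵁ U ∧ IsChart f U x := by
  obtain ⟨U, d, x, hy, hx⟩ := exists_isChart f (twistProj p s f i y)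
  exact ⟨U, d, x, hy, hx⟩

theorem isLevel_frobIter [Smooth f] (i : ℕ) :
    IsLevel f (frobIter p s f i) (twistHom p s f i) p i where
  homeo := isHomeomorph_frobIter p s f i
  comp := frobIter_twistHom p s f i
  char := natCast_eq_zero_of_over p (f ≫ s)
  linear {U D m} hD hm hlt := by
    obtain ⟨V₀, rfl⟩ := exists_preimage_eq (isHomeomorph_frobIter p s f i) U
    exact mem_endSections_of_preimage (isHomeomorph_frobIter p s f i) hD.1
      fun V h c a => apply_frobIter_mul p s f hlt hD hm _ c a
  chart y := by
    obtain ⟨U, d, x, hy, hx⟩ := exists_isChart_twistProj p s f i y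
    refine ⟨_, hy, (hx.coord p s f i).1, ?_, d, _, _, hx.monoBasis_frobIter p s f i⟩
    rw [frobIter_preimage_twistProj]
    exact hx.1

theorem isStep_frob [Smooth f] (i : ℕ) :
    IsStep (frobIter p s f i) (frob p s f i) (twistHom p s f i) (twistHom p s f (i + 1)) p i where
  homeo := isHomeomorph_frob p s f i
  comp := relFrobenius_hom p s _
  char := natCast_eq_zero_of_over p (twistHom p s f i ≫ s)
  chart z := by
    obtain ⟨U, d, x, hz, hx⟩ := exists_isChart_twistProj p s f (i + 1) z
    refine ⟨_, hz, d, iterCoord p s f (i + 1) x, _, _, ?_, hx.monoBasis_frob p s f i,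
      hx.monoBasis_frobIter p s f (i + 1)⟩
    have h := (hx.monoBasis_frobIter p s f i).restrict (frob_preimage_twistProj p s f i U).le
    simp only [resO_resO] at h
    exact h

/-! ### Sequences of Frobenius descents -/

variable (E : ∀ i, (twist p s f i).Modules)
    (σ : ∀ i, (Scheme.Modules.pullback (frob p s f i)).obj (E (i + 1)) ≅ E i)

/-- The adjoint `E (i+1) ⟶ F_* E i` of `σ i`. -/
def adjointMap (i : ℕ) : E (i + 1) ⟶ (Scheme.Modules.pushforward (frob p s f i)).obj (E i) :=
  (Scheme.Modules.pullbackPushforwardAdjunction (frob p s f i)).homEquiv _ _ (σ i).hom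

theorem modBasis_id {V₀ : X.Opens} (N : X.Modules) {I : Type} [Fintype I] [Unique I]
    (b : I → Γ(X, 𝟙 X ⁻¹ᵁ V₀)) (hb : b default = 1) :
    ModBasis (𝟙 X) ((Scheme.Modules.pushforwardId X).inv.app N) V₀ b := by
  intro V hV
  have hbij := (Equiv.funUnique I Γ(N, V)).bijective
  refine (congrArg Function.Bijective (funext fun c => ?_)).mpr hbij
  rw [Fintype.sum_unique, hb, map_one, one_smul]
  rfl

/-- Because `σ i` is an isomorphism, a basis of functions along the `i`-th Frobenius is a basis of
`E i` over `E (i+1)`. These bases are composed one Frobenius at a time, in step with the base `p`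
digits of exponents. -/
theorem IsChart.modBasis_descentMap {U : X.Opens} {d : ℕ} {x : Fin d → Γ(X, U)}
    (hx : IsChart f U x) : ∀ i, ModBasis (frobIter p s f i) (descentMap p s f E σ i)
      (twistProj p s f i ⁻¹ᵁ U) (iterMono p s f i x)
  | 0 => by
    have : Unique (Fin d → Fin (p ^ 0)) := by
      rw [pow_zero]
      infer_instance
    have h : ∀ α : Fin d → Fin (p ^ 0), iterMono p s f 0 x α = 1 := fun α =>
      Finset.prod_eq_one fun j _ => by
        rw [Nat.lt_one_iff.1 (lt_of_lt_of_eq (α j).is_lt (pow_zero p)), pow_zero]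
    exact modBasis_id _ _ (h _)
  | i + 1 => by
    have hiso : IsIso (((Scheme.Modules.pullbackPushforwardAdjunction (frob p s f i)).homEquiv _ _).symm
        (adjointMap p s f E σ i)) := by
      rw [adjointMap, Equiv.symm_apply_apply]
      infer_instance
    have h := ((IsChart.modBasis_descentMap hx i).comp (frob_preimage_twistProj p s f i U).le
      ((hx.localBasis_frob p s f i).modBasis_of_isIso_adjoint (isHomeomorph_frob p s f i)
        hiso)).reindex (digitsEquiv p d i)
    have e : iterMono p s f (i + 1) x = _ := funext fun α => iterMono_succ p s f i x α
    rw [e]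
    exact h

theorem hasCharts_descentMap [Smooth f] (i : ℕ) : HasCharts (descentMap p s f E σ i) (p ^ i) := by
  intro y
  obtain ⟨U, d, x, hy, hx⟩ := exists_isChart_twistProj p s f i y
  exact ⟨_, hy, d, _, _, hx.monoBasis_frobIter p s f i, hx.modBasis_descentMap p s f E σ i⟩

end Concrete

end KatzGieseker

end



noncomputable section

namespace KatzGieseker

/-! ### The stratification attached to a sequence of Frobenius descents -/

section Descent

variable {k : Type u} [Field k] (p : ℕ) [hp : Fact p.Prime] [CharP k p]
  {S X : Scheme.{u}} (s : S ⟶ Spec (.of k)) (f : X ⟶ S)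

theorem frobIter_app_twistHom_appLE (i : ℕ) {V : (twist p s f i).Opens} {T : S.Opens}
    (hT : V ≤ twistHom p s f i ⁻¹ᵁ T) (hT' : frobIter p s f i ⁻¹ᵁ V ≤ f ⁻¹ᵁ T) (t : Γ(S, T)) :
    ((frobIter p s f i).app V).hom (((twistHom p s f i).appLE T V hT).hom t) =
      (f.appLE T (frobIter p s f i ⁻¹ᵁ V) hT').hom t := by
  have e1 := Scheme.Hom.appLE_comp_appLE (frobIter p s f i) (twistHom p s f i) T V
    (frobIter p s f i ⁻¹ᵁ V) hT le_rfl
  simp only [frobIter_twistHom] at e1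
  rw [← e1, Scheme.Hom.appLE_eq_app]
  rfl

theorem frobIter_app_twistProj_appLE (i : ℕ) {V : (twist p s f i).Opens} {U : X.Opens}
    (hU : V ≤ twistProj p s f i ⁻¹ᵁ U) (hU' : frobIter p s f i ⁻¹ᵁ V ≤ U) (a : Γ(X, U)) :
    ((frobIter p s f i).app V).hom (((twistProj p s f i).appLE U V hU).hom a) =
      resO hU' a ^ p ^ i := by
  have e1 : ((twistProj p s f i).appLE U V hU).hom a =
      resO hU (((twistProj p s f i).app U).hom a) := rfl
  rw [e1, ← resO_app (frobIter p s f i) hU (preimage_le hU),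
    frobIter_app_twistProj p s f i U (frobIter_preimage_twistProj p s f i U).le, map_pow, resO_resO]

variable (E : ∀ i, (twist p s f i).Modules)
    (σ : ∀ i, (Scheme.Modules.pullback (frob p s f i)).obj (E (i + 1)) ≅ E i)

theorem rangeSet_descentMap_succ_subset (i : ℕ) (W : X.Opens) :
    rangeSet (descentMap p s f E σ (i + 1)) W ⊆ rangeSet (descentMap p s f E σ i) W := by
  rintro _ ⟨V, h, m, rfl⟩
  exact ⟨frob p s f i ⁻¹ᵁ V, h, onSections (adjointMap p s f E σ i) V m, rfl⟩

/-- Operators of order less than `p^i` are linear over `X^{(i)}` and act on `E⁰` with the image of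
`E^i` as horizontal sections. Uniqueness uses only that the image of `E^{i+1}` is contained in the
killed sections; existence also needs equality, which comes from comparing monomial expansions. -/
theorem exists_unique_stratification [Smooth f] :
    ∃! nab : Stratification f (E 0 : X.Modules), ∀ i,
      Identifies (frobIter p s f (i + 1)) (nab.killed (p ^ (i + 1)))
        (descentMap p s f E σ (i + 1)) := by
  have hmono := rangeSet_descentMap_succ_subset p s f E σ
  have huniq := fun i => (hasCharts_descentMap p s f E σ i).isLocallyTensor.actUnique
    (isHomeomorph_frobIter p s f i)
  have hex : ∀ (i : ℕ) (U : X.Opens) (D : OpFamily X U) (m : ℕ), D ∈ endSections f U →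
      IsOrderLE m U D → m < p ^ i → ∃ L, IsAct (rangeSet (descentMap p s f E σ i)) D L :=
    fun i U D m hD hm hlt => (hasCharts_descentMap p s f E σ i).isLocallyTensor.exists_isAct
      (isHomeomorph_frobIter p s f i) ((isLevel_frobIter p s f i).linear hD hm hlt)
  refine existsUnique_of_exists_of_unique
    ⟨stratificationOf hmono huniq hp.out.one_lt hex, fun i => ?_⟩ fun nab nab' hnab hnab' => ?_
  · exact (hasCharts_descentMap p s f E σ (i + 1)).identifies (isLevel_frobIter p s f (i + 1)) _
      (onSections_mem_killed (isHomeomorph_frobIter p s f (i + 1)) _ fun U D m hD hm b e he =>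
        stratificationOf_smul hmono huniq hp.out.one_lt hex D hD hm b he)
  · exact stratification_unique hmono huniq hp.out.one_lt (fun i => (hnab i).rangeSet_subset)
      fun i => (hnab' i).rangeSet_subset

end Descent

end KatzGieseker

end

/-! ### The theorem, from the facts on levels, consecutive steps and descents -/

theorem theorem1p2 {k : Type u} [Field k] (p : ℕ) [Fact p.Prime] [CharP k p]
    {X S : Scheme.{u}} (s : S ⟶ Spec (.of k)) (f : X ⟶ S) [Smooth f] :
    -- stratified sheaves
    (∀ (E : X.Modules), E.IsQuasicoherent → ∀ (nab : Stratification f E),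
      ∃ (M : ∀ i, (twist p s f i).Modules)
        (ι : ∀ i, M i ⟶ (Scheme.Modules.pushforward (frobIter p s f i)).obj E)
        (c : ∀ i, Connection (twistHom p s f i) (M i)),
        -- `E^{(i)}` is a subsheaf of `E`, and is a sheaf of modules `M i` on `X^{(i)}`
        (∀ i, IsSubsheafOverBase f E (nab.killed (p ^ i)) ∧
          Identifies (frobIter p s f i) (nab.killed (p ^ i)) (ι i) ∧
          (M i).IsQuasicoherent) ∧
        -- the action is `(t ⊗ a) e = t a ^ (p ^ i) e`
        (∀ (i : ℕ) (V : (twist p s f i).Opens) (T : S.Opens) (U : X.Opens)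
          (hT : V ≤ twistHom p s f i ⁻¹ᵁ T) (hU : V ≤ twistProj p s f i ⁻¹ᵁ U),
          ∃ (hT' : frobIter p s f i ⁻¹ᵁ V ≤ f ⁻¹ᵁ T) (hU' : frobIter p s f i ⁻¹ᵁ V ≤ U),
          ∀ (t : Γ(S, T)) (a : Γ(X, U)) (m : Γ(M i, V)),
            onSections (ι i) V ((((twistHom p s f i).appLE T V hT).hom t *
                ((twistProj p s f i).appLE U V hU).hom a) • m) =
              ((f.appLE T (frobIter p s f i ⁻¹ᵁ V) hT').hom t * resO hU' a ^ p ^ i) •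
                onSections (ι i) V m) ∧
        -- the connection on `E^{(i)}` induced by the stratification
        (∀ i, nab.Induces (p ^ i) (frobIter p s f i) (twistHom p s f i) (ι i) (c i) ∧
          (∀ c' : Connection (twistHom p s f i) (M i),
            nab.Induces (p ^ i) (frobIter p s f i) (twistHom p s f i) (ι i) c' → c' = c i) ∧
          (c i).IsIntegrable ∧ (c i).PCurvatureZero p) ∧
        -- `E^{(i+1)}` is the kernel of the connection on `E^{(i)}`, and `F^* E^{(i+1)} ≅ E^{(i)}`
        (∀ i, ∃ j : M (i + 1) ⟶ (Scheme.Modules.pushforward (frob p s f i)).obj (M i),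
          j ≫ (Scheme.Modules.pushforward (frob p s f i)).map (ι i) ≫
            (Scheme.Modules.pushforwardComp (frobIter p s f i) (frob p s f i)).hom.app E =
              ι (i + 1) ∧
          (∀ V : (twist p s f (i + 1)).Opens,
            Set.range (onSections j V) = (c i).ker (frob p s f i ⁻¹ᵁ V)) ∧
          IsIso (((Scheme.Modules.pullbackPushforwardAdjunction
            (frob p s f i)).homEquiv _ _).symm j))) ∧
    -- sequences of Frobenius descents
    (∀ (E : ∀ i, (twist p s f i).Modules), (∀ i, (E i).IsQuasicoherent) →
      ∀ (σ : ∀ i, (Scheme.Modules.pullback (frob p s f i)).obj (E (i + 1)) ≅ E i),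
      ∃! nab : Stratification f (E 0 : X.Modules), ∀ i,
        Identifies (frobIter p s f (i + 1)) (nab.killed (p ^ (i + 1)))
          (descentMap p s f E σ (i + 1))) := by
  refine ⟨fun E hE nab => ?_, fun E _ σ => exists_unique_stratification p s f E σ⟩
  have lv := isLevel_frobIter p s f
  have st := isStep_frob p s f
  refine ⟨fun i => (lv i).killedM nab, fun i => (lv i).killedHom nab,
    fun i => (st i).connection (lv i) (lv (i + 1)) nab, fun i => ⟨?_, ?_, ?_⟩,
    fun i V T U hT hU => ?_, fun i => ⟨?_, ?_, ?_, ?_⟩, fun i =>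
      ⟨IsStep.stepHom (lv i) (lv (i + 1)) nab, ?_, ?_, ?_⟩⟩
  · exact nab.isSubsheafOverBase_killed
  · exact (lv i).identifies_killedHom nab
  · exact (lv i).isQuasicoherent_killedM nab
  · have hT' := (preimage_le hT).trans (frobIter_preimage_twistHom p s f i T).le
    have hU' := (preimage_le hU).trans (frobIter_preimage_twistProj p s f i U).le
    refine ⟨hT', hU', fun t a m => ?_⟩
    rw [onSections_smul, map_mul, frobIter_app_twistHom_appLE p s f i hT hT',
      frobIter_app_twistProj_appLE p s f i hU hU']
  · exact (st i).induces_connection (lv i) (lv (i + 1)) nab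
  · exact fun c' hc' => (st i).connection_unique (lv i) (lv (i + 1)) nab c' hc'
  · exact connectionOf_integrable _ _
  · exact connectionOf_pCurvatureZero _ _ p
  · exact IsStep.compOn_stepHom (lv i) (lv (i + 1)) nab
  · exact (st i).range_stepHom (lv i) (lv (i + 1)) nab
  · exact ((st i).isLocallyTensor_stepHom (lv i) (lv (i + 1)) nab).isIso_adjoint
      (isHomeomorph_frob p s f i)
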